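/- **Conventions.** A *Vaisman manifold* is a Hermitian manifold $(M,g,J)$ ($J$ integrable, $\dim_{\mathbf R}M\ge 4$) with a closed $1$-form $\theta\neq 0$ (the Lee form) such that the fundamental form $\Omega(X,Y)=g(X,JY)$ satisfies $d\Omega=\Omega\wedge\theta$ and the Lee field $\xi$, defined by $g(\xi,\cdot)=\theta$, is a Killing field. Its automorphisms are the holomorphic isometries. A *Sasaki manifold* is a manifold with a contact form $\phi$, Reeb field $\eta$ ($\phi(\eta)=1$, $i(\eta)d\phi=0$), a $(1,1)$-tensor $\widetilde J$ with $\widetilde J^2=-I+\phi\otimes\eta$ and a Riemannian metric $g(X,Y)=\phi(X)\phi(Y)+d\phi(X,\widetilde JY)$, such that $\eta$ is Killing and $J=\widetilde J|_{\ker\phi}$ is an integrable CR structure. Its automorphisms are the diffeomorphisms which preserve $\phi$ and commute with $J$ on $\ker\phi$. A *simply connected homogeneous Vaisman (resp. Sasaki) manifold* $M=G/H$ is here a Vaisman (resp. Sasaki) manifold $M$ with a smooth transitive action by automorphisms of a simply connected Lie group $G$, such that the isotropy group $H$ of the base point $o\in M$ is connected, $M$ carries the manifold structure of $G/H$, and the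 action is almost effective, i.e. the Lie algebra $\mathfrak h$ of $H$ contains no nonzero ideal of the Lie algebra $\mathfrak g$ of $G$. Thus $T_oM=\mathfrak g/\mathfrak h$, which carries the metric $g$ and the endomorphism $J$ (resp. $\widetilde J$). A *modification step* passes from $(\mathfrak g,\mathfrak h)$ to a pair $(\mathfrak g',\mathfrak h')$ with $\mathfrak g'/\mathfrak h'=\mathfrak g/\mathfrak h$ as follows. Let $\mathfrak k\subset\mathrm{Der}(\mathfrak g)$ be a subalgebra of derivations $\sigma$ with $\sigma(\mathfrak h)\subset\mathfrak h$ which induce on $\mathfrak g/\mathfrak h$ endomorphisms that are skew-symmetric for $g$ and commute with $J$ (resp. $\widetilde J$). Up to isomorphism, either $\mathfrak g'=\mathfrak g\rtimes\mathfrak k$ and $\mathfrak h'=\mathfrak h\rtimes\mathfrak k$; or $\mathfrak k$ is abelian, $\mathfrak g'$ is a subalgebra of $\mathfrak g\rtimes\mathfrak k$ of the form $\{(X,\varphi(X)) : X\in\mathfrak g\}$ with $\varphi:\mathfrak g\to\mathfrak k$ linear, and $\mathfrak h'=\mathfrak g'\cap(\mathfrak h\rtimes\mathfrak k)$. In both cases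 $\mathfrak g'/\mathfrak h'$ is identified with $(\mathfrak g\rtimes\mathfrak k)/(\mathfrak h\rtimes\mathfrak k)=\mathfrak g/\mathfrak h$. A *modification* is a finite (possibly empty) sequence of modification steps. **Lemma.** (1) Let $M=G/H$ be a simply connected homogeneous Vaisman manifold, with $G$ simply connected and $H$ connected. Then there are a simply connected Lie group $G'$ and a connected closed subgroup $H'$, with Lie algebras $\mathfrak g',\mathfrak h'$, such that $(\mathfrak g',\mathfrak h')$ is a modification of $(\mathfrak g,\mathfrak h)$, $$\dim Z(\mathfrak g')=2,\qquad \dim\mathfrak h'\le\dim\mathfrak h+1,$$ and $M=G'/H'$ as a homogeneous Vaisman manifold: $G'$ acts smoothly, transitively and almost effectively on $M$ by automorphisms, with isotropy group $H'$ at $o$ and $M\cong G'/H'$ as a manifold. (2) Let $M=G/H$ be a simply connected homogeneous Sasaki manifold, with $G$ simply connected and $H$ connected. Then there are a simply connected Lie group $G'$ and a connected closed subgroup $H'$, with Lie algebras $\mathfrak g',\mathfrak h'$, such that $(\mathfrak g',\mathfrak h')$ is a modification of $(\mathfrak g,\mathfrak h)$, $\dim Z(\mathfrak g')=1$, and $M=G'/H'$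 as a homogeneous Sasaki manifold, in the same sense. -/

import Mathlib

open Module Bundle VectorField
open scoped Manifold ContDiff

universe u v w z

section Calculus

variable {F : Type w} [NormedAddCommGroup F] [NormedSpace ℝ F]
  {M : Type z} [TopologicalSpace M] [ChartedSpace F M]

/-- A smooth (globally defined) vector field on `M`. -/
def IsSmoothVF [IsManifold 𝓘(ℝ, F) ∞ M] (X : ∀ x : M, TangentSpace 𝓘(ℝ, F) x) : Prop :=
  ContMDiff 𝓘(ℝ, F) (𝓘(ℝ, F).prod 𝓘(ℝ, F)) ∞
    (fun x => TotalSpace.mk' F (E := (TangentSpace 𝓘(ℝ, F) : M → Type w)) x (X x))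

/-- A smooth 1-form on `M`. -/
def IsSmoothOneForm [IsManifold 𝓘(ℝ, F) ∞ M]
    (α : ∀ x : M, TangentSpace 𝓘(ℝ, F) x →L[ℝ] ℝ) : Prop :=
  ContMDiff 𝓘(ℝ, F) (𝓘(ℝ, F).prod 𝓘(ℝ, F →L[ℝ] ℝ)) ∞
    (fun x => TotalSpace.mk' (F →L[ℝ] ℝ)
      (E := fun x : M => TangentSpace 𝓘(ℝ, F) x →L[ℝ] Bundle.Trivial M ℝ x) x (α x))

/-- A smooth `(1,1)`-tensor field on `M`. -/
def IsSmoothEndo [IsManifold 𝓘(ℝ, F) ∞ M]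
    (J : ∀ x : M, TangentSpace 𝓘(ℝ, F) x →L[ℝ] TangentSpace 𝓘(ℝ, F) x) : Prop :=
  ContMDiff 𝓘(ℝ, F) (𝓘(ℝ, F).prod 𝓘(ℝ, F →L[ℝ] F)) ∞
    (fun x => TotalSpace.mk' (F →L[ℝ] F)
      (E := fun x : M => TangentSpace 𝓘(ℝ, F) x →L[ℝ] TangentSpace 𝓘(ℝ, F) x) x (J x))

/-- The derivative `X f` of a real function `f` along the vector field `X`. -/
noncomputable def dirDeriv (X : ∀ x : M, TangentSpace 𝓘(ℝ, F) x) (f : M → ℝ) (x : M) : ℝ :=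
  (mfderiv 𝓘(ℝ, F) 𝓘(ℝ, ℝ) f x : TangentSpace 𝓘(ℝ, F) x → ℝ) (X x)

/-- The exterior derivative of a 1-form:
`dα(X,Y) = X(α(Y)) - Y(α(X)) - α([X,Y])`. -/
noncomputable def extDerivOne (α : ∀ x : M, TangentSpace 𝓘(ℝ, F) x →L[ℝ] ℝ)
    (X Y : ∀ x : M, TangentSpace 𝓘(ℝ, F) x) (x : M) : ℝ :=
  dirDeriv X (fun y => α y (Y y)) x - dirDeriv Y (fun y => α y (X y)) x
    - α x (mlieBracket 𝓘(ℝ, F) X Y x)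

/-- The exterior derivative of a 2-form:
`dβ(X,Y,Z) = X(β(Y,Z)) + Y(β(Z,X)) + Z(β(X,Y)) - β([X,Y],Z) - β([Y,Z],X) - β([Z,X],Y)`. -/
noncomputable def extDerivTwo
    (β : ∀ x : M, TangentSpace 𝓘(ℝ, F) x → TangentSpace 𝓘(ℝ, F) x → ℝ)
    (X Y Z : ∀ x : M, TangentSpace 𝓘(ℝ, F) x) (x : M) : ℝ :=
  dirDeriv X (fun y => β y (Y y) (Z y)) x + dirDeriv Y (fun y => β y (Z y) (X y)) x
    + dirDeriv Z (fun y => β y (X y) (Y y)) x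
    - β x (mlieBracket 𝓘(ℝ, F) X Y x) (Z x) - β x (mlieBracket 𝓘(ℝ, F) Y Z x) (X x)
    - β x (mlieBracket 𝓘(ℝ, F) Z X x) (Y x)

/-- A smooth Riemannian metric on `M`. -/
abbrev RMetric (F : Type w) [NormedAddCommGroup F] [NormedSpace ℝ F]
    (M : Type z) [TopologicalSpace M] [ChartedSpace F M] [IsManifold 𝓘(ℝ, F) ∞ M] :=
  ContMDiffRiemannianMetric 𝓘(ℝ, F) ∞ F (TangentSpace 𝓘(ℝ, F) : M → Type w)

/-- The vector field `ξ` is a Killing field of `g`: `L_ξ g = 0`, that is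
`ξ(g(X,Y)) = g([ξ,X],Y) + g(X,[ξ,Y])` for all smooth vector fields `X, Y`. -/
def IsKillingField [IsManifold 𝓘(ℝ, F) ∞ M] (g : RMetric F M)
    (ξ : ∀ x : M, TangentSpace 𝓘(ℝ, F) x) : Prop :=
  ∀ X Y : ∀ x : M, TangentSpace 𝓘(ℝ, F) x, IsSmoothVF X → IsSmoothVF Y → ∀ x,
    dirDeriv ξ (fun y => g.inner y (X y) (Y y)) x
      = g.inner x (mlieBracket 𝓘(ℝ, F) ξ X x) (Y x)
        + g.inner x (X x) (mlieBracket 𝓘(ℝ, F) ξ Y x)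

end Calculus

/-- A Vaisman structure on the smooth manifold `M`: a locally conformally Kähler structure
`(g, J)`, with Lee form `θ ≠ 0`, whose Lee field `ξ` (the `g`-dual of `θ`) is Killing.
As usual for l.c.K. manifolds, the complex dimension is at least two. -/
structure VaismanStructure (F : Type w) [NormedAddCommGroup F] [NormedSpace ℝ F]
    (M : Type z) [TopologicalSpace M] [ChartedSpace F M] [IsManifold 𝓘(ℝ, F) ∞ M] where
  /-- the metric -/
  g : RMetric F M
  /-- the complex structure -/
  J : ∀ x : M, TangentSpace 𝓘(ℝ, F) x →L[ℝ] TangentSpace 𝓘(ℝ, F) x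
  /-- the Lee form -/
  θ : ∀ x : M, TangentSpace 𝓘(ℝ, F) x →L[ℝ] ℝ
  /-- the Lee field -/
  ξ : ∀ x : M, TangentSpace 𝓘(ℝ, F) x
  four_le_dim : 4 ≤ finrank ℝ F
  smooth_J : IsSmoothEndo J
  smooth_θ : IsSmoothOneForm θ
  J_sq : ∀ x (X : TangentSpace 𝓘(ℝ, F) x), J x (J x X) = -X
  /-- the Nijenhuis tensor of `J` vanishes -/
  integrable : ∀ X Y : ∀ x : M, TangentSpace 𝓘(ℝ, F) x, IsSmoothVF X → IsSmoothVF Y → ∀ x,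
    mlieBracket 𝓘(ℝ, F) (fun y => J y (X y)) (fun y => J y (Y y)) x
      - mlieBracket 𝓘(ℝ, F) X Y x
      - J x (mlieBracket 𝓘(ℝ, F) (fun y => J y (X y)) Y x)
      - J x (mlieBracket 𝓘(ℝ, F) X (fun y => J y (Y y)) x) = 0
  /-- `g` is Hermitian -/
  hermitian : ∀ x (X Y : TangentSpace 𝓘(ℝ, F) x), g.inner x (J x X) (J x Y) = g.inner x X Y
  /-- `θ` is closed -/
  closed : ∀ X Y : ∀ x : M, TangentSpace 𝓘(ℝ, F) x, IsSmoothVF X → IsSmoothVF Y → ∀ x,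
    extDerivOne θ X Y x = 0
  /-- `dΩ = Ω ∧ θ` for the fundamental form `Ω(X,Y) = g(X,JY)` -/
  lck : ∀ X Y Z : ∀ x : M, TangentSpace 𝓘(ℝ, F) x,
    IsSmoothVF X → IsSmoothVF Y → IsSmoothVF Z → ∀ x,
    extDerivTwo (fun y U V => g.inner y U (J y V)) X Y Z x
      = g.inner x (X x) (J x (Y x)) * θ x (Z x) + g.inner x (Y x) (J x (Z x)) * θ x (X x)
        + g.inner x (Z x) (J x (X x)) * θ x (Y x)
  lee_ne_zero : ∃ x, θ x ≠ 0
  lee_dual : ∀ x (X : TangentSpace 𝓘(ℝ, F) x), g.inner x (ξ x) X = θ x X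
  killing : IsKillingField g ξ

/-- A Sasaki structure on the smooth manifold `M`. -/
structure SasakiStructure (F : Type w) [NormedAddCommGroup F] [NormedSpace ℝ F]
    (M : Type z) [TopologicalSpace M] [ChartedSpace F M] [IsManifold 𝓘(ℝ, F) ∞ M] where
  /-- the contact form -/
  φ : ∀ x : M, TangentSpace 𝓘(ℝ, F) x →L[ℝ] ℝ
  /-- the Reeb field -/
  η : ∀ x : M, TangentSpace 𝓘(ℝ, F) x
  /-- the `(1,1)`-tensor, extending by `0` on `η` the complex structure of `ker φ` -/
  J : ∀ x : M, TangentSpace 𝓘(ℝ, F) x →L[ℝ] TangentSpace 𝓘(ℝ, F) x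
  /-- the metric -/
  g : RMetric F M
  smooth_φ : IsSmoothOneForm φ
  smooth_η : IsSmoothVF η
  smooth_J : IsSmoothEndo J
  /-- `φ` is a contact form: `φ ∧ (dφ)^n ≠ 0` everywhere, i.e. no nonzero tangent vector is
  annihilated by both `φ` and `dφ` -/
  contact : ∀ (X : ∀ x : M, TangentSpace 𝓘(ℝ, F) x) (x : M), IsSmoothVF X →
    φ x (X x) = 0 → (∀ Y : ∀ x : M, TangentSpace 𝓘(ℝ, F) x, IsSmoothVF Y →
      extDerivOne φ X Y x = 0) → X x = 0
  φ_η : ∀ x, φ x (η x) = 1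
  dφ_η : ∀ X : ∀ x : M, TangentSpace 𝓘(ℝ, F) x, IsSmoothVF X → ∀ x, extDerivOne φ η X x = 0
  J_sq : ∀ x (X : TangentSpace 𝓘(ℝ, F) x), J x (J x X) = -X + φ x X • η x
  metric_eq : ∀ X Y : ∀ x : M, TangentSpace 𝓘(ℝ, F) x, IsSmoothVF X → IsSmoothVF Y → ∀ x,
    g.inner x (X x) (Y x) = φ x (X x) * φ x (Y x) + extDerivOne φ X (fun y => J y (Y y)) x
  killing : IsKillingField g η
  /-- `J` restricted to `ker φ` is an integrable CR structure -/
  cr_integrable : ∀ X Y : ∀ x : M, TangentSpace 𝓘(ℝ, F) x, IsSmoothVF X → IsSmoothVF Y →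
    (∀ x, φ x (X x) = 0) → (∀ x, φ x (Y x) = 0) → ∀ x,
    φ x (mlieBracket 𝓘(ℝ, F) X Y x
        - mlieBracket 𝓘(ℝ, F) (fun y => J y (X y)) (fun y => J y (Y y)) x) = 0 ∧
    J x (mlieBracket 𝓘(ℝ, F) X Y x
        - mlieBracket 𝓘(ℝ, F) (fun y => J y (X y)) (fun y => J y (Y y)) x)
      = mlieBracket 𝓘(ℝ, F) (fun y => J y (X y)) Y x
        + mlieBracket 𝓘(ℝ, F) X (fun y => J y (Y y)) x

section Automorphisms

variable {F : Type w} [NormedAddCommGroup F] [NormedSpace ℝ F]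
  {M : Type z} [TopologicalSpace M] [ChartedSpace F M] [IsManifold 𝓘(ℝ, F) ∞ M]

/-- The map `Ψ` is a holomorphic isometry of the Vaisman manifold `M` (to be used for
diffeomorphisms `Ψ`). -/
def VaismanStructure.IsAutomorphism (S : VaismanStructure F M) (Ψ : M → M) : Prop :=
  ∀ x (X : TangentSpace 𝓘(ℝ, F) x),
    (∀ Y : TangentSpace 𝓘(ℝ, F) x,
      S.g.inner (Ψ x) (mfderiv 𝓘(ℝ, F) 𝓘(ℝ, F) Ψ x X) (mfderiv 𝓘(ℝ, F) 𝓘(ℝ, F) Ψ x Y)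
        = S.g.inner x X Y) ∧
    mfderiv 𝓘(ℝ, F) 𝓘(ℝ, F) Ψ x (S.J x X) = S.J (Ψ x) (mfderiv 𝓘(ℝ, F) 𝓘(ℝ, F) Ψ x X)

/-- The map `Ψ` preserves the contact form and commutes with `J` on its kernel (to be used for
diffeomorphisms `Ψ`). -/
def SasakiStructure.IsAutomorphism (S : SasakiStructure F M) (Ψ : M → M) : Prop :=
  ∀ x (X : TangentSpace 𝓘(ℝ, F) x),
    S.φ (Ψ x) (mfderiv 𝓘(ℝ, F) 𝓘(ℝ, F) Ψ x X) = S.φ x X ∧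
    (S.φ x X = 0 →
      mfderiv 𝓘(ℝ, F) 𝓘(ℝ, F) Ψ x (S.J x X) = S.J (Ψ x) (mfderiv 𝓘(ℝ, F) 𝓘(ℝ, F) Ψ x X))

end Automorphisms

section LieGroups

variable {E : Type v} [NormedAddCommGroup E] [NormedSpace ℝ E]
  {G : Type u} [TopologicalSpace G] [ChartedSpace E G] [Group G]

instance lieGroup_minSmoothness [LieGroup 𝓘(ℝ, E) ∞ G] :
    LieGroup 𝓘(ℝ, E) (minSmoothness ℝ 3) G :=
  LieGroup.of_le (n := ∞) (by
    rw [minSmoothness_of_isRCLikeNormedField]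
    exact ENat.LEInfty.out)

/-- For a smooth action of `G` on `M` and `o ∈ M`, the differential at `1` of the orbit map
`a ↦ a • o`. For `M = G/H` it is the projection `𝔤 → 𝔤/𝔥 = T_o M`, with kernel `𝔥`. -/
noncomputable def orbitDeriv (E : Type v) [NormedAddCommGroup E] [NormedSpace ℝ E]
    (G : Type u) [TopologicalSpace G] [ChartedSpace E G] [Group G]
    (F : Type w) [NormedAddCommGroup F] [NormedSpace ℝ F]
    {M : Type z} [TopologicalSpace M] [ChartedSpace F M] [MulAction G M] (o : M) :
    GroupLieAlgebra 𝓘(ℝ, E) G →ₗ[ℝ] TangentSpace 𝓘(ℝ, F) o :=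
  (mfderiv 𝓘(ℝ, E) 𝓘(ℝ, F) (fun a : G => a • o) 1 : E →L[ℝ] F).toLinearMap

end LieGroups

/-- A presentation `M = G/H` of the manifold `M`, with base point `o`, as a homogeneous space of
a simply connected Lie group `G`, where `H`, the isotropy group of `o`, is connected. The last
two fields say that `M` carries the manifold structure of `G/H` (the orbit map is a submersion),
and that `G/H` is (almost) effective (the isotropy algebra contains no nonzero ideal). -/
structure HomogeneousPresentation (F : Type w) [NormedAddCommGroup F] [NormedSpace ℝ F]
    {M : Type z} [TopologicalSpace M] [ChartedSpace F M] (o : M) where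
  /-- the model space of `G` -/
  E : Type v
  [normedAddCommGroup : NormedAddCommGroup E]
  [normedSpace : NormedSpace ℝ E]
  [finiteDimensional : FiniteDimensional ℝ E]
  [completeSpace : CompleteSpace E]
  /-- the Lie group -/
  G : Type u
  [group : Group G]
  [topologicalSpace : TopologicalSpace G]
  [chartedSpace : ChartedSpace E G]
  [lieGroup : LieGroup 𝓘(ℝ, E) ∞ G]
  [simplyConnected : SimplyConnectedSpace G]
  [action : MulAction G M]
  [smoothAction : ContMDiffSMul 𝓘(ℝ, E) 𝓘(ℝ, F) ∞ G M]
  [transitive : MulAction.IsPretransitive G M]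
  isotropy_connected : IsConnected (MulAction.stabilizer G o : Set G)
  submersion : Function.Surjective (orbitDeriv E G F o)
  almost_effective : ∀ I : LieIdeal ℝ (GroupLieAlgebra 𝓘(ℝ, E) G),
    (∀ X ∈ I, orbitDeriv E G F o X = 0) → I = ⊥

namespace HomogeneousPresentation

attribute [instance] normedAddCommGroup normedSpace finiteDimensional completeSpace group
  topologicalSpace chartedSpace lieGroup simplyConnected action smoothAction transitive

end HomogeneousPresentation

/-- A pair `(𝔤, 𝔥)` together with an identification of `𝔤/𝔥` with the vector space `V`: it is
given by a linear projection `𝔤 → V`, and `𝔥` is its kernel. -/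
structure LiePair (V : Type w) [AddCommGroup V] [Module ℝ V] where
  /-- the Lie algebra -/
  𝔤 : Type v
  [lieRing : LieRing 𝔤]
  [lieAlgebra : LieAlgebra ℝ 𝔤]
  /-- the projection `𝔤 → 𝔤/𝔥` -/
  proj : 𝔤 →ₗ[ℝ] V

attribute [instance] LiePair.lieRing LiePair.lieAlgebra

/-- One modification of a pair `(𝔤, 𝔥)` into `(𝔤', 𝔥')`, with respect to the metric `g` and the
endomorphism `J` on `V = 𝔤/𝔥`. There is a subalgebra `𝔨` of `Der 𝔤` consisting of derivations `σ`
which preserve `𝔥` and which are, modulo `𝔥`, skew-symmetric and compatible with `J`. Either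
`𝔤' = 𝔤 ⋊ 𝔨`, or `𝔨` is abelian and `𝔤'` is a subalgebra of `𝔤 ⋊ 𝔨` of the form
`{(X, φ(X)) | X ∈ 𝔤}`. In both cases the projection `𝔤' → V` comes from
`(𝔤 ⋊ 𝔨)/(𝔥 ⋊ 𝔨) = 𝔤/𝔥`. -/
def LiePair.IsModificationStep {V : Type w} [AddCommGroup V] [Module ℝ V]
    (g : V → V → ℝ) (J : V → V) (P P' : LiePair.{v} V) : Prop :=
  ∃ k : LieSubalgebra ℝ (LieDerivation ℝ P.𝔤 P.𝔤),
    (∀ σ ∈ k, ∃ τ : V →ₗ[ℝ] V, (∀ X, P.proj (σ X) = τ (P.proj X)) ∧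
      (∀ x y, g (τ x) y + g x (τ y) = 0) ∧ ∀ x, J (τ x) = τ (J x)) ∧
    ∃ f : P'.𝔤 →ₗ⁅ℝ⁆ LieAlgebra.SemiDirectSum P.𝔤 k k.incl,
      (∀ X, P'.proj X = P.proj (f X).left) ∧
      (Function.Bijective f ∨
        (IsLieAbelian k ∧ Function.Bijective fun X => (f X).left))

/-- `(𝔤', 𝔥')` is obtained from `(𝔤, 𝔥)` by finitely many (possibly no) modifications. -/
def LiePair.IsModification {V : Type w} [AddCommGroup V] [Module ℝ V]
    (g : V → V → ℝ) (J : V → V) : LiePair.{v} V → LiePair.{v} V → Prop :=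
  Relation.ReflTransGen (LiePair.IsModificationStep g J)

namespace HomogeneousPresentation

variable {F : Type w} [NormedAddCommGroup F] [NormedSpace ℝ F]
  {M : Type z} [TopologicalSpace M] [ChartedSpace F M] {o : M}

/-- The Lie algebra `𝔤` of `G`. -/
abbrev lieAlg (P : HomogeneousPresentation.{u, v} F o) : Type v := GroupLieAlgebra 𝓘(ℝ, P.E) P.G

/-- The pair `(𝔤, 𝔥)`, with `𝔤/𝔥` identified with `T_o M`. -/
noncomputable def pair (P : HomogeneousPresentation.{u, v} F o) :
    LiePair.{v} (TangentSpace 𝓘(ℝ, F) o) where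
  𝔤 := P.lieAlg
  proj := orbitDeriv P.E P.G F o

/-- The dimension of the isotropy algebra `𝔥`. -/
noncomputable def isotropyDim (P : HomogeneousPresentation.{u, v} F o) : ℕ :=
  finrank ℝ (LinearMap.ker (orbitDeriv P.E P.G F o))

/-- The dimension of the center `Z(𝔤)`. -/
noncomputable def centerDim (P : HomogeneousPresentation.{u, v} F o) : ℕ :=
  finrank ℝ (LieAlgebra.center ℝ P.lieAlg)

end HomogeneousPresentation

/-!
# Modifications of homogeneous Vaisman and Sasaki manifolds

Let `M = G/H` be homogeneous Vaisman, with Lee field `ξ` and Lee form `θ`. The structure equation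
`dΩ = Ω ∧ θ` determines `θ`, so `G` preserves `θ`, `ξ` and `Jξ`. Both fields are infinitesimal
automorphisms (`VaismanStructure.leeField_isInvariantAutField`,
`VaismanStructure.rotatedLeeField_isInvariantAutField`), so their flows, which are complete because
`M` is homogeneous (`exists_isEquivariantFlow`), commute with `G` and consist of automorphisms. A
central element `W` of `𝔤` induces a field that, by the structure equation, is a combination of `ξ`
and `Jξ` (`VaismanStructure.fund_of_central`). By almost effectiveness the center embeds into
`T_o M`, hence its dimension is two as soon as central elements represent both fields at `o`
(`VaismanStructure.centerDim_eq_two`). This is achieved in two steps.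

* The Lee field. As `θ` is closed and invariant, `Y ↦ θ(Y*)/θ(ξ)` is a linear form on `𝔤` that kills
  brackets and the isotropy algebra. Since `G` is simply connected, it is the differential of a
  character `χ` (`exists_character`). Choose `X ∈ 𝔤` representing `ξ` at `o`, and let `ψ` be the
  flow of `ξ`. The elements `x ↦ a exp(-χ(a) X) ψ_{χ(a)}(x)`, for `a ∈ G`, of the group of
  automorphisms that is generated by `G` and `ψ` are again a group with the underlying manifold `G`
  (`TwistData.Twisted`), and with the same orbit map at `o`, because `ψ_t(o) = exp(t X) o`. In its
  Lie algebra, `X` is central. The isotropy group does not change, and the pair of Lie algebras is a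
  modification of the second kind by the derivation `ad X` (`HomogeneousPresentation.twist`).
* The rotated Lee field. If no central element represents `Jξ` at `o`, replace `G` by `G × ℝ`, where
  `ℝ` acts by the flow of `Jξ`. This adds one dimension to the isotropy group, and is a modification
  of the first kind by a derivation `ad X` (`HomogeneousPresentation.prodReal`).

For a homogeneous Sasaki manifold, central elements represent multiples of the Reeb field
(`SasakiStructure.fund_of_central`), and the second step for the Reeb field suffices.

Tangent vectors and elements of Lie algebras are taken as elements of the model spaces throughout;
`mder`, `mbr`, `lbr` and `fund` are the differential, the bracket of vector fields, the bracket of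
the Lie algebra, and the fundamental fields in these terms.
-/

set_option linter.unusedSectionVars false

open Set Filter Topology

/-! ### Differentials and brackets in the model space -/

section Derivative

variable {E : Type*} [NormedAddCommGroup E] [NormedSpace ℝ E]
  {F : Type*} [NormedAddCommGroup F] [NormedSpace ℝ F]
  {F' : Type*} [NormedAddCommGroup F'] [NormedSpace ℝ F']
  {N : Type*} [TopologicalSpace N] [ChartedSpace E N]
  {M : Type*} [TopologicalSpace M] [ChartedSpace F M]
  {M' : Type*} [TopologicalSpace M'] [ChartedSpace F' M']

/-- The differential of a map between manifolds, as a linear map between the model spaces: the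
tangent space at any point of a manifold modelled on `F` is definitionally equal to `F`. -/
noncomputable def mder (F : Type*) [NormedAddCommGroup F] [NormedSpace ℝ F]
    (F' : Type*) [NormedAddCommGroup F'] [NormedSpace ℝ F']
    {M : Type*} [TopologicalSpace M] [ChartedSpace F M]
    {M' : Type*} [TopologicalSpace M'] [ChartedSpace F' M']
    (f : M → M') (x : M) : F →L[ℝ] F' := mfderiv 𝓘(ℝ, F) 𝓘(ℝ, F') f x

/-- Differentiability of a map between manifolds modelled on normed spaces. -/
abbrev MDAt (F : Type*) [NormedAddCommGroup F] [NormedSpace ℝ F]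
    (F' : Type*) [NormedAddCommGroup F'] [NormedSpace ℝ F']
    {M : Type*} [TopologicalSpace M] [ChartedSpace F M]
    {M' : Type*} [TopologicalSpace M'] [ChartedSpace F' M']
    (f : M → M') (x : M) : Prop := MDifferentiableAt 𝓘(ℝ, F) 𝓘(ℝ, F') f x

lemma mder_comp {g : M → M'} {f : N → M} (x : N) (hg : MDAt F F' g (f x)) (hf : MDAt E F f x) :
    mder E F' (g ∘ f) x = (mder F F' g (f x)).comp (mder E F f x) :=
  mfderiv_comp x hg hf

lemma mder_comp' {g : M → M'} {f : N → M} (x : N) (hg : MDAt F F' g (f x)) (hf : MDAt E F f x)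
    (v : E) :
    mder E F' (fun y => g (f y)) x v = mder F F' g (f x) (mder E F f x v) :=
  congrArg (fun L : E →L[ℝ] F' => L v) (mder_comp x hg hf)

lemma mder_id (x : M) : mder F F (fun y : M => y) x = ContinuousLinearMap.id ℝ F := mfderiv_id

lemma mder_const (c : M') (x : M) : mder F F' (fun _ : M => c) x = (0 : F →L[ℝ] F') := mfderiv_const

lemma mder_congr {f g : M → M'} {x : M} (h : f =ᶠ[𝓝 x] g) : mder F F' f x = mder F F' g x :=
  h.mfderiv_eq

lemma mder_eq_fderiv (f : F → F') (x : F) : mder F F' f x = fderiv ℝ f x := mfderiv_eq_fderiv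

lemma mder_neg_apply (f : M → ℝ) (x : M) (v : F) :
    mder F ℝ (fun y => -f y) x v = -mder F ℝ f x v :=
  congrArg (fun L : F →L[ℝ] ℝ => L v) (mfderiv_neg (f := f) (x := x))

lemma mdAt_extChartAt {x₀ x : M} [IsManifold 𝓘(ℝ, F) ∞ M]
    (hx : x ∈ (extChartAt 𝓘(ℝ, F) x₀).source) : MDAt F F (extChartAt 𝓘(ℝ, F) x₀) x := by
  have : IsManifold 𝓘(ℝ, F) 1 M := IsManifold.of_le (n := ∞) (by norm_num)
  exact mdifferentiableAt_extChartAt (by rwa [extChartAt_source] at hx)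

lemma mdAt_extChartAt_symm {x₀ : M} [IsManifold 𝓘(ℝ, F) ∞ M] {y : F}
    (hy : y ∈ (extChartAt 𝓘(ℝ, F) x₀).target) : MDAt F F (extChartAt 𝓘(ℝ, F) x₀).symm y := by
  have h := (contMDiffOn_extChartAt_symm (I := 𝓘(ℝ, F)) (n := ∞) x₀).contMDiffAt
    ((isOpen_extChartAt_target x₀).mem_nhds hy)
  exact h.mdifferentiableAt (by simp)

lemma mder_extChartAt_self [IsManifold 𝓘(ℝ, F) ∞ M] (x₀ : M) :
    mder F F (extChartAt 𝓘(ℝ, F) x₀) x₀ = ContinuousLinearMap.id ℝ F := by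
  have h := mdAt_extChartAt (mem_extChartAt_source (I := 𝓘(ℝ, F)) x₀)
  unfold mder
  rw [h.mfderiv]
  have h2 : (writtenInExtChartAt 𝓘(ℝ, F) 𝓘(ℝ, F) x₀ (extChartAt 𝓘(ℝ, F) x₀))
      =ᶠ[𝓝 (extChartAt 𝓘(ℝ, F) x₀ x₀)] id := by
    filter_upwards [extChartAt_target_mem_nhds (I := 𝓘(ℝ, F)) x₀] with y hy
    simp only [writtenInExtChartAt, Function.comp]
    rw [extChartAt_model_space_eq_id]
    exact (extChartAt 𝓘(ℝ, F) x₀).right_inv hy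
  rw [show range 𝓘(ℝ, F) = univ from by simp, fderivWithin_univ]
  exact h2.fderiv_eq.trans fderiv_id

lemma mder_extChartAt_symm_comp [IsManifold 𝓘(ℝ, F) ∞ M] {x₀ x : M}
    (hx : x ∈ (extChartAt 𝓘(ℝ, F) x₀).source) :
    (mder F F (extChartAt 𝓘(ℝ, F) x₀).symm (extChartAt 𝓘(ℝ, F) x₀ x)).comp
      (mder F F (extChartAt 𝓘(ℝ, F) x₀) x) = ContinuousLinearMap.id ℝ F := by
  rw [← mder_comp x (mdAt_extChartAt_symm ((extChartAt 𝓘(ℝ, F) x₀).map_source hx))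
    (mdAt_extChartAt hx), ← mder_id x]
  refine mder_congr ?_
  filter_upwards [(isOpen_extChartAt_source (I := 𝓘(ℝ, F)) x₀).mem_nhds hx] with y hy
  exact (extChartAt 𝓘(ℝ, F) x₀).left_inv hy

lemma mder_extChartAt_comp_symm [IsManifold 𝓘(ℝ, F) ∞ M] {x₀ : M} {y : F}
    (hy : y ∈ (extChartAt 𝓘(ℝ, F) x₀).target) :
    (mder F F (extChartAt 𝓘(ℝ, F) x₀) ((extChartAt 𝓘(ℝ, F) x₀).symm y)).comp
      (mder F F (extChartAt 𝓘(ℝ, F) x₀).symm y) = ContinuousLinearMap.id ℝ F := by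
  rw [← mder_comp y (mdAt_extChartAt ((extChartAt 𝓘(ℝ, F) x₀).map_target hy))
    (mdAt_extChartAt_symm hy), ← mder_id y]
  refine mder_congr ?_
  filter_upwards [(isOpen_extChartAt_target (I := 𝓘(ℝ, F)) x₀).mem_nhds hy] with y hy
  exact (extChartAt 𝓘(ℝ, F) x₀).right_inv hy

lemma mder_extChartAt_symm_self [IsManifold 𝓘(ℝ, F) ∞ M] (x₀ : M) :
    mder F F (extChartAt 𝓘(ℝ, F) x₀).symm (extChartAt 𝓘(ℝ, F) x₀ x₀)
      = ContinuousLinearMap.id ℝ F := by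
  have h := mder_extChartAt_symm_comp (mem_extChartAt_source (I := 𝓘(ℝ, F)) x₀)
  rwa [mder_extChartAt_self, ContinuousLinearMap.comp_id] at h

/-- A vector field read in the preferred chart at `x₀`. -/
noncomputable def chartVF (x₀ : M) (V : M → F) (y : F) : F :=
  mder F F (extChartAt 𝓘(ℝ, F) x₀) ((extChartAt 𝓘(ℝ, F) x₀).symm y)
    (V ((extChartAt 𝓘(ℝ, F) x₀).symm y))

/-- The Lie bracket of two vector fields on a manifold, with values in the model space. -/
noncomputable def mbr (V W : M → F) (x : M) : F := mlieBracket 𝓘(ℝ, F) (M := M) V W x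

lemma mbr_eq_chart [IsManifold 𝓘(ℝ, F) ∞ M] (x₀ : M) (V W : M → F) :
    mbr V W x₀
      = lieBracket ℝ (chartVF x₀ V) (chartVF x₀ W) (extChartAt 𝓘(ℝ, F) x₀ x₀) := by
  have key : ∀ V : M → F, (mpullbackWithin 𝓘(ℝ, F) 𝓘(ℝ, F) (extChartAt 𝓘(ℝ, F) x₀).symm V
      (range 𝓘(ℝ, F)) : F → F) =ᶠ[𝓝 (extChartAt 𝓘(ℝ, F) x₀ x₀)] chartVF x₀ V := by
    intro V
    filter_upwards [extChartAt_target_mem_nhds (I := 𝓘(ℝ, F)) x₀] with y hy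
    have h1 := mder_extChartAt_comp_symm hy
    have h2 := mder_extChartAt_symm_comp ((extChartAt 𝓘(ℝ, F) x₀).map_target hy)
    rw [(extChartAt 𝓘(ℝ, F) x₀).right_inv hy] at h2
    have h3 : (mder F F (extChartAt 𝓘(ℝ, F) x₀).symm y).inverse
        = mder F F (extChartAt 𝓘(ℝ, F) x₀) ((extChartAt 𝓘(ℝ, F) x₀).symm y) :=
      ContinuousLinearMap.inverse_eq h2 h1
    unfold chartVF
    rw [← h3]
    change (mfderivWithin 𝓘(ℝ, F) 𝓘(ℝ, F) (extChartAt 𝓘(ℝ, F) x₀).symm (range 𝓘(ℝ, F)) y).inverse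
      (V ((extChartAt 𝓘(ℝ, F) x₀).symm y)) = _
    rw [show range 𝓘(ℝ, F) = univ from by simp, mfderivWithin_univ]
    rfl
  have h1 : (mfderiv 𝓘(ℝ, F) 𝓘(ℝ, F) (extChartAt 𝓘(ℝ, F) x₀) x₀ : F →L[ℝ] F)
      = ContinuousLinearMap.id ℝ F := mder_extChartAt_self x₀
  have h0 : ∀ V W : (x : M) → TangentSpace 𝓘(ℝ, F) x, mlieBracket 𝓘(ℝ, F) V W x₀ =
      (mfderiv 𝓘(ℝ, F) 𝓘(ℝ, F) (extChartAt 𝓘(ℝ, F) x₀) x₀).inverse (lieBracket (E := F) ℝ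
        (mpullbackWithin (M := F) 𝓘(ℝ, F) 𝓘(ℝ, F) (extChartAt 𝓘(ℝ, F) x₀).symm V (range 𝓘(ℝ, F)))
        (mpullbackWithin (M := F) 𝓘(ℝ, F) 𝓘(ℝ, F) (extChartAt 𝓘(ℝ, F) x₀).symm W (range 𝓘(ℝ, F)))
        (extChartAt 𝓘(ℝ, F) x₀ x₀)) := by
    intro V W
    rw [← mlieBracketWithin_univ, mlieBracketWithin_apply, preimage_univ, univ_inter,
      show range 𝓘(ℝ, F) = univ by simp]
    exact congrArg _ (congrFun (lieBracketWithin_univ (𝕜 := ℝ) (E := F)) _)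
  refine (h0 V W).trans ((congrArg (fun L : F →L[ℝ] F => L.inverse _) h1).trans ?_)
  rw [ContinuousLinearMap.inverse_id]
  exact (key V).lieBracket_vectorField_eq (key W)

end Derivative

section Family

variable {E : Type*} [NormedAddCommGroup E] [NormedSpace ℝ E]
  {F : Type*} [NormedAddCommGroup F] [NormedSpace ℝ F]

/-- The Lie derivative formula for a family `A u` of transformations of a vector space, where
`w u` is the vector `W (A (u, p))` transported back to `p`. It follows from the symmetry of the
second derivative of `A`. -/
lemma lieBracket_of_family {A : E × F → F} {e : E} {p : F} (hA : ContDiffAt ℝ 2 A (e, p))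
    (hid : ∀ᶠ y in 𝓝 p, A (e, y) = y) {W : F → F} (hW : DifferentiableAt ℝ W p) {w : E → F}
    (hw : DifferentiableAt ℝ w e)
    (hwW : ∀ᶠ u in 𝓝 e, fderiv ℝ (fun y => A (u, y)) p (w u) = W (A (u, p))) (Y : E) :
    lieBracket ℝ (fun y => fderiv ℝ (fun u => A (u, y)) e Y) W p = fderiv ℝ w e Y := by
  obtain ⟨D, hD⟩ : ∃ D, D = fderiv ℝ A := ⟨_, rfl⟩
  have hdiff : ∀ᶠ q in 𝓝 (e, p), DifferentiableAt ℝ A q := by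
    filter_upwards [hA.eventually (by simp)] with q hq using hq.differentiableAt (by simp)
  have hslice2 : ∀ u y, DifferentiableAt ℝ A (u, y) → ∀ v,
      fderiv ℝ (fun y => A (u, y)) y v = D (u, y) (0, v) := by
    intro u y h v
    have h1 : HasFDerivAt (fun y : F => (u, y)) (ContinuousLinearMap.inr ℝ E F) y :=
      hasFDerivAt_prodMk_right u y
    have h2 := (h.hasFDerivAt.comp y h1).fderiv
    rw [show (fun y => A (u, y)) = A ∘ (fun y => (u, y)) from rfl, h2, hD]; rfl
  have hslice1 : ∀ u y, DifferentiableAt ℝ A (u, y) → ∀ v,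
      fderiv ℝ (fun u => A (u, y)) u v = D (u, y) (v, 0) := by
    intro u y h v
    have h1 : HasFDerivAt (fun u : E => (u, y)) (ContinuousLinearMap.inl ℝ E F) u :=
      hasFDerivAt_prodMk_left u y
    have h2 := (h.hasFDerivAt.comp u h1).fderiv
    rw [show (fun u => A (u, y)) = A ∘ (fun u => (u, y)) from rfl, h2, hD]; rfl
  have hDd : DifferentiableAt ℝ D (e, p) := by
    rw [hD]; exact (hA.fderiv_right (m := 1) (by norm_num)).differentiableAt (by simp)
  obtain ⟨D2, hD2⟩ : ∃ D2, D2 = fderiv ℝ D (e, p) := ⟨_, rfl⟩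
  have hDh : HasFDerivAt D D2 (e, p) := hD2 ▸ hDd.hasFDerivAt
  have hsymm : ∀ a b, D2 a b = D2 b a := by
    intro a b
    have := hA.isSymmSndFDerivAt (by simp)
    rw [hD2, hD]; exact this.eq a b
  have hp : A (e, p) = p := hid.self_of_nhds
  -- the partial differential along `F` at `(e, p)` is the identity
  have hDid : ∀ v, D (e, p) (0, v) = v := by
    intro v
    rw [← hslice2 e p (hA.differentiableAt (by simp)) v]
    have h1 : (fun y => A (e, y)) =ᶠ[𝓝 p] id := hid
    rw [h1.fderiv_eq, fderiv_id]; rfl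
  have htu : Tendsto (fun u : E => (u, p)) (𝓝 e) (𝓝 (e, p)) :=
    (Continuous.prodMk_left p).tendsto e
  have hty : Tendsto (fun y : F => (e, y)) (𝓝 p) (𝓝 (e, p)) :=
    (Continuous.prodMk_right e).tendsto p
  have hwe : w e = W p := by
    have h := hwW.self_of_nhds
    rw [hslice2 e p (hA.differentiableAt (by simp)), hDid, hp] at h
    exact h
  -- differentiate `D (u, p) (0, w u) = W (A (u, p))` with respect to `u` along `Y`
  have hL : HasFDerivAt (fun u => D (u, p) (0, w u)) _ e :=
    (hDh.comp e (hasFDerivAt_prodMk_left e p)).clm_apply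
      ((hasFDerivAt_const (0 : E) e).prodMk hw.hasFDerivAt)
  have hR : HasFDerivAt (fun u => W (A (u, p))) _ e :=
    HasFDerivAt.comp e (g := W) (f := fun u => A (u, p)) (by rw [hp]; exact hW.hasFDerivAt)
      ((hA.differentiableAt (by simp)).hasFDerivAt.comp e (hasFDerivAt_prodMk_left e p))
  have hEq : (fun u => D (u, p) (0, w u)) =ᶠ[𝓝 e] (fun u => W (A (u, p))) := by
    filter_upwards [hwW, htu.eventually hdiff] with u h1 h2
    rw [← h1, hslice2 u p h2]
  have h1 := congrArg (fun L : E →L[ℝ] F => L Y)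
    (hL.fderiv.symm.trans (hEq.fderiv_eq.trans hR.fderiv))
  simp only [_root_.add_apply, ContinuousLinearMap.comp_apply,
    ContinuousLinearMap.flip_apply, ContinuousLinearMap.prod_apply,
    _root_.zero_apply, ContinuousLinearMap.inl_apply, hDid, hwe] at h1
  have hV : fderiv ℝ (fun y => fderiv ℝ (fun u => A (u, y)) e Y) p (W p) = D2 (0, W p) (Y, 0) := by
    have h2 : (fun y => fderiv ℝ (fun u => A (u, y)) e Y) =ᶠ[𝓝 p] fun y => D (e, y) (Y, 0) := by
      filter_upwards [hty.eventually hdiff] with y hy using hslice1 e y hy Y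
    have h3 : HasFDerivAt (fun y => D (e, y) (Y, 0)) _ p :=
      (hDh.comp p (hasFDerivAt_prodMk_right e p)).clm_apply (hasFDerivAt_const (Y, 0) p)
    rw [h2.fderiv_eq, h3.fderiv]
    simp
  unfold lieBracket
  beta_reduce
  rw [hV, hslice1 e p (hA.differentiableAt (by simp)) Y, hD, hsymm]
  rw [← h1]; simp

end Family

/-! ### Smooth vector fields along maps and the Lie derivative formula -/

section Smooth

variable {E : Type*} [NormedAddCommGroup E] [NormedSpace ℝ E]
  {F : Type*} [NormedAddCommGroup F] [NormedSpace ℝ F]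
  {F' : Type*} [NormedAddCommGroup F'] [NormedSpace ℝ F']
  {N : Type*} [TopologicalSpace N] [ChartedSpace E N]
  {M : Type*} [TopologicalSpace M] [ChartedSpace F M]
  {M' : Type*} [TopologicalSpace M'] [ChartedSpace F' M']
  {K : Type*} [NormedAddCommGroup K] [NormedSpace ℝ K]
  {P : Type*} [TopologicalSpace P] [ChartedSpace K P]

/-- Smoothness of a map between manifolds modelled on normed spaces. -/
abbrev Smooth (F : Type*) [NormedAddCommGroup F] [NormedSpace ℝ F]
    (F' : Type*) [NormedAddCommGroup F'] [NormedSpace ℝ F']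
    {M : Type*} [TopologicalSpace M] [ChartedSpace F M]
    {M' : Type*} [TopologicalSpace M'] [ChartedSpace F' M']
    (f : M → M') : Prop := ContMDiff 𝓘(ℝ, F) 𝓘(ℝ, F') ∞ f

/-- Smoothness of a map of two variables. -/
abbrev Smooth₂ (E : Type*) [NormedAddCommGroup E] [NormedSpace ℝ E]
    (F : Type*) [NormedAddCommGroup F] [NormedSpace ℝ F]
    (F' : Type*) [NormedAddCommGroup F'] [NormedSpace ℝ F']
    {N : Type*} [TopologicalSpace N] [ChartedSpace E N]
    {M : Type*} [TopologicalSpace M] [ChartedSpace F M]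
    {M' : Type*} [TopologicalSpace M'] [ChartedSpace F' M']
    (A : N × M → M') : Prop := ContMDiff (𝓘(ℝ, E).prod 𝓘(ℝ, F)) 𝓘(ℝ, F') ∞ A

lemma Smooth.mdAt {f : M → M'} (hf : Smooth F F' f) (x : M) : MDAt F F' f x :=
  hf.mdifferentiable (by simp) x

/-- Smoothness of a vector field along a map `f`, as a map to the tangent bundle. -/
def SmoothAlong (K : Type*) [NormedAddCommGroup K] [NormedSpace ℝ K]
    (F : Type*) [NormedAddCommGroup F] [NormedSpace ℝ F]
    {P : Type*} [TopologicalSpace P] [ChartedSpace K P]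
    {M : Type*} [TopologicalSpace M] [ChartedSpace F M] [IsManifold 𝓘(ℝ, F) ∞ M]
    (f : P → M) (v : P → F) : Prop :=
  ContMDiff 𝓘(ℝ, K) (𝓘(ℝ, F).prod 𝓘(ℝ, F)) ∞
    (fun p => TotalSpace.mk' F (E := (TangentSpace 𝓘(ℝ, F) : M → Type _)) (f p) (v p))

lemma trivializationAt_mder [IsManifold 𝓘(ℝ, F) ∞ M] {x₀ x : M}
    (hx : x ∈ (extChartAt 𝓘(ℝ, F) x₀).source) (v : F) :
    (trivializationAt F (TangentSpace 𝓘(ℝ, F) : M → Type _) x₀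
      (TotalSpace.mk' F (E := (TangentSpace 𝓘(ℝ, F) : M → Type _)) x v)).2
      = mder F F (extChartAt 𝓘(ℝ, F) x₀) x v := by
  have h1 := hx
  rw [extChartAt_source] at h1
  have : IsManifold 𝓘(ℝ, F) 1 M := IsManifold.of_le (n := ∞) (by norm_num)
  have h := TangentBundle.continuousLinearMapAt_trivializationAt (I := 𝓘(ℝ, F)) (𝕜 := ℝ) h1
  have h2 : (mder F F (extChartAt 𝓘(ℝ, F) x₀) x : F →L[ℝ] F) v
    = (trivializationAt F (TangentSpace 𝓘(ℝ, F) : M → Type _) x₀).continuousLinearMapAt ℝ x v :=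
    (congrArg (fun L : F →L[ℝ] F => L v) h).symm
  rw [h2]
  exact (Trivialization.continuousLinearMapAt_apply_of_mem ℝ
    (trivializationAt F (TangentSpace 𝓘(ℝ, F) : M → Type _) x₀) (by simpa using h1) v).symm

/-- Smoothness of a vector field along a map is smoothness in a chart of the target. -/
lemma contMDiffAt_along_iff [IsManifold 𝓘(ℝ, F) ∞ M] {f : P → M} {v : P → F} {p₀ : P} :
    ContMDiffAt 𝓘(ℝ, K) (𝓘(ℝ, F).prod 𝓘(ℝ, F)) ∞
      (fun p => TotalSpace.mk' F (E := (TangentSpace 𝓘(ℝ, F) : M → Type _)) (f p) (v p)) p₀ ↔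
    ContMDiffAt 𝓘(ℝ, K) 𝓘(ℝ, F) ∞ f p₀ ∧ ContMDiffAt 𝓘(ℝ, K) 𝓘(ℝ, F) ∞
      (fun p => mder F F (extChartAt 𝓘(ℝ, F) (f p₀)) (f p) (v p)) p₀ := by
  rw [contMDiffAt_totalSpace]
  refine and_congr_right fun hf => ?_
  refine Filter.EventuallyEq.contMDiffAt_iff ?_
  filter_upwards [hf.continuousAt ((isOpen_extChartAt_source (I := 𝓘(ℝ, F)) (f p₀)).mem_nhds
    (mem_extChartAt_source (I := 𝓘(ℝ, F)) (f p₀)))] with p hp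
  exact trivializationAt_mder hp (v p)

lemma smoothAlong_const_iff [IsManifold 𝓘(ℝ, F) ∞ M] {x : M} {v : P → F} :
    SmoothAlong K F (fun _ => x) v ↔ Smooth K F v := by
  refine forall_congr' fun p => ?_
  rw [contMDiffAt_along_iff]
  simp only [mder_extChartAt_self]
  exact ⟨fun h => h.2, fun h => ⟨contMDiffAt_const, h⟩⟩

lemma SmoothAlong.comp [IsManifold 𝓘(ℝ, F) ∞ M] {f : P → M} {v : P → F}
    (h : SmoothAlong K F f v) {k : N → P} (hk : Smooth E K k) :
    SmoothAlong E F (f ∘ k) (v ∘ k) :=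
  ContMDiff.comp h hk

lemma smoothAlong_zero [IsManifold 𝓘(ℝ, F) ∞ M] {f : P → M} (hf : Smooth K F f) :
    SmoothAlong K F f (fun _ => 0) := by
  intro p
  rw [contMDiffAt_along_iff]
  exact ⟨hf p, by simpa using contMDiffAt_const⟩

/-- A vector field is smooth if and only if it is smooth along the identity. -/
lemma isSmoothVF_iff [IsManifold 𝓘(ℝ, F) ∞ M] {V : M → F} :
    IsSmoothVF (F := F) V ↔ SmoothAlong F F (fun x : M => x) V := Iff.rfl

lemma contDiffAt_chartVF [IsManifold 𝓘(ℝ, F) ∞ M] {V : M → F} (hV : IsSmoothVF (F := F) V)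
    (x₀ : M) : ContDiffAt ℝ ∞ (chartVF x₀ V) (extChartAt 𝓘(ℝ, F) x₀ x₀) := by
  have h := (contMDiffAt_along_iff.1 (isSmoothVF_iff.1 hV x₀)).2
  rw [← contMDiffAt_iff_contDiffAt]
  have h2 := (contMDiffOn_extChartAt_symm (I := 𝓘(ℝ, F)) (n := ∞) x₀).contMDiffAt
    (extChartAt_target_mem_nhds (I := 𝓘(ℝ, F)) x₀)
  refine ContMDiffAt.comp (extChartAt 𝓘(ℝ, F) x₀ x₀)
    (g := fun p => mder F F (extChartAt 𝓘(ℝ, F) x₀) p (V p)) ?_ h2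
  rwa [extChartAt_to_inv]

/-- The differential of a smooth map of two variables, applied to vector fields along smooth
maps. -/
lemma SmoothAlong.mder₂ [IsManifold 𝓘(ℝ, E) ∞ N] [IsManifold 𝓘(ℝ, F) ∞ M]
    [IsManifold 𝓘(ℝ, F') ∞ M'] {A : N × M → M'} (hA : Smooth₂ E F F' A)
    {f : P → N} {v : P → E} (hv : SmoothAlong K E f v)
    {k : P → M} {u : P → F} (hu : SmoothAlong K F k u) :
    SmoothAlong K F' (fun p => A (f p, k p))
      (fun p => mder E F' (fun n => A (n, k p)) (f p) (v p)
        + mder F F' (fun x => A (f p, x)) (k p) (u p)) := by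
  let F₁ : P → TangentBundle 𝓘(ℝ, E) N × TangentBundle 𝓘(ℝ, F) M := fun p =>
    (TotalSpace.mk' E (f p) (v p), TotalSpace.mk' F (k p) (u p))
  have S₁ : ContMDiff 𝓘(ℝ, K) _ ∞ F₁ := ContMDiff.prodMk hv hu
  have S₂ : ContMDiff _ _ ∞ (equivTangentBundleProd 𝓘(ℝ, E) N 𝓘(ℝ, F) M).symm :=
    contMDiff_equivTangentBundleProd_symm
  have S₃ : ContMDiff _ _ ∞ (tangentMap (𝓘(ℝ, E).prod 𝓘(ℝ, F)) 𝓘(ℝ, F') A) :=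
    hA.contMDiff_tangentMap (m := ∞) (by simp)
  have S := (S₃.comp S₂).comp S₁
  refine S.congr fun p => ?_
  change (⟨_, _⟩ : TangentBundle 𝓘(ℝ, F') M') = ⟨_, _⟩
  congr 1
  exact (mfderiv_prod_eq_add_apply (v := ((v p, u p) : E × F))
    (hA.mdifferentiable (by simp) (f p, k p))).symm

lemma Smooth₂.left {A : N × M → M'} (hA : Smooth₂ E F F' A) (x : M) :
    Smooth E F' (fun n => A (n, x)) :=
  ContMDiff.comp hA (contMDiff_id.prodMk contMDiff_const)

lemma Smooth₂.right {A : N × M → M'} (hA : Smooth₂ E F F' A) (n : N) :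
    Smooth F F' (fun x => A (n, x)) :=
  ContMDiff.comp hA (contMDiff_const.prodMk contMDiff_id)

/-- The **Lie derivative formula**: if `A n` is a smooth family of transformations of `M` with
`A n₀ = id`, generating at `n₀` in the direction `Y` the vector field `V`, then the bracket
`[V, W]` at `x₀` is the derivative of the vectors obtained by transporting `W` back to `x₀`. -/
lemma mbr_of_family [IsManifold 𝓘(ℝ, E) ∞ N] [IsManifold 𝓘(ℝ, F) ∞ M] {A : N × M → M}
    (hA : Smooth₂ E F F A) {n₀ : N} (hid : ∀ x, A (n₀, x) = x) {W : M → F}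
    (hW : IsSmoothVF (F := F) W) {x₀ : M} {w : N → F} (hw : MDAt E F w n₀)
    (hwW : ∀ n, mder F F (fun x => A (n, x)) x₀ (w n) = W (A (n, x₀))) (Y : E) :
    mbr (fun x => mder E F (fun n => A (n, x)) n₀ Y) W x₀ = mder E F w n₀ Y := by
  obtain ⟨φ, hφ⟩ : ∃ φ, φ = extChartAt 𝓘(ℝ, F) x₀ := ⟨_, rfl⟩
  obtain ⟨ψ, hψ⟩ : ∃ ψ, ψ = extChartAt 𝓘(ℝ, E) n₀ := ⟨_, rfl⟩
  have hψs : ψ.symm (ψ n₀) = n₀ := by rw [hψ, extChartAt_to_inv]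
  have hφs : φ.symm (φ x₀) = x₀ := by rw [hφ, extChartAt_to_inv]
  obtain ⟨B, hB⟩ : ∃ B : E × F → F, B = fun q => φ (A (ψ.symm q.1, φ.symm q.2)) := ⟨_, rfl⟩
  have hψt : ∀ᶠ u in 𝓝 (ψ n₀), u ∈ ψ.target := by
    rw [hψ]; exact extChartAt_target_mem_nhds (I := 𝓘(ℝ, E)) n₀
  have hφt : ∀ᶠ y in 𝓝 (φ x₀), y ∈ φ.target := by
    rw [hφ]; exact extChartAt_target_mem_nhds (I := 𝓘(ℝ, F)) x₀
  have hφsmooth : ContMDiffAt 𝓘(ℝ, F) 𝓘(ℝ, F) ∞ φ x₀ := by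
    rw [hφ]; exact contMDiffAt_extChartAt
  have hφinv : ContMDiffAt 𝓘(ℝ, F) 𝓘(ℝ, F) ∞ φ.symm (φ x₀) := by
    rw [hφ]
    exact (contMDiffOn_extChartAt_symm (I := 𝓘(ℝ, F)) (n := ∞) x₀).contMDiffAt
      (extChartAt_target_mem_nhds (I := 𝓘(ℝ, F)) x₀)
  have hψinv : ContMDiffAt 𝓘(ℝ, E) 𝓘(ℝ, E) ∞ ψ.symm (ψ n₀) := by
    rw [hψ]
    exact (contMDiffOn_extChartAt_symm (I := 𝓘(ℝ, E)) (n := ∞) n₀).contMDiffAt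
      (extChartAt_target_mem_nhds (I := 𝓘(ℝ, E)) n₀)
  have hBsmooth : ContDiffAt ℝ ∞ B (ψ n₀, φ x₀) := by
    rw [← contMDiffAt_iff_contDiffAt, hB]
    have h1 : ContMDiffAt 𝓘(ℝ, E × F) 𝓘(ℝ, E) ∞ (fun q : E × F => ψ.symm q.1) (ψ n₀, φ x₀) :=
      ContMDiffAt.comp (ψ n₀, φ x₀) (g := ψ.symm) (f := Prod.fst) hψinv
        contDiff_fst.contMDiff.contMDiffAt
    have h2 : ContMDiffAt 𝓘(ℝ, E × F) 𝓘(ℝ, F) ∞ (fun q : E × F => φ.symm q.2) (ψ n₀, φ x₀) :=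
      ContMDiffAt.comp (ψ n₀, φ x₀) (g := φ.symm) (f := Prod.snd) hφinv
        contDiff_snd.contMDiff.contMDiffAt
    refine ContMDiffAt.comp (ψ n₀, φ x₀) (g := φ)
      (f := fun q : E × F => A (ψ.symm q.1, φ.symm q.2)) ?_
      (ContMDiffAt.comp (ψ n₀, φ x₀) (g := A) hA.contMDiffAt (h1.prodMk h2))
    simp only [hψs, hφs, hid]
    exact hφsmooth
  have hsrc : ∀ᶠ u in 𝓝 (ψ n₀), A (ψ.symm u, x₀) ∈ φ.source := by
    have hc : ContinuousAt (fun u => A (ψ.symm u, x₀)) (ψ n₀) :=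
      ContinuousAt.comp (g := fun n => A (n, x₀)) ((hA.left x₀).continuous.continuousAt)
        hψinv.continuousAt
    refine hc ((hφ ▸ isOpen_extChartAt_source (I := 𝓘(ℝ, F)) x₀).mem_nhds ?_)
    beta_reduce
    rw [hψs, hid, hφ]
    exact mem_extChartAt_source (I := 𝓘(ℝ, F)) x₀
  -- the partial differentials of the family read in charts
  have hdiff2 : ∀ᶠ u in 𝓝 (ψ n₀), ∀ v, fderiv ℝ (fun y => B (u, y)) (φ x₀) v
      = mder F F φ (A (ψ.symm u, x₀)) (mder F F (fun x => A (ψ.symm u, x)) x₀ v) := by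
    filter_upwards [hsrc] with u hu v
    have h2 : MDAt F F φ.symm (φ x₀) := hφinv.mdifferentiableAt (by simp)
    have h3 : MDAt F F (fun x => A (ψ.symm u, x)) (φ.symm (φ x₀)) := (hA.right _).mdAt _
    rw [← mder_eq_fderiv, hB]
    rw [mder_comp' (g := φ) (f := fun y => A (ψ.symm u, φ.symm y)) (φ x₀)
      (by rw [hφs, hφ]; exact mdAt_extChartAt (hφ ▸ hu))
      (MDifferentiableAt.comp (φ x₀) (g := fun x => A (ψ.symm u, x)) h3 h2),
      mder_comp' (g := fun x => A (ψ.symm u, x)) (f := φ.symm) (φ x₀) h3 h2]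
    rw [hφs]
    congr 2
    rw [hφ, mder_extChartAt_symm_self]; rfl
  have hdiff1 : ∀ᶠ y in 𝓝 (φ x₀), fderiv ℝ (fun u => B (u, y)) (ψ n₀) Y
      = chartVF x₀ (fun x => mder E F (fun n => A (n, x)) n₀ Y) y := by
    filter_upwards [hφt] with y hy
    have h2 : MDAt E E ψ.symm (ψ n₀) := hψinv.mdifferentiableAt (by simp)
    have h3 : MDAt E F (fun n => A (n, φ.symm y)) (ψ.symm (ψ n₀)) := (hA.left _).mdAt _
    rw [← mder_eq_fderiv, hB]
    rw [mder_comp' (g := φ) (f := fun u => A (ψ.symm u, φ.symm y)) (ψ n₀)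
      (by rw [hψs, hid]; subst hφ; exact mdAt_extChartAt (PartialEquiv.map_target _ hy))
      (MDifferentiableAt.comp (ψ n₀) (g := fun n => A (n, φ.symm y)) h3 h2),
      mder_comp' (g := fun n => A (n, φ.symm y)) (f := ψ.symm) (ψ n₀) h3 h2]
    have h4 : mder E E ψ.symm (ψ n₀) Y = Y := by rw [hψ, mder_extChartAt_symm_self]; rfl
    rw [h4, hψs, hid]
    unfold chartVF
    rw [hφ]
  have hwd : MDAt E F (w ∘ ψ.symm) (ψ n₀) :=
    MDifferentiableAt.comp (ψ n₀) (g := w) (by rw [hψs]; exact hw)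
      (hψinv.mdifferentiableAt (by simp))
  have hmain := lieBracket_of_family (A := B) (e := ψ n₀) (p := φ x₀) (W := chartVF x₀ W)
    (w := w ∘ ψ.symm) (hBsmooth.of_le ENat.LEInfty.out)
    (by
      filter_upwards [hφt] with y hy
      rw [hB]
      change φ (A (ψ.symm (ψ n₀), φ.symm y)) = y
      rw [hψs, hid, φ.right_inv hy])
    (by rw [hφ]; exact (contDiffAt_chartVF hW x₀).differentiableAt (by simp))
    hwd.differentiableAt
    (by
      filter_upwards [hsrc, hdiff2] with u hu1 hu2
      have h1 : B (u, φ x₀) = φ (A (ψ.symm u, x₀)) := by rw [hB]; simp only [hφs]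
      rw [hu2, h1]
      unfold chartVF
      rw [← hφ, φ.left_inv hu1, Function.comp_apply, hwW]) Y
  have hw' : fderiv ℝ (w ∘ ψ.symm) (ψ n₀) Y = mder E F w n₀ Y := by
    rw [← mder_eq_fderiv]
    rw [show mder E F (w ∘ ψ.symm) (ψ n₀) Y = mder E F w (ψ.symm (ψ n₀)) (mder E E ψ.symm (ψ n₀) Y)
      from mder_comp' (g := w) (f := ψ.symm) (ψ n₀) (by rw [hψs]; exact hw)
        (hψinv.mdifferentiableAt (by simp)) Y, hψs]
    congr 1
    rw [hψ, mder_extChartAt_symm_self]; rfl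
  rw [mbr_eq_chart, ← hw', ← hmain, hφ]
  rw [hφ] at hdiff1
  exact (Filter.EventuallyEq.lieBracket_vectorField_eq (Filter.EventuallyEq.symm hdiff1)
    (Filter.EventuallyEq.refl _ _))

end Smooth

section TwoVariables

variable {E : Type*} [NormedAddCommGroup E] [NormedSpace ℝ E]
  {F : Type*} [NormedAddCommGroup F] [NormedSpace ℝ F]
  {F' : Type*} [NormedAddCommGroup F'] [NormedSpace ℝ F']
  {N : Type*} [TopologicalSpace N] [ChartedSpace E N]
  {M : Type*} [TopologicalSpace M] [ChartedSpace F M]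
  {M' : Type*} [TopologicalSpace M'] [ChartedSpace F' M']
  {K : Type*} [NormedAddCommGroup K] [NormedSpace ℝ K]
  {P : Type*} [TopologicalSpace P] [ChartedSpace K P]

lemma mder_comp₂ {A : N × M → M'} (hA : Smooth₂ E F F' A) {f : P → N} {k : P → M} {p : P}
    (hf : MDAt K E f p) (hk : MDAt K F k p) (v : K) :
    mder K F' (fun p => A (f p, k p)) p v
      = mder E F' (fun n => A (n, k p)) (f p) (mder K E f p v)
        + mder F F' (fun x => A (f p, x)) (k p) (mder K F k p v) := by
  have hAd := hA.mdifferentiable (by simp) (f p, k p)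
  have h1 := mfderiv_comp p (g := A) (f := fun p => (f p, k p)) hAd (hf.prodMk hk)
  have h2 := mfderiv_prod_eq_add_apply
    (v := ((mder K E f p v, mder K F k p v) : E × F)) hAd
  rw [mfderiv_prodMk hf hk] at h1
  exact (congrArg (fun L : K →L[ℝ] F' => L v) h1).trans h2

end TwoVariables

/-! ### The bracket of a Lie group -/

section LieGroup

variable {E : Type*} [NormedAddCommGroup E] [NormedSpace ℝ E]
  {G : Type*} [TopologicalSpace G] [ChartedSpace E G] [Group G]

/-- The bracket of the Lie algebra of `G`, as an operation on the model space of `G`. -/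
noncomputable def lbr (G : Type*) [TopologicalSpace G] [ChartedSpace E G] [Group G]
    (Y Z : E) : E :=
  Bracket.bracket (L := GroupLieAlgebra 𝓘(ℝ, E) G) (M := GroupLieAlgebra 𝓘(ℝ, E) G) Y Z

/-- The adjoint representation of `G`. -/
noncomputable def adj (b : G) : E →L[ℝ] E := mder E E (fun x : G => b * x * b⁻¹) 1

variable [LieGroup 𝓘(ℝ, E) ∞ G]

lemma smooth₂_mul (E : Type*) [NormedAddCommGroup E] [NormedSpace ℝ E]
    (G : Type*) [TopologicalSpace G] [ChartedSpace E G] [Group G] [LieGroup 𝓘(ℝ, E) ∞ G] :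
    Smooth₂ E E E (fun p : G × G => p.1 * p.2) := contMDiff_mul 𝓘(ℝ, E) ∞

lemma smooth_inv (E : Type*) [NormedAddCommGroup E] [NormedSpace ℝ E]
    (G : Type*) [TopologicalSpace G] [ChartedSpace E G] [Group G] [LieGroup 𝓘(ℝ, E) ∞ G] :
    Smooth E E (fun a : G => a⁻¹) := contMDiff_inv 𝓘(ℝ, E) ∞

lemma smooth₂_conj (E : Type*) [NormedAddCommGroup E] [NormedSpace ℝ E]
    (G : Type*) [TopologicalSpace G] [ChartedSpace E G] [Group G] [LieGroup 𝓘(ℝ, E) ∞ G] :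
    Smooth₂ E E E (fun p : G × G => p.1 * p.2 * p.1⁻¹) :=
  (contMDiff_fst.mul contMDiff_snd).mul contMDiff_fst.inv

lemma mder_inv_one (Y : E) : mder E E (fun a : G => a⁻¹) 1 Y = -Y := by
  have h := mder_comp₂ (smooth₂_mul E G) (f := fun a => a) (k := fun a => a⁻¹) (p := (1 : G))
    mdifferentiableAt_id ((smooth_inv E G).mdAt 1) Y
  simp only [mul_inv_cancel, mder_const, inv_one, mul_one, one_mul, mder_id] at h
  rw [_root_.zero_apply] at h
  exact (neg_eq_of_add_eq_zero_right h.symm).symm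

lemma smooth_adj (Z : E) : Smooth E E (fun b : G => adj b Z) := by
  rw [← smoothAlong_const_iff (x := (1 : G))]
  have h := SmoothAlong.mder₂ (smooth₂_conj E G) (f := fun b : G => b) (k := fun _ : G => (1 : G))
    (smoothAlong_zero contMDiff_id)
    ((smoothAlong_const_iff (K := E) (v := fun _ : G => Z)).2 contMDiff_const)
  simpa [adj] using h

/-- The bracket is the derivative of the adjoint representation: right translations generate the
left-invariant fields, so this is the Lie derivative formula. -/
lemma lbr_eq (Y Z : E) : lbr G Y Z = mder E E (fun b : G => adj b Z) 1 Y := by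
  have hA : Smooth₂ E E E (fun p : G × G => p.2 * p.1) := contMDiff_snd.mul contMDiff_fst
  have hW : IsSmoothVF (F := E) (M := G) (fun a => mder E E (fun b : G => a * b) 1 Z) := by
    have h := SmoothAlong.mder₂ (smooth₂_mul E G) (f := fun b : G => b) (k := fun _ : G => (1 : G))
      (smoothAlong_zero contMDiff_id)
      ((smoothAlong_const_iff (K := E) (v := fun _ : G => Z)).2 contMDiff_const)
    simpa [isSmoothVF_iff] using h
  have h := mbr_of_family hA (n₀ := (1 : G)) (fun x => mul_one x) hW (x₀ := (1 : G))
    (w := fun b : G => adj b Z) ((smooth_adj Z).mdAt 1) (fun n => ?_) Y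
  · simp only at h
    rw [← h]; rfl
  · have h1 : (fun x : G => n * x * n⁻¹ * n) = fun x => n * x := by ext x; simp
    change mder E E (fun x : G => x * n) 1 (adj n Z) = mder E E (fun b : G => 1 * n * b) 1 Z
    have h2 := mder_comp' (E := E) (F := E) (F' := E) (g := fun x : G => x * n)
      (f := fun x : G => n * x * n⁻¹) 1 ((hA.right n).mdAt _)
      (((smooth₂_conj E G).right n).mdAt 1) Z
    rw [h1] at h2
    simp only [mul_one, mul_inv_cancel] at h2
    rw [one_mul, h2]; rfl

lemma lbr_smul_left (c : ℝ) (Y Z : E) : lbr G (c • Y) Z = c • lbr G Y Z := by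
  rw [lbr_eq, lbr_eq, map_smul]

lemma lbr_neg_left (Y Z : E) : lbr G (-Y) Z = -lbr G Y Z := by
  rw [lbr_eq, lbr_eq, map_neg]

lemma lbr_add_left (Y Y' Z : E) : lbr G (Y + Y') Z = lbr G Y Z + lbr G Y' Z := by
  rw [lbr_eq, lbr_eq, lbr_eq, map_add]

lemma lbr_skew (Y Z : E) : lbr G Y Z = -lbr G Z Y :=
  mlieBracket_swap_apply (I := 𝓘(ℝ, E)) (x := (1 : G))
    (V := mulInvariantVectorField (I := 𝓘(ℝ, E)) (G := G) Y)
    (W := mulInvariantVectorField (I := 𝓘(ℝ, E)) (G := G) Z)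

lemma lbr_self (Y : E) : lbr G Y Y = 0 := by
  have h := lbr_skew (G := G) Y Y
  have h2 : (2 : ℝ) • lbr G Y Y = 0 := by rw [two_smul]; nth_rewrite 2 [h]; simp
  exact (smul_eq_zero.1 h2).resolve_left two_ne_zero

lemma lbr_add_right (Y Z Z' : E) : lbr G Y (Z + Z') = lbr G Y Z + lbr G Y Z' := by
  rw [lbr_skew, lbr_add_left, lbr_skew Z, lbr_skew Z']; abel

lemma lbr_smul_right (c : ℝ) (Y Z : E) : lbr G Y (c • Z) = c • lbr G Y Z := by
  rw [lbr_skew, lbr_smul_left, lbr_skew Z]; simp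

lemma lbr_neg_right (Y Z : E) : lbr G Y (-Z) = -lbr G Y Z := by
  rw [lbr_skew, lbr_neg_left, lbr_skew Z, neg_neg]

lemma lbr_sub_left (Y Y' Z : E) : lbr G (Y - Y') Z = lbr G Y Z - lbr G Y' Z := by
  rw [lbr_eq, lbr_eq, lbr_eq, map_sub]

lemma lbr_sub_right (Y Z Z' : E) : lbr G Y (Z - Z') = lbr G Y Z - lbr G Y Z' := by
  rw [sub_eq_add_neg, lbr_add_right, lbr_neg_right, sub_eq_add_neg]

variable {E' : Type*} [NormedAddCommGroup E'] [NormedSpace ℝ E']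
  {G' : Type*} [TopologicalSpace G'] [ChartedSpace E' G'] [Group G'] [LieGroup 𝓘(ℝ, E') ∞ G']

/-- The differential of a smooth homomorphism preserves brackets. -/
lemma mder_hom_lbr {f : G → G'} (hf : Smooth E E' f) (hmul : ∀ a b, f (a * b) = f a * f b)
    (Y Z : E) : mder E E' f 1 (lbr G Y Z) = lbr G' (mder E E' f 1 Y) (mder E E' f 1 Z) := by
  have h1 : f 1 = 1 := by simpa using hmul 1 1
  have hinv : ∀ a, f a⁻¹ = (f a)⁻¹ := fun a =>
    eq_inv_of_mul_eq_one_left (by rw [← hmul, inv_mul_cancel, h1])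
  have hadj : ∀ b : G, mder E E' f 1 (adj b Z) = adj (f b) (mder E E' f 1 Z) := by
    intro b
    have h2 := mder_comp' (E := E) (F := E) (F' := E') (g := f) (f := fun x : G => b * x * b⁻¹) 1
      (hf.mdAt _) (((smooth₂_conj E G).right b).mdAt 1) Z
    have h3 := mder_comp' (E := E) (F := E') (F' := E') (g := fun x : G' => f b * x * (f b)⁻¹)
      (f := f) 1 (((smooth₂_conj E' G').right (f b)).mdAt _) (hf.mdAt _) Z
    simp only [hmul, hinv] at h2
    simp only [mul_one, mul_inv_cancel] at h2
    rw [h1] at h3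
    exact h2.symm.trans h3
  have h4 := mder_comp' (E := E) (F := E) (F' := E') (g := fun v : E => mder E E' f 1 v)
    (f := fun b : G => adj b Z) 1 (mder E E' f 1).differentiableAt.mdifferentiableAt
    ((smooth_adj Z).mdAt 1) Y
  have h5 := mder_comp' (E := E) (F := E') (F' := E') (g := fun b : G' => adj b (mder E E' f 1 Z))
    (f := f) 1 ((smooth_adj _).mdAt _) (hf.mdAt 1) Y
  simp only [hadj] at h4
  rw [h4, h1] at h5
  rw [lbr_eq, lbr_eq, ← h5, mder_eq_fderiv]
  rw [ContinuousLinearMap.fderiv]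

/-- The differential of a smooth additive character vanishes on brackets. -/
lemma mder_char_lbr {χ : G → ℝ} (hf : Smooth E ℝ χ) (hmul : ∀ a b, χ (a * b) = χ a + χ b)
    (Y Z : E) : mder E ℝ χ 1 (lbr G Y Z) = 0 := by
  have h1 : χ 1 = 0 := by simpa using hmul 1 1
  have hinv : ∀ a, χ a⁻¹ = -χ a := fun a => by
    have := hmul a⁻¹ a
    rw [inv_mul_cancel, h1] at this; linarith
  have hadj : ∀ b : G, mder E ℝ χ 1 (adj b Z) = mder E ℝ χ 1 Z := by
    intro b
    have h2 := mder_comp' (E := E) (F := E) (F' := ℝ) (g := χ) (f := fun x : G => b * x * b⁻¹) 1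
      (hf.mdAt _) (((smooth₂_conj E G).right b).mdAt 1) Z
    have h3 : (fun y => χ (b * y * b⁻¹)) = χ := by ext y; rw [hmul, hmul, hinv]; ring
    rw [h3] at h2
    simp only [mul_one, mul_inv_cancel] at h2
    exact h2.symm
  have h4 := mder_comp' (E := E) (F := E) (F' := ℝ) (g := fun v : E => mder E ℝ χ 1 v)
    (f := fun b : G => adj b Z) (1 : G) (mder E ℝ χ 1).differentiableAt.mdifferentiableAt
    ((smooth_adj (G := G) Z).mdAt 1) Y
  simp only [hadj, mder_const, mder_eq_fderiv, ContinuousLinearMap.fderiv] at h4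
  rw [lbr_eq, ← h4]; rfl

end LieGroup

/-! ### Fundamental vector fields -/

section Action

variable {E : Type*} [NormedAddCommGroup E] [NormedSpace ℝ E]
  {G : Type*} [TopologicalSpace G] [ChartedSpace E G] [Group G] [LieGroup 𝓘(ℝ, E) ∞ G]
  {F : Type*} [NormedAddCommGroup F] [NormedSpace ℝ F]
  {M : Type*} [TopologicalSpace M] [ChartedSpace F M] [IsManifold 𝓘(ℝ, F) ∞ M]
  [MulAction G M]

/-- The differential of the action of an element of the group. -/
noncomputable def actDeriv (F : Type*) [NormedAddCommGroup F] [NormedSpace ℝ F]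
    {M : Type*} [TopologicalSpace M] [ChartedSpace F M] {G : Type*} [SMul G M]
    (a : G) (x : M) : F →L[ℝ] F :=
  mder F F (fun y : M => a • y) x

/-- The fundamental vector fields on `M` at the point `x`, as a linear function on the Lie algebra
of `G`: the differential at `1` of the orbit map of `x`. -/
noncomputable def fund (E : Type*) [NormedAddCommGroup E] [NormedSpace ℝ E]
    (G : Type*) [TopologicalSpace G] [ChartedSpace E G] [Group G]
    (F : Type*) [NormedAddCommGroup F] [NormedSpace ℝ F]
    {M : Type*} [TopologicalSpace M] [ChartedSpace F M] [MulAction G M] (x : M) : E →L[ℝ] F :=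
  mder E F (fun a : G => a • x) 1

variable (E G F M) in
lemma smooth₂_smul [ContMDiffSMul 𝓘(ℝ, E) 𝓘(ℝ, F) ∞ G M] :
    Smooth₂ E F F (fun p : G × M => p.1 • p.2) := contMDiff_smul

variable (E F M) in
lemma smooth_smul_left [ContMDiffSMul 𝓘(ℝ, E) 𝓘(ℝ, F) ∞ G M] (a : G) :
    Smooth F F (fun x : M => a • x) := (smooth₂_smul E G F M).right a

variable (E G F) in
lemma smooth_orbit [ContMDiffSMul 𝓘(ℝ, E) 𝓘(ℝ, F) ∞ G M] (x : M) :
    Smooth E F (fun a : G => a • x) := (smooth₂_smul E G F M).left x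

variable (E) in
lemma actDeriv_mul [ContMDiffSMul 𝓘(ℝ, E) 𝓘(ℝ, F) ∞ G M] (a b : G) (x : M) (v : F) :
    actDeriv F (a * b) x v = actDeriv F a (b • x) (actDeriv F b x v) := by
  have h := mder_comp' (g := fun y : M => a • y) (f := fun y : M => b • y) x
    ((smooth_smul_left E F M a).mdAt _) ((smooth_smul_left E F M b).mdAt _) v
  simp only [smul_smul] at h
  exact h

lemma actDeriv_one (x : M) (v : F) : actDeriv F (1 : G) x v = v := by
  simp [actDeriv, mder_id]

variable (E) in
lemma actDeriv_inv_apply [ContMDiffSMul 𝓘(ℝ, E) 𝓘(ℝ, F) ∞ G M] (a : G) (x : M) (v : F) :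
    actDeriv F a⁻¹ (a • x) (actDeriv F a x v) = v := by
  rw [← actDeriv_mul E, inv_mul_cancel, actDeriv_one]

variable (E) in
lemma actDeriv_apply_inv [ContMDiffSMul 𝓘(ℝ, E) 𝓘(ℝ, F) ∞ G M] (a : G) (x : M) (v : F) :
    actDeriv F a x (actDeriv F a⁻¹ (a • x) v) = v := by
  have h := actDeriv_mul E a a⁻¹ (a • x) v
  rw [mul_inv_cancel, actDeriv_one, inv_smul_smul] at h
  exact h.symm

/-- A vector field is invariant under the action of `G`. -/
def IsInvariantVF (G : Type*) {F : Type*} [NormedAddCommGroup F] [NormedSpace ℝ F]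
    {M : Type*} [TopologicalSpace M] [ChartedSpace F M] [SMul G M] (V : M → F) : Prop :=
  ∀ (a : G) (x : M), actDeriv F a x (V x) = V (a • x)

lemma isSmoothVF_fund [ContMDiffSMul 𝓘(ℝ, E) 𝓘(ℝ, F) ∞ G M] (Y : E) :
    IsSmoothVF (F := F) (fun x : M => fund E G F x Y) := by
  have h := SmoothAlong.mder₂ (smooth₂_smul E G F M) (f := fun _ : M => (1 : G))
    (k := fun x : M => x) (v := fun _ => Y) (u := fun _ => 0)
    ((smoothAlong_const_iff (K := F) (v := fun _ : M => Y)).2 contMDiff_const)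
    (smoothAlong_zero contMDiff_id)
  simpa [isSmoothVF_iff, fund] using h

lemma actDeriv_fund [ContMDiffSMul 𝓘(ℝ, E) 𝓘(ℝ, F) ∞ G M] (a : G) (x : M) (Y : E) :
    actDeriv F a x (fund E G F x Y) = fund E G F (a • x) (adj a Y) := by
  have h1 := mder_comp' (F' := F) (g := fun y : M => a • y) (f := fun b : G => b • x) 1
    ((smooth_smul_left E F M a).mdAt _) ((smooth_orbit E G F x).mdAt _) Y
  have h2 := mder_comp' (F' := F) (g := fun b : G => b • (a • x)) (f := fun b : G => a * b * a⁻¹) 1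
    ((smooth_orbit E G F (a • x)).mdAt _) (((smooth₂_conj E G).right a).mdAt 1) Y
  simp only [smul_smul, inv_mul_cancel_right, mul_one, mul_inv_cancel] at h1 h2
  rw [one_smul] at h1
  unfold actDeriv fund
  rw [← h1, h2]
  simp only [smul_smul]; rfl

lemma adj_inv_apply (a : G) (Y : E) : adj a (adj a⁻¹ Y) = Y := by
  have h := mder_comp' (E := E) (F := E) (F' := E) (g := fun x : G => a * x * a⁻¹)
    (f := fun x : G => a⁻¹ * x * a⁻¹⁻¹) 1 (((smooth₂_conj E G).right a).mdAt _)
      (((smooth₂_conj E G).right a⁻¹).mdAt 1) Y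
  have h1 : (fun y => a * (a⁻¹ * y * a⁻¹⁻¹) * a⁻¹) = fun y => y := by ext y; group
  rw [h1, mder_id] at h
  simp only [mul_one, mul_inv_cancel] at h
  exact h.symm

/-- The fundamental fields form an anti-homomorphic image of the Lie algebra: they are generated by
a left action, whereas the bracket of the Lie algebra is that of left-invariant fields. -/
lemma mbr_fund_fund [ContMDiffSMul 𝓘(ℝ, E) 𝓘(ℝ, F) ∞ G M] (Y Z : E) (x : M) :
    mbr (fun x => fund E G F x Y) (fun x => fund E G F x Z) x = -fund E G F x (lbr G Y Z) := by
  have hinv : MDAt E E (fun a : G => adj a⁻¹ Z) 1 :=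
    MDifferentiableAt.comp (1 : G) (g := fun a : G => adj a Z) ((smooth_adj Z).mdAt _)
      ((smooth_inv E G).mdAt 1)
  have hd : MDAt E F (fun v : E => fund E G F x v) (adj (1 : G)⁻¹ Z) :=
    (fund E G F x).differentiableAt.mdifferentiableAt
  have h := mbr_of_family (smooth₂_smul E G F M) (n₀ := (1 : G)) (fun x => one_smul G x)
    (isSmoothVF_fund (E := E) (G := G) Z) (x₀ := x) (w := fun a => fund E G F x (adj a⁻¹ Z))
    (MDifferentiableAt.comp (1 : G) (g := fun v : E => fund E G F x v) hd hinv)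
    (fun a => by
      refine (actDeriv_fund (F := F) a x (adj a⁻¹ Z)).trans ?_
      rw [adj_inv_apply]) Y
  refine h.trans ?_
  rw [mder_comp' (F' := F) (g := fun v : E => fund E G F x v) (f := fun a : G => adj a⁻¹ Z) 1
    hd hinv, mder_eq_fderiv, ContinuousLinearMap.fderiv, mder_comp' (E := E) (F := E) (F' := E)
    (g := fun a : G => adj a Z) (f := fun a : G => a⁻¹) 1 ((smooth_adj Z).mdAt _)
    ((smooth_inv E G).mdAt 1), mder_inv_one, inv_one, ← lbr_eq, lbr_neg_left, map_neg]

/-- The values of a vector field `W` along the orbit of `x`, transported back to `x`. -/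
noncomputable def transport (G : Type*) [Group G] {F : Type*} [NormedAddCommGroup F]
    [NormedSpace ℝ F] {M : Type*} [TopologicalSpace M] [ChartedSpace F M] [MulAction G M]
    (W : M → F) (x : M) (a : G) : F := actDeriv F a⁻¹ (a • x) (W (a • x))

variable (E G) in
lemma smooth_transport [ContMDiffSMul 𝓘(ℝ, E) 𝓘(ℝ, F) ∞ G M] {W : M → F}
    (hW : IsSmoothVF (F := F) W) (x : M) : Smooth E F (transport G W x) := by
  rw [← smoothAlong_const_iff (x := x)]
  have h := SmoothAlong.mder₂ (smooth₂_smul E G F M) (f := fun a : G => a⁻¹)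
    (k := fun a : G => a • x) (v := fun _ => 0) (u := fun a => W (a • x))
    (smoothAlong_zero (smooth_inv E G))
    (SmoothAlong.comp (isSmoothVF_iff.1 hW) (smooth_orbit E G F x))
  simp only [inv_smul_smul, map_zero, zero_add] at h
  exact h

/-- The bracket with a fundamental field is a Lie derivative. -/
lemma mbr_fund [ContMDiffSMul 𝓘(ℝ, E) 𝓘(ℝ, F) ∞ G M] {W : M → F}
    (hW : IsSmoothVF (F := F) W) (x : M) (Y : E) :
    mbr (fun x => fund E G F x Y) W x = mder E F (transport G W x) 1 Y :=
  mbr_of_family (smooth₂_smul E G F M) (n₀ := (1 : G)) (fun x => one_smul G x)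
    hW (x₀ := x) ((smooth_transport E G hW x).mdAt 1)
    (fun a => actDeriv_apply_inv E a x (W (a • x))) Y

lemma mbr_fund_of_invariant [ContMDiffSMul 𝓘(ℝ, E) 𝓘(ℝ, F) ∞ G M] {W : M → F}
    (hW : IsSmoothVF (F := F) W) (hinv : IsInvariantVF G W) (x : M) (Y : E) :
    mbr (fun x => fund E G F x Y) W x = 0 := by
  rw [mbr_fund hW]
  have h : transport G W x = fun _ : G => W x := by
    funext a
    rw [transport, ← hinv a x, actDeriv_inv_apply E]
  rw [h, mder_const]; rfl

lemma mder_clm_comp {f : G → F} {F' : Type*} [NormedAddCommGroup F'] [NormedSpace ℝ F']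
    (L : F →L[ℝ] F') {a : G} (hf : MDAt E F f a) (Y : E) :
    mder E F' (fun b => L (f b)) a Y = L (mder E F f a Y) := by
  rw [mder_comp' (F' := F') (g := fun v : F => L v) a L.differentiableAt.mdifferentiableAt hf,
    mder_eq_fderiv, ContinuousLinearMap.fderiv]

/-- The Lie derivative along a fundamental field commutes with an invariant endomorphism field. -/
lemma mbr_fund_endo [ContMDiffSMul 𝓘(ℝ, E) 𝓘(ℝ, F) ∞ G M] {J : M → F →L[ℝ] F} {W : M → F}
    (hW : IsSmoothVF (F := F) W) (hJW : IsSmoothVF (F := F) (fun x => J x (W x)))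
    (hJ : ∀ (a : G) x v, actDeriv F a x (J x v) = J (a • x) (actDeriv F a x v)) (x : M) (Y : E) :
    mbr (fun x => fund E G F x Y) (fun x => J x (W x)) x
      = J x (mbr (fun x => fund E G F x Y) W x) := by
  rw [mbr_fund hW, mbr_fund hJW]
  have h : transport G (fun x => J x (W x)) x = fun a : G => J x (transport G W x a) := by
    funext a
    rw [transport, hJ, inv_smul_smul]; rfl
  rw [h, mder_clm_comp _ ((smooth_transport E G hW x).mdAt 1)]

/-- The Leibniz rule for the Lie derivative of an invariant one-form along a fundamental field. -/
lemma mder_oneForm_fund [ContMDiffSMul 𝓘(ℝ, E) 𝓘(ℝ, F) ∞ G M] {α : M → F →L[ℝ] ℝ} {W : M → F}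
    (hW : IsSmoothVF (F := F) W) (hαW : Smooth F ℝ (fun x => α x (W x)))
    (hα : ∀ (a : G) x v, α (a • x) (actDeriv F a x v) = α x v) (x : M) (Y : E) :
    mder F ℝ (fun x => α x (W x)) x (fund E G F x Y)
      = α x (mbr (fun x => fund E G F x Y) W x) := by
  have h1 := mder_comp' (F' := ℝ) (g := fun x => α x (W x)) (f := fun a : G => a • x) 1
    (hαW.mdAt _) ((smooth_orbit E G F x).mdAt 1) Y
  rw [one_smul] at h1
  refine h1.symm.trans ?_
  have h2 : (fun a : G => α (a • x) (W (a • x))) = fun a : G => α x (transport G W x a) := by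
    funext a
    rw [← hα a x, transport, actDeriv_apply_inv E]
  rw [h2, mbr_fund hW, mder_clm_comp _ ((smooth_transport E G hW x).mdAt 1)]

/-- The Leibniz rule for the Lie derivative of an invariant bilinear form along a fundamental
field. -/
lemma mder_bilin_fund [ContMDiffSMul 𝓘(ℝ, E) 𝓘(ℝ, F) ∞ G M] {g : M → F →L[ℝ] F →L[ℝ] ℝ}
    {V W : M → F} (hV : IsSmoothVF (F := F) V)
    (hW : IsSmoothVF (F := F) W) (hgW : Smooth F ℝ (fun x => g x (V x) (W x)))
    (hg : ∀ (a : G) x u v, g (a • x) (actDeriv F a x u) (actDeriv F a x v) = g x u v)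
    (x : M) (Y : E) :
    mder F ℝ (fun x => g x (V x) (W x)) x (fund E G F x Y)
      = g x (mbr (fun x => fund E G F x Y) V x) (W x)
        + g x (V x) (mbr (fun x => fund E G F x Y) W x) := by
  have h1 := mder_comp' (F' := ℝ) (g := fun x => g x (V x) (W x)) (f := fun a : G => a • x) 1
    (hgW.mdAt _) ((smooth_orbit E G F x).mdAt 1) Y
  rw [one_smul] at h1
  refine h1.symm.trans ?_
  have h2 : (fun a : G => g (a • x) (V (a • x)) (W (a • x)))
      = fun a : G => g x (transport G V x a) (transport G W x a) := by
    funext a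
    rw [← hg a x, transport, transport, actDeriv_apply_inv E, actDeriv_apply_inv E]
  have hB : Smooth₂ F F ℝ (fun p : F × F => g x p.1 p.2) := by
    exact ContMDiff.clm_apply ((g x).contMDiff.comp contMDiff_fst) contMDiff_snd
  have ht : ∀ U : M → F, transport G U x 1 = U x := by
    intro U
    rw [transport, inv_one, actDeriv_one, one_smul]
  rw [h2, mder_comp₂ hB ((smooth_transport E G hV x).mdAt 1) ((smooth_transport E G hW x).mdAt 1),
    mbr_fund hV, mbr_fund hW, ht, ht]
  congr 1
  · rw [mder_eq_fderiv]
    exact congrArg (fun L : F →L[ℝ] ℝ => L (mder E F (transport G V x) 1 Y))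
      (((g x).flip (W x)).fderiv (x := V x))
  · rw [mder_eq_fderiv]
    exact congrArg (fun L : F →L[ℝ] ℝ => L (mder E F (transport G W x) 1 Y))
      ((g x (V x)).fderiv (x := W x))

end Action

/-! ### Integral curves and one-parameter subgroups -/

section IntegralCurve

variable {F : Type*} [NormedAddCommGroup F] [NormedSpace ℝ F]
  {M : Type*} [TopologicalSpace M] [ChartedSpace F M] [IsManifold 𝓘(ℝ, F) ∞ M]

/-- A solution of an autonomous differential equation with smooth right-hand side is smooth. -/
lemma contDiffAt_of_hasDerivAt {f : ℝ → F} {V : F → F} {t₀ : ℝ} (hV : ContDiffAt ℝ ∞ V (f t₀))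
    (hf : ∀ᶠ t in 𝓝 t₀, HasDerivAt f (V (f t)) t) : ContDiffAt ℝ ∞ f t₀ := by
  rw [contDiffAt_infty]
  intro n
  obtain ⟨U, hU, hVU⟩ := (contDiffAt_infty.1 hV n).contDiffOn (le_refl _) (by simp)
  have hcont : ContinuousAt f t₀ := hf.self_of_nhds.continuousAt
  obtain ⟨I, hI, hIo, ht₀⟩ := eventually_nhds_iff.1 (hf.and (hcont hU))
  have hder : ∀ t ∈ I, deriv f t = V (f t) := fun t ht => (hI t ht).1.deriv
  have key : ∀ m : ℕ, m ≤ n → ContDiffOn ℝ m f I := by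
    intro m
    induction m with
    | zero =>
      intro _
      exact contDiffOn_zero.2 fun t ht => (hI t ht).1.continuousAt.continuousWithinAt
    | succ m ih =>
      intro hm
      have h1 := ih (by omega)
      push_cast
      rw [contDiffOn_succ_iff_deriv_of_isOpen hIo]
      refine ⟨fun t ht => (hI t ht).1.differentiableAt.differentiableWithinAt, by simp, ?_⟩
      refine ContDiffOn.congr ?_ hder
      refine ContDiffOn.comp (hVU.of_le (by exact_mod_cast (by omega : m ≤ n))) h1
        fun t ht => ?_
      simpa using (hI t ht).2
  exact (key n le_rfl).contDiffAt (hIo.mem_nhds ht₀)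

lemma IsMIntegralCurve.smooth {γ : ℝ → M} {V : M → F} (hV : IsSmoothVF (F := F) V)
    (hγ : IsMIntegralCurve (I := 𝓘(ℝ, F)) γ V) : Smooth ℝ F γ := by
  intro t₀
  have hd : ∀ t, MDAt ℝ F γ t := fun t => (hγ t).mdifferentiableAt
  have hc : Continuous γ := hγ.continuous
  have hev : ∀ᶠ t in 𝓝 t₀, γ t ∈ (extChartAt 𝓘(ℝ, F) (γ t₀)).source :=
    hc.continuousAt ((isOpen_extChartAt_source (I := 𝓘(ℝ, F)) (γ t₀)).mem_nhds
      (mem_extChartAt_source _))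
  have h1 : ContDiffAt ℝ ∞ (fun t => extChartAt 𝓘(ℝ, F) (γ t₀) (γ t)) t₀ := by
    refine contDiffAt_of_hasDerivAt (V := chartVF (γ t₀) V) (contDiffAt_chartVF hV (γ t₀)) ?_
    filter_upwards [hev] with t ht
    have h2 : HasFDerivAt (fun t => extChartAt 𝓘(ℝ, F) (γ t₀) (γ t)) _ t :=
      (MDifferentiableAt.comp t (mdAt_extChartAt ht) (hd t)).differentiableAt.hasFDerivAt
    have h3 := h2.hasDerivAt
    have h4 := mder_comp' (F' := F) (g := extChartAt 𝓘(ℝ, F) (γ t₀)) (f := γ) t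
      (mdAt_extChartAt ht) (hd t) (1 : ℝ)
    rw [mder_eq_fderiv] at h4
    have h5 : mder ℝ F γ t (1 : ℝ) = V (γ t) := by
      have h6 := (hγ t).mfderiv
      refine (congrArg (fun L : ℝ →L[ℝ] F => L 1) h6).trans ?_
      exact one_smul ℝ (V (γ t))
    rw [h5] at h4
    have h7 : chartVF (γ t₀) V (extChartAt 𝓘(ℝ, F) (γ t₀) (γ t))
        = mder F F (extChartAt 𝓘(ℝ, F) (γ t₀)) (γ t) (V (γ t)) := by
      unfold chartVF; rw [(extChartAt 𝓘(ℝ, F) (γ t₀)).left_inv ht]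
    rw [h7, ← h4]
    exact h3
  have h2 : ContMDiffAt 𝓘(ℝ, ℝ) 𝓘(ℝ, F) ∞
      (fun t => (extChartAt 𝓘(ℝ, F) (γ t₀)).symm (extChartAt 𝓘(ℝ, F) (γ t₀) (γ t))) t₀ :=
    ContMDiffAt.comp t₀ (g := (extChartAt 𝓘(ℝ, F) (γ t₀)).symm)
      ((contMDiffOn_extChartAt_symm (I := 𝓘(ℝ, F)) (n := ∞) (γ t₀)).contMDiffAt
        (extChartAt_target_mem_nhds (I := 𝓘(ℝ, F)) (γ t₀))) h1.contMDiffAt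
  refine h2.congr_of_eventuallyEq ?_
  filter_upwards [hev] with t ht
  exact ((extChartAt 𝓘(ℝ, F) (γ t₀)).left_inv ht).symm

lemma isMIntegralCurve_iff_mder {γ : ℝ → M} {V : M → F} (hγ : Smooth ℝ F γ) :
    IsMIntegralCurve (I := 𝓘(ℝ, F)) γ V ↔ ∀ t, mder ℝ F γ t 1 = V (γ t) := by
  refine forall_congr' fun t => ⟨fun h => ?_, fun h => ?_⟩
  · exact (congrArg (fun L : ℝ →L[ℝ] F => L 1) h.mfderiv).trans (one_smul ℝ (V (γ t)))
  · refine ((hγ.mdAt t).hasMFDerivAt).congr_mfderiv ?_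
    refine ContinuousLinearMap.ext_ring (h.trans ?_)
    exact (one_smul ℝ (V (γ t))).symm

lemma isMIntegralCurve_unique [T2Space M] {V : M → F} (hV : IsSmoothVF (F := F) V)
    {γ γ' : ℝ → M} (h : IsMIntegralCurve (I := 𝓘(ℝ, F)) γ V)
    (h' : IsMIntegralCurve (I := 𝓘(ℝ, F)) γ' V) (h0 : γ 0 = γ' 0) : γ = γ' := by
  have : IsManifold 𝓘(ℝ, F) 1 M := IsManifold.of_le (n := ∞) (by norm_num)
  exact isMIntegralCurve_Ioo_eq_of_contMDiff_boundaryless (ContMDiff.of_le hV (by norm_num)) h h' h0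

end IntegralCurve

section OneParameter

variable {E : Type*} [NormedAddCommGroup E] [NormedSpace ℝ E]
  {G : Type*} [TopologicalSpace G] [ChartedSpace E G] [Group G] [LieGroup 𝓘(ℝ, E) ∞ G]

lemma t2Space_of_lieGroup (E : Type*) [NormedAddCommGroup E] [NormedSpace ℝ E]
    (G : Type*) [TopologicalSpace G] [ChartedSpace E G] [Group G] [LieGroup 𝓘(ℝ, E) ∞ G] :
    T2Space G := by
  have := topologicalGroup_of_lieGroup 𝓘(ℝ, E) ∞ (G := G)
  have : T1Space G := ChartedSpace.t1Space E G
  infer_instance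

lemma isSmoothVF_leftInvariant (X : E) :
    IsSmoothVF (F := E) (M := G) (fun a => mder E E (fun b : G => a * b) 1 X) := by
  have h := SmoothAlong.mder₂ (smooth₂_mul E G) (f := fun b : G => b) (k := fun _ : G => (1 : G))
    (smoothAlong_zero contMDiff_id)
    ((smoothAlong_const_iff (K := E) (v := fun _ : G => X)).2 contMDiff_const)
  simpa [isSmoothVF_iff] using h

lemma mder_mul_leftInvariant (X : E) (a b : G) :
    mder E E (fun c : G => a * c) b (mder E E (fun c : G => b * c) 1 X)
      = mder E E (fun c : G => a * b * c) 1 X := by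
  have h := mder_comp' (E := E) (F := E) (F' := E) (g := fun c : G => a * c)
    (f := fun c : G => b * c) 1 (((smooth₂_mul E G).right a).mdAt _)
    (((smooth₂_mul E G).right b).mdAt _) X
  simp only [mul_one, ← mul_assoc] at h
  exact h.symm

/-- Every element of the Lie algebra generates a smooth one-parameter subgroup: the integral curve
through `1` of its left-invariant field. This field is complete, as by translation its integral
curves all exist for the same time. -/
lemma exists_oneParameterSubgroup [CompleteSpace E] (X : E) :
    ∃ e : ℝ → G, Smooth ℝ E e ∧ (∀ s t, e (s + t) = e s * e t) ∧ mder ℝ E e 0 1 = X := by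
  have := t2Space_of_lieGroup E G
  have hm1 : IsManifold 𝓘(ℝ, E) 1 G := IsManifold.of_le (n := ∞) (by norm_num)
  obtain ⟨V, hVdef⟩ : ∃ V : G → E, V = fun a => mder E E (fun b : G => a * b) 1 X := ⟨_, rfl⟩
  have hV : IsSmoothVF (F := E) V := hVdef ▸ isSmoothVF_leftInvariant X
  have hV1 : ContMDiff 𝓘(ℝ, E) (𝓘(ℝ, E).prod 𝓘(ℝ, E)) 1
      (fun x => (⟨x, V x⟩ : TangentBundle 𝓘(ℝ, E) G)) := ContMDiff.of_le hV (by norm_num)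
  -- left translations map integral curves to integral curves
  have htrans : ∀ (a : G) (γ : ℝ → G) (t : ℝ) (s : Set ℝ),
      HasMFDerivWithinAt 𝓘(ℝ, ℝ) 𝓘(ℝ, E) γ s t
        ((1 : ℝ →L[ℝ] ℝ).smulRight (V (γ t)) : ℝ →L[ℝ] E) →
      HasMFDerivWithinAt 𝓘(ℝ, ℝ) 𝓘(ℝ, E) (fun t => a * γ t) s t
        ((1 : ℝ →L[ℝ] ℝ).smulRight (V (a * γ t)) : ℝ →L[ℝ] E) := by
    intro a γ t s h
    have h1 := ((((smooth₂_mul E G).right a).mdAt (γ t)).hasMFDerivAt).comp_hasMFDerivWithinAt t h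
    refine h1.congr_mfderiv ?_
    refine ContinuousLinearMap.ext_ring ?_
    have h2 : mder E E (fun c : G => a * c) (γ t) ((1 : ℝ) • V (γ t)) = (1 : ℝ) • V (a * γ t) := by
      rw [one_smul, one_smul, hVdef]
      exact mder_mul_leftInvariant X a (γ t)
    exact h2
  obtain ⟨γ, hγ0, hγ⟩ := exists_isMIntegralCurveAt_of_contMDiffAt_boundaryless (I := 𝓘(ℝ, E))
    (v := V) (t₀ := 0) (hV1 (1 : G))
  obtain ⟨ε, hε, hγε⟩ := isMIntegralCurveAt_iff'.1 hγ
  have hball : Metric.ball (0 : ℝ) ε = Ioo (-ε) ε := by rw [Real.ball_eq_Ioo]; simp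
  rw [hball] at hγε
  obtain ⟨e, he0, he⟩ := exists_isMIntegralCurve_of_isMIntegralCurveOn (I := 𝓘(ℝ, E)) (v := V)
    hV1 hε (fun x => ⟨fun t => x * γ t, by simp only [hγ0, mul_one],
      fun t ht => htrans x γ t _ (hγε t ht)⟩) 1
  have hes : Smooth ℝ E e := IsMIntegralCurve.smooth hV he
  refine ⟨e, hes, fun s t => ?_, ?_⟩
  · have h1 : IsMIntegralCurve (I := 𝓘(ℝ, E)) (fun t => e s * e t) V := fun t => by
      have h := htrans (e s) e t univ (he t).hasMFDerivWithinAt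
      exact h.hasMFDerivAt univ_mem
    have h2 : IsMIntegralCurve (I := 𝓘(ℝ, E)) (fun t => e (t + s)) V := he.comp_add s
    have h3 := isMIntegralCurve_unique hV h2 h1 (by simp [he0])
    rw [add_comm]
    exact congrFun h3 t
  · rw [(isMIntegralCurve_iff_mder hes).1 he 0, he0, hVdef]
    simp [mder_id]

end OneParameter

/-! ### Characters of simply connected Lie groups -/

section ChartFields

variable {F : Type*} [NormedAddCommGroup F] [NormedSpace ℝ F]
  {M : Type*} [TopologicalSpace M] [ChartedSpace F M] [IsManifold 𝓘(ℝ, F) ∞ M]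

lemma contDiffOn_chartVF {V : M → F} (hV : IsSmoothVF (F := F) V) (x₀ : M) :
    ContDiffOn ℝ ∞ (chartVF x₀ V) (extChartAt 𝓘(ℝ, F) x₀).target := by
  intro y hy
  refine ContDiffAt.contDiffWithinAt ?_
  have hx := (extChartAt 𝓘(ℝ, F) x₀).map_target hy
  have hx' := hx
  rw [extChartAt_source] at hx'
  have h1 := (((trivializationAt F (TangentSpace 𝓘(ℝ, F) : M → Type _) x₀).contMDiffAt_iff
    (IB := 𝓘(ℝ, F)) (IM := 𝓘(ℝ, F)) (n := ∞)
    (f := fun p => TotalSpace.mk' F (E := (TangentSpace 𝓘(ℝ, F) : M → Type _)) p (V p))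
    (x₀ := (extChartAt 𝓘(ℝ, F) x₀).symm y)
    ((Trivialization.mem_source _).2 (by simpa using hx'))).1 (hV _)).2
  have h2 := (contMDiffOn_extChartAt_symm (I := 𝓘(ℝ, F)) (n := ∞) x₀).contMDiffAt
    ((isOpen_extChartAt_target (I := 𝓘(ℝ, F)) x₀).mem_nhds hy)
  have h3 := contMDiffAt_iff_contDiffAt.1 (ContMDiffAt.comp y h1 h2)
  refine h3.congr_of_eventuallyEq ?_
  filter_upwards [(isOpen_extChartAt_target (I := 𝓘(ℝ, F)) x₀).mem_nhds hy] with z hz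
  exact (trivializationAt_mder ((extChartAt 𝓘(ℝ, F) x₀).map_target hz) _).symm

/-- The bracket of two fields read in a chart is the bracket of the fields read in that chart. -/
lemma lieBracket_chartVF [CompleteSpace F] {V W : M → F} (hV : IsSmoothVF (F := F) V)
    (hW : IsSmoothVF (F := F) W) {x₀ : M} {y : F} (hy : y ∈ (extChartAt 𝓘(ℝ, F) x₀).target) :
    lieBracket ℝ (chartVF x₀ V) (chartVF x₀ W) y = chartVF x₀ (mbr V W) y := by
  have hinv : ∀ z ∈ (extChartAt 𝓘(ℝ, F) x₀).target,
      (mder F F (extChartAt 𝓘(ℝ, F) x₀).symm z).inverse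
        = mder F F (extChartAt 𝓘(ℝ, F) x₀) ((extChartAt 𝓘(ℝ, F) x₀).symm z) := fun z hz => by
    have h1 := mder_extChartAt_comp_symm hz
    have h2 := mder_extChartAt_symm_comp ((extChartAt 𝓘(ℝ, F) x₀).map_target hz)
    rw [(extChartAt 𝓘(ℝ, F) x₀).right_inv hz] at h2
    exact ContinuousLinearMap.inverse_eq h2 h1
  have hpull : ∀ (V : M → F), ∀ z ∈ (extChartAt 𝓘(ℝ, F) x₀).target,
      mpullback 𝓘(ℝ, F) 𝓘(ℝ, F) (extChartAt 𝓘(ℝ, F) x₀).symm V z = chartVF x₀ V z := fun V z hz =>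
    congrArg (fun L : F →L[ℝ] F => L (V ((extChartAt 𝓘(ℝ, F) x₀).symm z))) (hinv z hz)
  have key : ∀ V : M → F, (mpullback 𝓘(ℝ, F) 𝓘(ℝ, F) (extChartAt 𝓘(ℝ, F) x₀).symm V : F → F)
      =ᶠ[𝓝 y] chartVF x₀ V := fun V => by
    filter_upwards [(isOpen_extChartAt_target (I := 𝓘(ℝ, F)) x₀).mem_nhds hy] with z hz
    exact hpull V z hz
  have : IsManifold 𝓘(ℝ, F) (minSmoothness ℝ 2) M := by
    rw [minSmoothness_of_isRCLikeNormedField]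
    exact IsManifold.of_le (n := ∞) ENat.LEInfty.out
  have : IsManifold 𝓘(ℝ, F) (minSmoothness ℝ 3) M := by
    rw [minSmoothness_of_isRCLikeNormedField]
    exact IsManifold.of_le (n := ∞) ENat.LEInfty.out
  have h2 := (contMDiffOn_extChartAt_symm (I := 𝓘(ℝ, F)) (n := ∞) x₀).contMDiffAt
    ((isOpen_extChartAt_target (I := 𝓘(ℝ, F)) x₀).mem_nhds hy)
  have h := mpullback_mlieBracket (I := 𝓘(ℝ, F)) (I' := 𝓘(ℝ, F)) (n := ∞) (x₀ := y)
    (f := (extChartAt 𝓘(ℝ, F) x₀).symm) (V := V) (W := W)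
    ((hV _).mdifferentiableAt (by simp)) ((hW _).mdifferentiableAt (by simp)) h2
    (by rw [minSmoothness_of_isRCLikeNormedField]; exact ENat.LEInfty.out)
  have h4 : (mlieBracket 𝓘(ℝ, F)
      (mpullback 𝓘(ℝ, F) 𝓘(ℝ, F) (extChartAt 𝓘(ℝ, F) x₀).symm V)
      (mpullback 𝓘(ℝ, F) 𝓘(ℝ, F) (extChartAt 𝓘(ℝ, F) x₀).symm W) y : F)
      = lieBracket ℝ (chartVF x₀ V) (chartVF x₀ W) y := by
    rw [← mlieBracketWithin_univ, mlieBracketWithin_eq_lieBracketWithin]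
    exact (congrFun (lieBracketWithin_univ (𝕜 := ℝ) (E := F)) y).trans
      ((key V).lieBracket_vectorField_eq (key W))
  rw [← h4, ← hpull _ y hy]
  exact h.symm

end ChartFields

section Primitive

variable {E : Type*} [NormedAddCommGroup E] [NormedSpace ℝ E]
  {G : Type*} [TopologicalSpace G] [ChartedSpace E G]

/-- A function with vanishing differential on an open set is locally constant there. -/
lemma eventually_eq_of_mder_eq_zero [IsManifold 𝓘(ℝ, E) ∞ G] {f : G → ℝ} {x : G}
    (h : ∀ᶠ y in 𝓝 x, MDAt E ℝ f y ∧ mder E ℝ f y = 0) : ∀ᶠ y in 𝓝 x, f y = f x := by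
  have ht := extChartAt_target_mem_nhds (I := 𝓘(ℝ, E)) x
  have hc : Tendsto (extChartAt 𝓘(ℝ, E) x).symm (𝓝 (extChartAt 𝓘(ℝ, E) x x)) (𝓝 x) := by
    have := continuousAt_extChartAt_symm (I := 𝓘(ℝ, E)) x
    rwa [ContinuousAt, extChartAt_to_inv] at this
  obtain ⟨ε, hε, hball⟩ := Metric.mem_nhds_iff.1 (Filter.inter_mem ht (hc.eventually h))
  have hd : ∀ z ∈ Metric.ball (extChartAt 𝓘(ℝ, E) x x) ε,
      MDAt E ℝ (fun z => f ((extChartAt 𝓘(ℝ, E) x).symm z)) z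
        ∧ mder E ℝ (fun z => f ((extChartAt 𝓘(ℝ, E) x).symm z)) z = 0 := fun z hz => by
    have hz' := hball hz
    have h1 := mdAt_extChartAt_symm hz'.1
    refine ⟨MDifferentiableAt.comp z hz'.2.1 h1, ?_⟩
    exact (mder_comp z hz'.2.1 h1).trans (by rw [hz'.2.2, ContinuousLinearMap.zero_comp])
  obtain ⟨c, hcst⟩ := Metric.isOpen_ball.exists_is_const_of_fderiv_eq_zero (𝕜 := ℝ)
    (f := fun z => f ((extChartAt 𝓘(ℝ, E) x).symm z))
    ((convex_ball (extChartAt 𝓘(ℝ, E) x x) ε).isPreconnected)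
    (fun z hz => (hd z hz).1.differentiableAt.differentiableWithinAt)
    (fun z hz => by rw [← mder_eq_fderiv]; exact (hd z hz).2)
  have h0 : f x = c := by simpa using hcst _ (Metric.mem_ball_self hε)
  filter_upwards [extChartAt_source_mem_nhds (I := 𝓘(ℝ, E)) x,
    (continuousAt_extChartAt (I := 𝓘(ℝ, E)) x).preimage_mem_nhds (Metric.ball_mem_nhds _ hε)]
    with y hy hy2
  have := hcst _ hy2
  rw [(extChartAt 𝓘(ℝ, E) x).left_inv hy] at this
  rw [this, h0]

variable [Group G]

/-- The function `f` is smooth near `a`, and a primitive of the left-invariant form that is given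
by the covector `l` at `1`. -/
def IsPrimitiveAt (l : E →L[ℝ] ℝ) (f : G → ℝ) (a : G) : Prop :=
  ContMDiffAt 𝓘(ℝ, E) 𝓘(ℝ, ℝ) ∞ f a ∧
    ∀ X : E, mder E ℝ f a (mder E E (fun b : G => a * b) 1 X) = l X

variable [LieGroup 𝓘(ℝ, E) ∞ G]

lemma mder_mul_left_comp_inv (a : G) :
    (mder E E (fun b : G => a * b) 1).comp (mder E E (fun b : G => a⁻¹ * b) a)
      = ContinuousLinearMap.id ℝ E ∧
    (mder E E (fun b : G => a⁻¹ * b) a).comp (mder E E (fun b : G => a * b) 1)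
      = ContinuousLinearMap.id ℝ E := by
  constructor
  · ext v
    have h := mder_comp' (E := E) (F := E) (F' := E) (g := fun b : G => a * b)
      (f := fun b : G => a⁻¹ * b) a (((smooth₂_mul E G).right a).mdAt _)
      (((smooth₂_mul E G).right a⁻¹).mdAt _) v
    simp only [inv_mul_cancel, mul_inv_cancel_left, mder_id] at h
    exact h.symm
  · ext v
    have h := mder_comp' (E := E) (F := E) (F' := E) (g := fun b : G => a⁻¹ * b)
      (f := fun b : G => a * b) 1 (((smooth₂_mul E G).right a⁻¹).mdAt _)
      (((smooth₂_mul E G).right a).mdAt _) v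
    simp only [mul_one, inv_mul_cancel_left, mder_id] at h
    exact h.symm

lemma IsPrimitiveAt.eventually_eq {l : E →L[ℝ] ℝ} {f k : G → ℝ} {a : G}
    (hf : ∀ᶠ b in 𝓝 a, IsPrimitiveAt l f b) (hk : ∀ᶠ b in 𝓝 a, IsPrimitiveAt l k b) :
    ∀ᶠ b in 𝓝 a, f b - k b = f a - k a := by
  refine eventually_eq_of_mder_eq_zero (E := E) (f := fun b => f b - k b) ?_
  filter_upwards [hf, hk] with b hb1 hb2
  have d1 := hb1.1.mdifferentiableAt (by simp)
  have d2 := hb2.1.mdifferentiableAt (by simp)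
  refine ⟨d1.sub d2, ?_⟩
  have h : mder E ℝ (fun b => f b - k b) b = mder E ℝ f b - mder E ℝ k b := mfderiv_sub d1 d2
  ext v
  have hv : v = mder E E (fun c : G => b * c) 1 (mder E E (fun c : G => b⁻¹ * c) b v) :=
    (congrArg (fun L : E →L[ℝ] E => L v) (mder_mul_left_comp_inv b).1).symm
  rw [h, hv]
  change mder E ℝ f b _ - mder E ℝ k b _ = 0
  rw [hb1.2, hb2.2, sub_self]

lemma IsPrimitiveAt.translate {l : E →L[ℝ] ℝ} {f : G → ℝ} {a b : G}
    (hf : IsPrimitiveAt l f (b * a)) : IsPrimitiveAt l (fun c => f (b * c)) a := by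
  have hs := (smooth₂_mul E G).right b
  refine ⟨ContMDiffAt.comp a hf.1 (hs a), fun X => ?_⟩
  have h := mder_comp' (E := E) (F := E) (F' := ℝ) (g := f) (f := fun c => b * c) a
    (hf.1.mdifferentiableAt (by simp)) (hs.mdAt a) (mder E E (fun c : G => a * c) 1 X)
  rw [h, mder_mul_leftInvariant, hf.2]

lemma IsPrimitiveAt.congr {l : E →L[ℝ] ℝ} {f k : G → ℝ} {a : G} {c : ℝ}
    (hf : IsPrimitiveAt l f a) (h : ∀ᶠ b in 𝓝 a, k b = f b + c) : IsPrimitiveAt l k a := by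
  have h1 : IsPrimitiveAt l (fun b => f b + c) a := by
    refine ⟨hf.1.add contMDiffAt_const, fun X => ?_⟩
    have d1 := hf.1.mdifferentiableAt (by simp)
    have h : mder E ℝ (fun b => f b + c) a = mder E ℝ f a + mder E ℝ (fun _ => c) a :=
      mfderiv_add d1 mdifferentiableAt_const
    rw [h, mder_const, add_zero, hf.2]
  exact ⟨h1.1.congr_of_eventuallyEq h, fun X => by rw [mder_congr h]; exact h1.2 X⟩

/-- A left-invariant form that kills brackets is closed, and so has a primitive near `1`. -/
lemma exists_isPrimitiveAt [FiniteDimensional ℝ E] {l : E →L[ℝ] ℝ}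
    (hl : ∀ Y Z, l (lbr G Y Z) = 0) :
    ∃ f : G → ℝ, ∃ U : Set G, IsOpen U ∧ 1 ∈ U ∧ ∀ a ∈ U, IsPrimitiveAt l f a := by
  have : CompleteSpace E := FiniteDimensional.complete ℝ E
  let L : E → G → E := fun X a => mder E E (fun b : G => a * b) 1 X
  have hL : ∀ X, IsSmoothVF (F := E) (L X) := isSmoothVF_leftInvariant
  have hLbr : ∀ X Z, mbr (L X) (L Z) = L (lbr G X Z) := fun X Z =>
    (mulInvariantVector_mlieBracket (I := 𝓘(ℝ, E)) (G := G) X Z).symm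
  -- `T y` is the trivialization of the tangent space by left-invariant fields, read in a chart
  let T : E → E →L[ℝ] E := fun y =>
    (mder E E (extChartAt 𝓘(ℝ, E) (1 : G)) ((extChartAt 𝓘(ℝ, E) (1 : G)).symm y)).comp
      (mder E E (fun b : G => (extChartAt 𝓘(ℝ, E) (1 : G)).symm y * b) 1)
  have hT : ∀ y X, T y X = chartVF 1 (L X) y := fun y X => rfl
  have hTinv : ∀ y ∈ (extChartAt 𝓘(ℝ, E) (1 : G)).target, (T y).comp
      ((mder E E (fun b : G => ((extChartAt 𝓘(ℝ, E) (1 : G)).symm y)⁻¹ * b)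
        ((extChartAt 𝓘(ℝ, E) (1 : G)).symm y)).comp (mder E E (extChartAt 𝓘(ℝ, E) (1 : G)).symm y))
      = ContinuousLinearMap.id ℝ E ∧
      ((mder E E (fun b : G => ((extChartAt 𝓘(ℝ, E) (1 : G)).symm y)⁻¹ * b)
        ((extChartAt 𝓘(ℝ, E) (1 : G)).symm y)).comp
          (mder E E (extChartAt 𝓘(ℝ, E) (1 : G)).symm y)).comp (T y)
      = ContinuousLinearMap.id ℝ E := fun y hy => by
    have h1 := mder_extChartAt_comp_symm hy
    have h2 := mder_extChartAt_symm_comp ((extChartAt 𝓘(ℝ, E) (1 : G)).map_target hy)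
    rw [(extChartAt 𝓘(ℝ, E) (1 : G)).right_inv hy] at h2
    obtain ⟨h3, h4⟩ := mder_mul_left_comp_inv (E := E) ((extChartAt 𝓘(ℝ, E) (1 : G)).symm y)
    constructor
    · ext v
      have e3 := fun v => congrArg (fun L : E →L[ℝ] E => L v) h3
      have e1 := fun v => congrArg (fun L : E →L[ℝ] E => L v) h1
      exact (congrArg _ (e3 _)).trans (e1 v)
    · ext v
      have e4 := fun v => congrArg (fun L : E →L[ℝ] E => L v) h4
      have e2 := fun v => congrArg (fun L : E →L[ℝ] E => L v) h2
      exact (congrArg _ (e2 _)).trans (e4 v)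
  have hTi : ∀ y ∈ (extChartAt 𝓘(ℝ, E) (1 : G)).target, (T y).IsInvertible := fun y hy =>
    ContinuousLinearMap.IsInvertible.of_inverse (hTinv y hy).1 (hTinv y hy).2
  have hTs : ContDiffOn ℝ ∞ T (extChartAt 𝓘(ℝ, E) (1 : G)).target :=
    contDiffOn_clm_apply.2 fun X => contDiffOn_chartVF (hL X) 1
  -- the left-invariant form in the chart
  let ϖ : E → E →L[ℝ] ℝ := fun y => l.comp (T y).inverse
  have hϖs : ContDiffOn ℝ ∞ ϖ (extChartAt 𝓘(ℝ, E) (1 : G)).target := by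
    refine contDiffOn_const.clm_comp fun y hy => ?_
    exact ((hTi y hy).contDiffAt_map_inverse).comp_contDiffWithinAt y (hTs y hy)
  have hϖT : ∀ y ∈ (extChartAt 𝓘(ℝ, E) (1 : G)).target, ∀ X, ϖ y (T y X) = l X := fun y hy X => by
    change l ((T y).inverse (T y X)) = l X
    rw [(hTi y hy).inverse_apply_self]
  obtain ⟨ε, hε, hball⟩ := Metric.mem_nhds_iff.1 (extChartAt_target_mem_nhds (I := 𝓘(ℝ, E)) (1 : G))
  have hto := isOpen_extChartAt_target (I := 𝓘(ℝ, E)) (1 : G)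
  have hsymm : ∀ y ∈ Metric.ball (extChartAt 𝓘(ℝ, E) (1 : G) 1) ε, ∀ x z,
      fderiv ℝ ϖ y x z = fderiv ℝ ϖ y z x := by
    intro y hy x z
    have hyt := hball hy
    have hx : ∀ v, ∃ X, T y X = v := fun v =>
      ⟨_, congrArg (fun L : E →L[ℝ] E => L v) (hTinv y hyt).1⟩
    obtain ⟨X, rfl⟩ := hx x
    obtain ⟨Z, rfl⟩ := hx z
    have hϖd : DifferentiableAt ℝ ϖ y :=
      (hϖs.contDiffAt (hto.mem_nhds hyt)).differentiableAt (by simp)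
    have hcd : ∀ X, DifferentiableAt ℝ (chartVF 1 (L X)) y := fun X =>
      ((contDiffOn_chartVF (hL X) 1).contDiffAt (hto.mem_nhds hyt)).differentiableAt (by simp)
    -- differentiate the constant `ϖ (L Z) = l Z`
    have hder : ∀ X Z, fderiv ℝ ϖ y (T y X) (T y Z)
        = - ϖ y (fderiv ℝ (chartVF 1 (L Z)) y (T y X)) := fun X Z => by
      have h1 : fderiv ℝ (fun y => ϖ y (chartVF 1 (L Z) y)) y (T y X)
          = ϖ y (fderiv ℝ (chartVF 1 (L Z)) y (T y X)) + fderiv ℝ ϖ y (T y X) (T y Z) := by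
        rw [fderiv_clm_apply hϖd (hcd Z)]; rfl
      have h2 : (fun y => ϖ y (chartVF 1 (L Z) y)) =ᶠ[𝓝 y] fun _ => l Z := by
        filter_upwards [hto.mem_nhds hyt] with y' hy'
        exact hϖT y' hy' Z
      rw [h2.fderiv_eq] at h1
      simp only [fderiv_fun_const, Pi.zero_apply, _root_.zero_apply] at h1
      linarith
    have hbr := lieBracket_chartVF (hL X) (hL Z) hyt
    rw [hLbr, lieBracket] at hbr
    have h5 : ϖ y (fderiv ℝ (chartVF 1 (L Z)) y (T y X))
        - ϖ y (fderiv ℝ (chartVF 1 (L X)) y (T y Z)) = 0 := by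
      rw [← map_sub]
      have := (congrArg (ϖ y) hbr).trans (hϖT y hyt (lbr G X Z))
      rw [hl] at this
      exact this
    rw [hder, hder]
    linarith
  obtain ⟨f, hf⟩ := (convex_ball (extChartAt 𝓘(ℝ, E) (1 : G) 1)
    ε).exists_forall_hasFDerivAt_of_fderiv_symmetric Metric.isOpen_ball
    (fun y hy => ((hϖs.contDiffAt (hto.mem_nhds (hball hy))).differentiableAt
      (by simp)).differentiableWithinAt) hsymm
  have hfs : ContDiffOn ℝ ∞ f (Metric.ball (extChartAt 𝓘(ℝ, E) (1 : G) 1) ε) := by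
    rw [contDiffOn_infty_iff_fderiv_of_isOpen Metric.isOpen_ball]
    exact ⟨fun y hy => (hf y hy).differentiableAt.differentiableWithinAt,
      (hϖs.mono hball).congr fun y hy => (hf y hy).fderiv⟩
  refine ⟨fun a => f (extChartAt 𝓘(ℝ, E) (1 : G) a),
    (extChartAt 𝓘(ℝ, E) (1 : G)).source ∩ extChartAt 𝓘(ℝ, E) (1 : G) ⁻¹'
      Metric.ball (extChartAt 𝓘(ℝ, E) (1 : G) 1) ε,
    (continuousOn_extChartAt (1 : G)).isOpen_inter_preimage (isOpen_extChartAt_source (1 : G))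
      Metric.isOpen_ball, ⟨mem_extChartAt_source (1 : G), Metric.mem_ball_self hε⟩, ?_⟩
  rintro a ⟨ha, hab⟩
  have hfa := hfs.contDiffAt (Metric.isOpen_ball.mem_nhds hab)
  have ha' := ha
  rw [extChartAt_source] at ha'
  refine ⟨ContMDiffAt.comp a hfa.contMDiffAt (contMDiffAt_extChartAt' ha'), fun X => ?_⟩
  rw [mder_comp' a (hfa.contMDiffAt.mdifferentiableAt (by simp)) (mdAt_extChartAt ha),
    mder_eq_fderiv, (hf _ hab).fderiv]
  have h6 := hϖT _ (hball hab) X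
  rw [hT, chartVF, (extChartAt 𝓘(ℝ, E) (1 : G)).left_inv ha] at h6
  exact h6

end Primitive

section Character

variable {E : Type*} [NormedAddCommGroup E] [NormedSpace ℝ E]
  {G : Type*} [TopologicalSpace G] [ChartedSpace E G] [Group G] [LieGroup 𝓘(ℝ, E) ∞ G]

/-- The real numbers with the discrete topology, the fiber of the covering of primitives. -/
@[ext]
structure DiscreteReal where
  /-- the underlying real number -/
  val : ℝ

instance : TopologicalSpace DiscreteReal := ⊥

instance : DiscreteTopology DiscreteReal := ⟨rfl⟩

/-- The covering space of germs of primitives of a left-invariant form, where `f` is a primitive on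
the neighbourhood `U` of `1`: over `i U`, the number `v` stands for the primitive
`x ↦ f (i⁻¹ x) + v`. -/
def primitiveCore {l : E →L[ℝ] ℝ} {f : G → ℝ} {U : Set G} (hU : IsOpen U) (h1 : 1 ∈ U)
    (hf : ∀ a ∈ U, IsPrimitiveAt l f a) : FiberBundleCore G G DiscreteReal where
  baseSet i := {x | i⁻¹ * x ∈ U}
  isOpen_baseSet i := hU.preimage ((smooth₂_mul E G).right i⁻¹).continuous
  indexAt x := x
  mem_baseSet_at x := by simpa using h1
  coordChange i j x v := ⟨v.val + (f (i⁻¹ * x) - f (j⁻¹ * x))⟩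
  coordChange_self i x _ v := by
    rw [sub_self, add_zero]
  coordChange_comp i j k x _ v := by
    ext
    simp only
    ring
  continuousOn_coordChange i j := by
    rintro ⟨x, v⟩ ⟨⟨hxi, hxj⟩, -⟩
    refine ContinuousAt.continuousWithinAt ?_
    have hnear : ∀ i : G, i⁻¹ * x ∈ U →
        ∀ᶠ y in 𝓝 x, IsPrimitiveAt l (fun c => f (i⁻¹ * c)) y := fun i hi => by
      filter_upwards [(hU.preimage ((smooth₂_mul E G).right i⁻¹).continuous).mem_nhds hi] with y hy
      exact (hf _ hy).translate
    have hc := IsPrimitiveAt.eventually_eq (hnear i hxi) (hnear j hxj)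
    have hv : ∀ᶠ p : G × DiscreteReal in 𝓝 (x, v), p.2 = v :=
      (continuous_snd.continuousAt (x := (x, v))).eventually
        ((isOpen_discrete ({v} : Set DiscreteReal)).mem_nhds rfl)
    have hx : ∀ᶠ p : G × DiscreteReal in 𝓝 (x, v),
        f (i⁻¹ * p.1) - f (j⁻¹ * p.1) = f (i⁻¹ * x) - f (j⁻¹ * x) :=
      (continuous_fst.continuousAt (x := (x, v))).eventually hc
    refine (continuousAt_const
      (y := (⟨v.val + (f (i⁻¹ * x) - f (j⁻¹ * x))⟩ : DiscreteReal))).congr ?_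
    filter_upwards [hv, hx] with p hp1 hp2
    simp only [hp1, hp2]

/-- A covector that kills brackets is the differential of a character, if the group is simply
connected: a global section of the covering of germs of primitives is a global primitive `k`, and
`k (a b) - k b` does not depend on `b`, as translates of primitives are primitives. -/
lemma exists_character [FiniteDimensional ℝ E] [SimplyConnectedSpace G] {l : E →L[ℝ] ℝ}
    (hl : ∀ Y Z, l (lbr G Y Z) = 0) :
    ∃ χ : G → ℝ, Smooth E ℝ χ ∧ (∀ a b, χ (a * b) = χ a + χ b) ∧ mder E ℝ χ 1 = l := by
  have : LocallyPathConnectedSpace G := ChartedSpace.locallyPathConnectedSpace E G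
  obtain ⟨f, U, hU, h1, hf⟩ := exists_isPrimitiveAt hl
  let Z := primitiveCore hU h1 hf
  have hcov : IsCoveringMap (π DiscreteReal Z.Fiber) := FiberBundle.isCoveringMap
  obtain ⟨S, ⟨-, hS⟩, -⟩ := hcov.existsUnique_continuousMap_lifts (ContinuousMap.id G) 1
    (⟨1, (⟨0⟩ : DiscreteReal)⟩ : Z.TotalSpace) rfl
  have hS' : ∀ x, (S x).1 = x := fun x => congrFun hS x
  let k : G → ℝ := fun x => DiscreteReal.val (S x).2
  have hk : ∀ a, IsPrimitiveAt l k a := by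
    intro a
    have hbase : a ∈ Z.baseSet a := Z.mem_baseSet_at a
    have hc : ContinuousAt (fun x => (Z.localTriv a (S x)).2) a := by
      refine continuous_snd.continuousAt.comp (ContinuousAt.comp ?_ S.continuous.continuousAt)
      refine (Z.localTriv a).continuousAt ?_
      rw [Trivialization.mem_source]
      change (S a).1 ∈ Z.baseSet a
      rwa [hS' a]
    have hev : ∀ᶠ x in 𝓝 a, (Z.localTriv a (S x)).2 = (Z.localTriv a (S a)).2 :=
      hc.eventually ((isOpen_discrete {(Z.localTriv a (S a)).2}).mem_nhds rfl)
    have hval : ∀ x, (Z.localTriv a (S x)).2.val = k x + (f 1 - f (a⁻¹ * x)) := fun x => by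
      change (k x + (f ((S x).1⁻¹ * (S x).1) - f (a⁻¹ * (S x).1)) : ℝ) = _
      rw [hS' x, inv_mul_cancel]
    have hprim : IsPrimitiveAt l (fun x => f (a⁻¹ * x)) a :=
      IsPrimitiveAt.translate (by rw [inv_mul_cancel]; exact hf 1 h1)
    refine hprim.congr (c := (Z.localTriv a (S a)).2.val - f 1) ?_
    filter_upwards [hev] with x hx
    have h2 := hval x
    rw [show (Z.localTriv a (S x)).2.val = (Z.localTriv a (S a)).2.val from
      congrArg DiscreteReal.val hx] at h2
    linarith
  have hks : Smooth E ℝ k := fun a => (hk a).1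
  have hadd : ∀ a b, k (a * b) - k b = k a - k 1 := by
    intro a b
    have hloc : IsLocallyConstant (fun b => k (a * b) - k b) := by
      rw [IsLocallyConstant.iff_eventually_eq]
      intro b
      exact IsPrimitiveAt.eventually_eq (Eventually.of_forall fun c => (hk (a * c)).translate)
        (Eventually.of_forall hk)
    have := hloc.apply_eq_of_preconnectedSpace b 1
    simpa using this
  refine ⟨fun a => k a - k 1, hks.sub contMDiff_const, fun a b => ?_, ?_⟩
  · have := hadd a b
    linarith
  · have h2 : IsPrimitiveAt l (fun a => k a - k 1) 1 :=
      (hk 1).congr (c := - k 1) (Eventually.of_forall fun b => sub_eq_add_neg _ _)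
    ext X
    have h3 := h2.2 X
    simp only [one_mul, mder_id] at h3
    exact h3

end Character

/-! ### Flows of invariant vector fields on homogeneous spaces -/

section Sections

variable {E : Type*} [NormedAddCommGroup E] [NormedSpace ℝ E]
  {N : Type*} [TopologicalSpace N] [ChartedSpace E N] [IsManifold 𝓘(ℝ, E) ∞ N]
  {F : Type*} [NormedAddCommGroup F] [NormedSpace ℝ F] [FiniteDimensional ℝ F]
  {M : Type*} [TopologicalSpace M] [ChartedSpace F M] [IsManifold 𝓘(ℝ, F) ∞ M]

/-- A map with surjective differential has smooth local sections. -/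
lemma exists_local_section {p : N → M} (hp : Smooth E F p) (n : N)
    (hsurj : Function.Surjective (mder E F p n)) :
    ∃ σ : M → N, σ (p n) = n ∧ ContMDiffAt 𝓘(ℝ, F) 𝓘(ℝ, E) ∞ σ (p n)
      ∧ ∀ᶠ x in 𝓝 (p n), p (σ x) = x := by
  have : CompleteSpace F := FiniteDimensional.complete ℝ F
  obtain ⟨R, hR⟩ := (mder E F p n).toLinearMap.exists_rightInverse_of_surjective
    (LinearMap.range_eq_top.2 hsurj)
  let L : F →L[ℝ] E := LinearMap.toContinuousLinearMap R
  have hL : ∀ v, mder E F p n (L v) = v := fun v => LinearMap.congr_fun hR v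
  let s : F → N := fun v => (extChartAt 𝓘(ℝ, E) n).symm (extChartAt 𝓘(ℝ, E) n n + L v)
  have hs0 : s 0 = n := by simp [s]
  have hi : ContMDiffAt 𝓘(ℝ, F) 𝓘(ℝ, E) ∞ (fun v : F => extChartAt 𝓘(ℝ, E) n n + L v) 0 :=
    (contDiff_const.add L.contDiff).contMDiff 0
  have ht : ContMDiffAt 𝓘(ℝ, E) 𝓘(ℝ, E) ∞ (extChartAt 𝓘(ℝ, E) n).symm
      (extChartAt 𝓘(ℝ, E) n n + L 0) := by
    rw [map_zero, add_zero]
    exact (contMDiffOn_extChartAt_symm (I := 𝓘(ℝ, E)) (n := ∞) n).contMDiffAt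
      (extChartAt_target_mem_nhds (I := 𝓘(ℝ, E)) n)
  have hs : ContMDiffAt 𝓘(ℝ, F) 𝓘(ℝ, E) ∞ s 0 := ContMDiffAt.comp (0 : F) ht hi
  have hds : mder F E s 0 = L := by
    ext v
    have h1 := mder_comp' (E := F) (F := E) (F' := E) (0 : F) (ht.mdifferentiableAt (by simp))
      (hi.mdifferentiableAt (by simp)) v
    have h2 : mder F E (fun v : F => extChartAt 𝓘(ℝ, E) n n + L v) 0 = L := by
      rw [mder_eq_fderiv, fderiv_const_add]
      exact L.fderiv
    rw [h2, map_zero, add_zero, mder_extChartAt_symm_self] at h1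
    exact h1
  have hc : ContMDiffAt 𝓘(ℝ, F) 𝓘(ℝ, F) ∞ (extChartAt 𝓘(ℝ, F) (p n)) (p (s 0)) := by
    rw [hs0]; exact contMDiffAt_extChartAt
  have hps : ContMDiffAt 𝓘(ℝ, F) 𝓘(ℝ, F) ∞ (fun v => p (s v)) 0 :=
    ContMDiffAt.comp (0 : F) (hp (s 0)) hs
  have hh : ContMDiffAt 𝓘(ℝ, F) 𝓘(ℝ, F) ∞ (fun v => extChartAt 𝓘(ℝ, F) (p n) (p (s v))) 0 :=
    ContMDiffAt.comp (0 : F) hc hps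
  have hh' := contMDiffAt_iff_contDiffAt.1 hh
  have hdh : fderiv ℝ (fun v => extChartAt 𝓘(ℝ, F) (p n) (p (s v))) 0
      = ContinuousLinearMap.id ℝ F := by
    ext v
    rw [← mder_eq_fderiv]
    have h1 := mder_comp' (E := F) (F := F) (F' := F) (0 : F) (hc.mdifferentiableAt (by simp))
      (hps.mdifferentiableAt (by simp)) v
    have h2 := mder_comp' (E := F) (F := E) (F' := F) (0 : F) (hp.mdAt (s 0))
      (hs.mdifferentiableAt (by simp)) v
    rw [hds, hs0, hL] at h2
    rw [h2, hs0, mder_extChartAt_self] at h1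
    exact h1
  have hf' : HasFDerivAt (fun v => extChartAt 𝓘(ℝ, F) (p n) (p (s v)))
      ((ContinuousLinearEquiv.refl ℝ F : F ≃L[ℝ] F) : F →L[ℝ] F) 0 := by
    have h := (hh'.differentiableAt (by simp)).hasFDerivAt
    rw [hdh] at h
    exact h
  let k := hh'.localInverse hf' (by simp)
  have hk := hh'.to_localInverse hf' (by simp)
  have hk0 := hh'.localInverse_apply_image hf' (by simp)
  have hkr := (hh'.hasStrictFDerivAt' hf' (by simp)).eventually_right_inverse
  simp only [hs0] at hk hk0 hkr
  have hck : ContMDiffAt 𝓘(ℝ, F) 𝓘(ℝ, F) ∞ (fun x => k (extChartAt 𝓘(ℝ, F) (p n) x)) (p n) :=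
    ContMDiffAt.comp (p n) hk.contMDiffAt contMDiffAt_extChartAt
  have hσ : ContMDiffAt 𝓘(ℝ, F) 𝓘(ℝ, E) ∞ (fun x => s (k (extChartAt 𝓘(ℝ, F) (p n) x))) (p n) := by
    refine ContMDiffAt.comp (p n) (g := s) ?_ hck
    rw [show k (extChartAt 𝓘(ℝ, F) (p n) (p n)) = 0 from hk0]
    exact hs
  have hσn : s (k (extChartAt 𝓘(ℝ, F) (p n) (p n))) = n := by
    rw [show k (extChartAt 𝓘(ℝ, F) (p n) (p n)) = 0 from hk0, hs0]
  refine ⟨fun x => s (k (extChartAt 𝓘(ℝ, F) (p n) x)), hσn, hσ, ?_⟩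
  have h1 : ∀ᶠ x in 𝓝 (p n), p (s (k (extChartAt 𝓘(ℝ, F) (p n) x)))
      ∈ (extChartAt 𝓘(ℝ, F) (p n)).source := by
    have hcont : ContinuousAt (fun x => p (s (k (extChartAt 𝓘(ℝ, F) (p n) x)))) (p n) :=
      ContinuousAt.comp (g := p) hp.continuous.continuousAt hσ.continuousAt
    refine hcont.eventually ?_
    simp only [hσn]
    exact extChartAt_source_mem_nhds (I := 𝓘(ℝ, F)) (p n)
  have h2 := (continuousAt_extChartAt (I := 𝓘(ℝ, F)) (p n)).eventually hkr
  filter_upwards [h1, h2, extChartAt_source_mem_nhds (I := 𝓘(ℝ, F)) (p n)] with x hx1 hx2 hx3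
  exact (extChartAt 𝓘(ℝ, F) (p n)).injOn hx1 hx3 hx2

end Sections

section Flow

variable {E : Type*} [NormedAddCommGroup E] [NormedSpace ℝ E]
  {G : Type*} [TopologicalSpace G] [ChartedSpace E G] [Group G] [LieGroup 𝓘(ℝ, E) ∞ G]
  {F : Type*} [NormedAddCommGroup F] [NormedSpace ℝ F]
  {M : Type*} [TopologicalSpace M] [ChartedSpace F M] [IsManifold 𝓘(ℝ, F) ∞ M]
  [MulAction G M]

/-- The smooth action `ψ` of `ℝ` on `M` is the flow of the vector field `ζ`, and commutes with the
action of `G`. -/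
structure IsEquivariantFlow (G : Type*) {F : Type*} [NormedAddCommGroup F] [NormedSpace ℝ F]
    {M : Type*} [TopologicalSpace M] [ChartedSpace F M] [SMul G M] (ζ : M → F)
    (ψ : ℝ → M → M) : Prop where
  smooth : Smooth₂ ℝ F F (fun p : ℝ × M => ψ p.1 p.2)
  zero : ∀ x, ψ 0 x = x
  add : ∀ s t x, ψ (s + t) x = ψ s (ψ t x)
  smul : ∀ t (a : G) x, ψ t (a • x) = a • ψ t x
  deriv : ∀ x, mder ℝ F (fun t => ψ t x) 0 1 = ζ x

variable [ContMDiffSMul 𝓘(ℝ, E) 𝓘(ℝ, F) ∞ G M]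

/-- Orbits of the one-parameter subgroup generated by `X` that start at translates of `o` are
integral curves of the invariant field `ζ`, if `X` represents `ζ` at `o`. -/
lemma isMIntegralCurve_translate {ζ : M → F} (hinv : IsInvariantVF G ζ) {o : M} {X : E}
    (hX : fund E G F o X = ζ o) {e : ℝ → G} (he : Smooth ℝ E e)
    (hadd : ∀ s t, e (s + t) = e s * e t) (hder : mder ℝ E e 0 1 = X) (a : G) :
    IsMIntegralCurve (I := 𝓘(ℝ, F)) (fun t => a • e t • o) ζ := by
  have he0 : e 0 = 1 := by simpa using hadd 0 0
  have hs : Smooth ℝ F (fun t => a • e t • o) :=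
    (smooth_smul_left E F M a).comp ((smooth_orbit E G F o).comp he)
  rw [isMIntegralCurve_iff_mder hs]
  intro t
  have h1 : mder ℝ F (fun s => e s • o) 0 1 = ζ o := by
    have h := mder_comp' (E := ℝ) (F := E) (F' := F) (g := fun b : G => b • o) (f := e) 0
      ((smooth_orbit E G F o).mdAt _) (he.mdAt 0) 1
    rw [hder, he0] at h
    exact h.trans hX
  have h2 : mder ℝ F (fun s => (a * e t) • e s • o) 0 1 = ζ (a • e t • o) := by
    have h := mder_comp' (E := ℝ) (F := F) (F' := F) (g := fun y : M => (a * e t) • y)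
      (f := fun s => e s • o) 0 ((smooth_smul_left E F M (a * e t)).mdAt _)
      (Smooth.mdAt ((smooth_orbit E G F o).comp he) 0) 1
    rw [h1, he0, one_smul] at h
    rw [h, ← mul_smul]
    exact hinv (a * e t) o
  have h3 := mder_comp' (E := ℝ) (F := ℝ) (F' := F) (g := fun s => (a * e t) • e s • o)
    (f := fun s : ℝ => s - t) t
    (Smooth.mdAt ((smooth_smul_left E F M (a * e t)).comp ((smooth_orbit E G F o).comp he)) _)
    ((contDiff_id.sub contDiff_const).contMDiff.mdifferentiable (n := ∞) (by simp) t) 1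
  have h4 : mder ℝ ℝ (fun s : ℝ => s - t) t 1 = 1 := by
    rw [mder_eq_fderiv, fderiv_sub_const]; simp
  rw [h4, sub_self, h2] at h3
  rw [← h3]
  refine congrArg (fun f => mder ℝ F f t 1) ?_
  ext s
  rw [mul_smul, ← mul_smul (e t), ← hadd]
  simp

/-- An invariant vector field on a homogeneous space has a complete flow, which commutes with the
group: it moves `a • o` to `a • exp (t X) • o`. -/
lemma exists_isEquivariantFlow [FiniteDimensional ℝ F] [T2Space M]
    [MulAction.IsPretransitive G M] {ζ : M → F}
    (hζ : IsSmoothVF (F := F) ζ) (hinv : IsInvariantVF G ζ) {o : M}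
    (hsub : Function.Surjective (fund E G F o)) {X : E}
    (hX : fund E G F o X = ζ o) {e : ℝ → G} (he : Smooth ℝ E e)
    (hadd : ∀ s t, e (s + t) = e s * e t) (hder : mder ℝ E e 0 1 = X) :
    ∃ ψ : ℝ → M → M, IsEquivariantFlow G ζ ψ ∧ ∀ t, ψ t o = e t • o := by
  have he0 : e 0 = 1 := by simpa using hadd 0 0
  have hcurve := isMIntegralCurve_translate hinv hX he hadd hder
  choose τ hτ using fun x : M => MulAction.exists_smul_eq G o x
  let ψ : ℝ → M → M := fun t x => τ x • e t • o
  have hψ : ∀ t (a : G), ψ t (a • o) = a • e t • o := fun t a =>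
    congrFun (isMIntegralCurve_unique hζ (hcurve (τ (a • o))) (hcurve a)
      (by simp [he0, hτ])) t
  refine ⟨ψ, ⟨?_, fun x => ?_, fun s t x => ?_, fun t a x => ?_, fun x => ?_⟩, fun t => ?_⟩
  · rintro ⟨t₀, x₀⟩
    obtain ⟨σ, hσ1, hσ, hσx⟩ := exists_local_section (smooth_orbit E G F o) 1 hsub
    simp only [one_smul] at hσ1 hσ hσx
    have hxo : (τ x₀)⁻¹ • x₀ = o := by rw [inv_smul_eq_iff, hτ]
    have h1 : ContMDiffAt (𝓘(ℝ, ℝ).prod 𝓘(ℝ, F)) 𝓘(ℝ, E) ∞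
        (fun p : ℝ × M => τ x₀ * σ ((τ x₀)⁻¹ • p.2)) (t₀, x₀) := by
      have h2 : ContMDiffAt (𝓘(ℝ, ℝ).prod 𝓘(ℝ, F)) 𝓘(ℝ, F) ∞
        (fun p : ℝ × M => (τ x₀)⁻¹ • p.2) (t₀, x₀) :=
        ((smooth_smul_left E F M (τ x₀)⁻¹).comp contMDiff_snd) _
      have h3 : ContMDiffAt (𝓘(ℝ, ℝ).prod 𝓘(ℝ, F)) 𝓘(ℝ, E) ∞
          (fun p : ℝ × M => σ ((τ x₀)⁻¹ • p.2)) (t₀, x₀) := by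
        refine ContMDiffAt.comp (t₀, x₀) (g := σ) ?_ h2
        simp only [hxo]
        exact hσ
      exact ContMDiffAt.comp (t₀, x₀) (g := fun b : G => τ x₀ * b)
        (((smooth₂_mul E G).right (τ x₀)) _) h3
    have h4 : ContMDiffAt (𝓘(ℝ, ℝ).prod 𝓘(ℝ, F)) 𝓘(ℝ, F) ∞
        (fun p : ℝ × M => e p.1 • o) (t₀, x₀) :=
      (((smooth_orbit E G F o).comp he).comp contMDiff_fst) _
    have h5 : ContMDiffAt (𝓘(ℝ, ℝ).prod 𝓘(ℝ, F)) 𝓘(ℝ, F) ∞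
        (fun p : ℝ × M => (τ x₀ * σ ((τ x₀)⁻¹ • p.2)) • e p.1 • o) (t₀, x₀) :=
      ContMDiffAt.comp (t₀, x₀) (g := fun q : G × M => q.1 • q.2)
        ((smooth₂_smul E G F M) _) (h1.prodMk h4)
    refine h5.congr_of_eventuallyEq ?_
    have h6 : ∀ᶠ x in 𝓝 x₀, σ ((τ x₀)⁻¹ • x) • o = (τ x₀)⁻¹ • x := by
      have hc : Tendsto (fun x : M => (τ x₀)⁻¹ • x) (𝓝 x₀) (𝓝 o) := by
        have := (smooth_smul_left E F M (τ x₀)⁻¹).continuous.tendsto x₀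
        rwa [hxo] at this
      exact hc.eventually hσx
    have h7 : ∀ᶠ p : ℝ × M in 𝓝 (t₀, x₀), σ ((τ x₀)⁻¹ • p.2) • o = (τ x₀)⁻¹ • p.2 :=
      (continuous_snd.continuousAt (x := (t₀, x₀))).eventually h6
    filter_upwards [h7] with p hp
    rw [← hψ, mul_smul, hp, smul_inv_smul]
  · change τ x • e 0 • o = x
    rw [he0, one_smul, hτ]
  · change τ x • e (s + t) • o = ψ s (τ x • e t • o)
    rw [← mul_smul (τ x) (e t) o, hψ, add_comm, hadd, mul_smul, mul_smul]
  · obtain ⟨b, rfl⟩ := MulAction.exists_smul_eq G o x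
    rw [← mul_smul, hψ, hψ, mul_smul]
  · have h1 := hcurve (τ x) 0
    have hs : Smooth ℝ F (fun t => τ x • e t • o) :=
      (smooth_smul_left E F M (τ x)).comp ((smooth_orbit E G F o).comp he)
    have h2 := (isMIntegralCurve_iff_mder hs).1 (hcurve (τ x)) 0
    simp only [he0, one_smul, hτ] at h2
    exact h2
  · simpa using hψ t 1

variable {ζ : M → F} {ψ : ℝ → M → M}

lemma IsEquivariantFlow.smooth_right (h : IsEquivariantFlow G ζ ψ) (t : ℝ) : Smooth F F (ψ t) :=
  h.smooth.right t

lemma IsEquivariantFlow.smooth_left (h : IsEquivariantFlow G ζ ψ) (x : M) :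
    Smooth ℝ F (fun t => ψ t x) :=
  h.smooth.left x

lemma IsEquivariantFlow.mder_fund (h : IsEquivariantFlow G ζ ψ) (t : ℝ) (x : M) (Y : E) :
    mder F F (ψ t) x (fund E G F x Y) = fund E G F (ψ t x) Y := by
  have h1 := mder_comp' (E := E) (F := F) (F' := F) (g := ψ t) (f := fun a : G => a • x) 1
    ((h.smooth_right t).mdAt _) ((smooth_orbit E G F x).mdAt 1) Y
  simp only [h.smul, one_smul] at h1
  exact h1.symm

lemma IsEquivariantFlow.mder_time (h : IsEquivariantFlow G ζ ψ) (t : ℝ) (x : M) :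
    mder ℝ F (fun t => ψ t x) t 1 = ζ (ψ t x) := by
  have h3 := mder_comp' (E := ℝ) (F := ℝ) (F' := F) (g := fun s => ψ s (ψ t x))
    (f := fun s : ℝ => s - t) t ((h.smooth_left _).mdAt _)
    ((contDiff_id.sub contDiff_const).contMDiff.mdifferentiable (n := ∞) (by simp) t) 1
  have h4 : mder ℝ ℝ (fun s : ℝ => s - t) t 1 = 1 := by
    rw [mder_eq_fderiv, fderiv_sub_const]; simp
  rw [h4, sub_self, h.deriv] at h3
  rw [← h3]
  refine congrArg (fun f => mder ℝ F f t 1) ?_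
  ext s
  rw [← h.add]
  simp

end Flow

/-! ### Invariant metrics, endomorphisms and their infinitesimal automorphisms -/

section SmoothTensors

variable {F : Type*} [NormedAddCommGroup F] [NormedSpace ℝ F]
  {M : Type*} [TopologicalSpace M] [ChartedSpace F M] [IsManifold 𝓘(ℝ, F) ∞ M]

lemma IsSmoothEndo.isSmoothVF_apply
    {J : ∀ x : M, TangentSpace 𝓘(ℝ, F) x →L[ℝ] TangentSpace 𝓘(ℝ, F) x}
    (hJ : IsSmoothEndo J) {V : ∀ x : M, TangentSpace 𝓘(ℝ, F) x} (hV : IsSmoothVF V) :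
    IsSmoothVF (fun x => J x (V x)) := by
  have : IsManifold 𝓘(ℝ, F) 1 M := IsManifold.of_le (n := ∞) (by norm_num)
  exact ContMDiff.clm_bundle_apply (F₁ := F) (F₂ := F) (b := fun x : M => x) (IB := 𝓘(ℝ, F))
    (E₁ := (TangentSpace 𝓘(ℝ, F) : M → Type _)) (E₂ := (TangentSpace 𝓘(ℝ, F) : M → Type _)) hJ hV

lemma IsSmoothOneForm.smooth_apply {α : ∀ x : M, TangentSpace 𝓘(ℝ, F) x →L[ℝ] ℝ}
    (hα : IsSmoothOneForm α) {V : ∀ x : M, TangentSpace 𝓘(ℝ, F) x} (hV : IsSmoothVF V) :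
    Smooth F ℝ (fun x => α x (V x)) := by
  have : IsManifold 𝓘(ℝ, F) 1 M := IsManifold.of_le (n := ∞) (by norm_num)
  have h := ContMDiff.clm_bundle_apply (F₁ := F) (F₂ := ℝ) (b := fun x : M => x) (IB := 𝓘(ℝ, F))
    (E₁ := (TangentSpace 𝓘(ℝ, F) : M → Type _)) (E₂ := Bundle.Trivial M ℝ) hα hV
  exact fun x => by simpa using (contMDiffAt_totalSpace.1 (h x)).2

lemma smooth_rmetric (g : RMetric F M) {V W : ∀ x : M, TangentSpace 𝓘(ℝ, F) x}
    (hV : IsSmoothVF V) (hW : IsSmoothVF W) :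
    Smooth F ℝ (fun x => g.inner x (V x) (W x)) := by
  have : IsManifold 𝓘(ℝ, F) 1 M := IsManifold.of_le (n := ∞) (by norm_num)
  have h := ContMDiff.clm_bundle_apply₂ (F₁ := F) (F₂ := F) (F₃ := ℝ) (b := fun x : M => x)
    (IB := 𝓘(ℝ, F))
    (E₁ := (TangentSpace 𝓘(ℝ, F) : M → Type _)) (E₂ := (TangentSpace 𝓘(ℝ, F) : M → Type _))
    (E₃ := Bundle.Trivial M ℝ) g.contMDiff hV hW
  exact fun x => by simpa using (contMDiffAt_totalSpace.1 (h x)).2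

end SmoothTensors

section InvariantTensors

variable {E : Type*} [NormedAddCommGroup E] [NormedSpace ℝ E]
  {G : Type*} [TopologicalSpace G] [ChartedSpace E G] [Group G] [LieGroup 𝓘(ℝ, E) ∞ G]
  {F : Type*} [NormedAddCommGroup F] [NormedSpace ℝ F]
  {M : Type*} [TopologicalSpace M] [ChartedSpace F M] [IsManifold 𝓘(ℝ, F) ∞ M]
  [MulAction G M] [ContMDiffSMul 𝓘(ℝ, E) 𝓘(ℝ, F) ∞ G M]

/-- `g` is a Riemannian metric and `J` an endomorphism field, both smooth, in terms of the model
space. -/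
structure IsMetricEndo (g : M → F →L[ℝ] F →L[ℝ] ℝ) (J : M → F →L[ℝ] F) : Prop where
  symm : ∀ x u v, g x u v = g x v u
  pos : ∀ x u, u ≠ 0 → 0 < g x u u
  smooth_metric : ∀ {V W : M → F}, IsSmoothVF (F := F) V → IsSmoothVF (F := F) W →
    Smooth F ℝ (fun x => g x (V x) (W x))
  smooth_endo : ∀ {V : M → F}, IsSmoothVF (F := F) V → IsSmoothVF (F := F) (fun x => J x (V x))

lemma IsMetricEndo.eq_zero {g : M → F →L[ℝ] F →L[ℝ] ℝ} {J : M → F →L[ℝ] F}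
    (h : IsMetricEndo g J) {x : M} {u : F} (hu : ∀ v, g x u v = 0) : u = 0 := by
  by_contra hne
  exact (h.pos x u hne).ne' (hu u)

/-- The group `G` preserves the metric `g` and the endomorphism field `J`. -/
structure IsInvariantMetricEndo (G : Type*) [SMul G M] (g : M → F →L[ℝ] F →L[ℝ] ℝ)
    (J : M → F →L[ℝ] F) : Prop where
  metric : ∀ (a : G) x u v, g (a • x) (actDeriv F a x u) (actDeriv F a x v) = g x u v
  endo : ∀ (a : G) x u, actDeriv F a x (J x u) = J (a • x) (actDeriv F a x u)

/-- The vector field `ζ` is smooth, invariant under `G`, and the components of `g` and `g J` with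
respect to the fundamental fields are constant along `ζ`. As `ζ` commutes with the fundamental
fields, this says that `ζ` is an infinitesimal automorphism of `(g, J)`. -/
structure IsInvariantAutField (E : Type*) [NormedAddCommGroup E] [NormedSpace ℝ E]
    (G : Type*) [TopologicalSpace G] [ChartedSpace E G] [Group G] [MulAction G M]
    (g : M → F →L[ℝ] F →L[ℝ] ℝ) (J : M → F →L[ℝ] F) (ζ : M → F) : Prop where
  smooth : IsSmoothVF (F := F) ζ
  invariant : IsInvariantVF G ζ
  metric : ∀ (Y Z : E) x,
    mder F ℝ (fun x => g x (fund E G F x Y) (fund E G F x Z)) x (ζ x) = 0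
  endo : ∀ (Y Z : E) x,
    mder F ℝ (fun x => g x (J x (fund E G F x Y)) (fund E G F x Z)) x (ζ x) = 0

lemma fund_surjective [MulAction.IsPretransitive G M] {o : M}
    (hsub : Function.Surjective (fund E G F o)) (x : M) :
    Function.Surjective (fund E G F x) := by
  intro v
  obtain ⟨a, rfl⟩ := MulAction.exists_smul_eq G o x
  obtain ⟨Y, hY⟩ := hsub (actDeriv F a⁻¹ (a • o) v)
  exact ⟨adj a Y, by rw [← actDeriv_fund, hY, actDeriv_apply_inv E]⟩

/-- Invariant vector fields on a homogeneous space are smooth. -/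
lemma isSmoothVF_of_invariant [FiniteDimensional ℝ F] [MulAction.IsPretransitive G M] {o : M}
    (hsub : Function.Surjective (fund E G F o)) {ζ : M → F} (hζ : IsInvariantVF G ζ) :
    IsSmoothVF (F := F) ζ := by
  have hG : SmoothAlong E F (fun a : G => a • o) (fun a : G => ζ (a • o)) := by
    have h := SmoothAlong.mder₂ (smooth₂_smul E G F M) (f := fun a : G => a)
      (k := fun _ : G => o) (v := fun _ => 0) (u := fun _ => ζ o)
      (smoothAlong_zero contMDiff_id)
      ((smoothAlong_const_iff (K := E) (v := fun _ : G => ζ o)).2 contMDiff_const)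
    simp only [map_zero, zero_add] at h
    have h2 : (fun a : G => ζ (a • o)) = fun a => actDeriv F a o (ζ o) :=
      funext fun a => (hζ a o).symm
    rw [h2]
    exact h
  intro x
  obtain ⟨b, rfl⟩ := MulAction.exists_smul_eq G o x
  have hb : Function.Surjective (mder E F (fun a : G => a • o) b) := by
    intro v
    obtain ⟨Y, hY⟩ := fund_surjective (E := E) hsub (b • o) v
    have h := mder_comp' (E := E) (F := E) (F' := F) (g := fun a : G => a • o)
      (f := fun a : G => a * b) 1 ((smooth_orbit E G F o).mdAt _)
      (Smooth.mdAt ((smooth₂_mul E G).left b) 1) Y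
    simp only [mul_smul, one_mul] at h
    exact ⟨_, h.symm.trans hY⟩
  obtain ⟨σ, hσ1, hσ, hσx⟩ := exists_local_section (smooth_orbit E G F o) b hb
  have h1 := ContMDiffAt.comp (b • o) (g := fun a : G =>
    TotalSpace.mk' F (E := (TangentSpace 𝓘(ℝ, F) : M → Type _)) (a • o) (ζ (a • o)))
    (by rw [hσ1]; exact hG b) hσ
  refine h1.congr_of_eventuallyEq ?_
  filter_upwards [hσx] with x hx
  change _ = TotalSpace.mk' F (E := (TangentSpace 𝓘(ℝ, F) : M → Type _)) (σ x • o) (ζ (σ x • o))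
  rw [hx]

variable {ζ : M → F} {ψ : ℝ → M → M} {g : M → F →L[ℝ] F →L[ℝ] ℝ} {J : M → F →L[ℝ] F}

lemma IsEquivariantFlow.eq_of_mder_eq_zero (h : IsEquivariantFlow G ζ ψ) {k : M → ℝ}
    (hk : Smooth F ℝ k) (h0 : ∀ x, mder F ℝ k x (ζ x) = 0) (t : ℝ) (x : M) :
    k (ψ t x) = k x := by
  have hs : Smooth ℝ ℝ (fun t => k (ψ t x)) := ContMDiff.comp hk (h.smooth_left x)
  have hd : ∀ t, _root_.deriv (fun t => k (ψ t x)) t = 0 := fun t => by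
    rw [← fderiv_apply_one_eq_deriv, ← mder_eq_fderiv]
    have h1 := mder_comp' (E := ℝ) (F := F) (F' := ℝ) (g := k) (f := fun t => ψ t x) t
      (hk.mdAt _) ((h.smooth_left x).mdAt t) 1
    rw [h.mder_time, h0] at h1
    exact h1
  have := is_const_of_deriv_eq_zero (hs.contDiff.differentiable (by simp)) hd t 0
  rwa [h.zero] at this

/-- The flow of an invariant infinitesimal automorphism is isometric and commutes with `J`. -/
lemma IsEquivariantFlow.metric_endo [MulAction.IsPretransitive G M] {o : M}
    (hsub : Function.Surjective (fund E G F o))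
    (h : IsEquivariantFlow G ζ ψ) (hgJ : IsMetricEndo g J)
    (hζ : IsInvariantAutField E G g J ζ) (t : ℝ) (x : M) :
    (∀ u v, g (ψ t x) (mder F F (ψ t) x u) (mder F F (ψ t) x v) = g x u v) ∧
      ∀ u, mder F F (ψ t) x (J x u) = J (ψ t x) (mder F F (ψ t) x u) := by
  have hs := fund_surjective (E := E) (G := G) hsub
  have hm : ∀ u v, g (ψ t x) (mder F F (ψ t) x u) (mder F F (ψ t) x v) = g x u v := by
    intro u v
    obtain ⟨Y, rfl⟩ := hs x u
    obtain ⟨Z, rfl⟩ := hs x v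
    rw [h.mder_fund, h.mder_fund]
    exact h.eq_of_mder_eq_zero (hgJ.smooth_metric (isSmoothVF_fund Y) (isSmoothVF_fund Z))
      (hζ.metric Y Z) t x
  refine ⟨hm, fun u => ?_⟩
  obtain ⟨Y, rfl⟩ := hs x u
  rw [← sub_eq_zero]
  refine hgJ.eq_zero (x := ψ t x) fun v => ?_
  obtain ⟨Z, rfl⟩ := hs (ψ t x) v
  rw [map_sub, _root_.sub_apply, ← h.mder_fund t x Z, hm, h.mder_fund, h.mder_fund,
    sub_eq_zero]
  exact (h.eq_of_mder_eq_zero (hgJ.smooth_metric (hgJ.smooth_endo (isSmoothVF_fund Y))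
    (isSmoothVF_fund Z)) (hζ.endo Y Z) t x).symm

lemma IsEquivariantFlow.oneForm [MulAction.IsPretransitive G M] {o : M}
    (hsub : Function.Surjective (fund E G F o))
    (h : IsEquivariantFlow G ζ ψ) {α : M → F →L[ℝ] ℝ}
    (hα : ∀ Y : E, Smooth F ℝ (fun x => α x (fund E G F x Y)))
    (h0 : ∀ (Y : E) x, mder F ℝ (fun x => α x (fund E G F x Y)) x (ζ x) = 0) (t : ℝ) (x : M)
    (u : F) : α (ψ t x) (mder F F (ψ t) x u) = α x u := by
  obtain ⟨Y, rfl⟩ := fund_surjective (E := E) (G := G) hsub x u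
  rw [h.mder_fund]
  exact h.eq_of_mder_eq_zero (hα Y) (h0 Y) t x

/-- If `X` represents an invariant infinitesimal automorphism `ζ` at `o`, then `ad X` preserves the
isotropy algebra, and induces on the tangent space at `o` a skew-symmetric endomorphism that
commutes with `J`. -/
lemma IsInvariantAutField.exists_induced [MulAction.IsPretransitive G M] {o : M}
    (hsub : Function.Surjective (fund E G F o)) (hgJ : IsMetricEndo g J)
    (hG : IsInvariantMetricEndo G g J)
    (hζ : IsInvariantAutField E G g J ζ) {X : E} (hX : fund E G F o X = ζ o) :
    ∃ τ : F →ₗ[ℝ] F, (∀ Y, fund E G F o (lbr G X Y) = τ (fund E G F o Y)) ∧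
      (∀ u v, g o (τ u) v + g o u (τ v) = 0) ∧ ∀ u, J o (τ u) = τ (J o u) := by
  have hbr : ∀ (Y : E), mbr (fun x => fund E G F x X) (fun x => fund E G F x Y) o
      = -fund E G F o (lbr G X Y) := fun Y => mbr_fund_fund X Y o
  have hskew : ∀ Y Z : E, g o (fund E G F o (lbr G X Y)) (fund E G F o Z)
      + g o (fund E G F o Y) (fund E G F o (lbr G X Z)) = 0 := fun Y Z => by
    have h1 := mder_bilin_fund (isSmoothVF_fund (F := F) (M := M) (G := G) Y)
      (isSmoothVF_fund (G := G) Z)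
      (hgJ.smooth_metric (isSmoothVF_fund Y) (isSmoothVF_fund Z)) hG.metric o X
    rw [hX, hζ.metric, hbr, hbr, map_neg, map_neg, _root_.neg_apply] at h1
    linarith
  have hskewJ : ∀ Y Z : E, g o (J o (fund E G F o (lbr G X Y))) (fund E G F o Z)
      + g o (J o (fund E G F o Y)) (fund E G F o (lbr G X Z)) = 0 := fun Y Z => by
    have hJs := hgJ.smooth_endo (isSmoothVF_fund (F := F) (M := M) (G := G) Y)
    have h1 := mder_bilin_fund hJs (isSmoothVF_fund (G := G) Z)
      (hgJ.smooth_metric hJs (isSmoothVF_fund Z)) hG.metric o X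
    rw [hX, hζ.endo, mbr_fund_endo (isSmoothVF_fund (G := G) Y) hJs hG.endo, hbr, hbr, map_neg,
      map_neg, map_neg, _root_.neg_apply] at h1
    linarith
  obtain ⟨R, hR⟩ := (fund E G F o).toLinearMap.exists_rightInverse_of_surjective
    (LinearMap.range_eq_top.2 hsub)
  have hR' : ∀ u, fund E G F o (R u) = u := fun u => LinearMap.congr_fun hR u
  let ad : E →ₗ[ℝ] E :=
    { toFun := fun Y => lbr G X Y
      map_add' := fun Y Z => lbr_add_right X Y Z
      map_smul' := fun c Y => lbr_smul_right c X Y }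
  let τ : F →ₗ[ℝ] F := (fund E G F o).toLinearMap.comp (ad.comp R)
  have hτ : ∀ Y, fund E G F o (lbr G X Y) = τ (fund E G F o Y) := fun Y => by
    change _ = fund E G F o (lbr G X (R (fund E G F o Y)))
    rw [← sub_eq_zero, ← map_sub, ← lbr_sub_right]
    refine hgJ.eq_zero (x := o) fun v => ?_
    obtain ⟨Z, rfl⟩ := hsub v
    have h1 := hskew (Y - R (fund E G F o Y)) Z
    have h2 : fund E G F o (Y - R (fund E G F o Y)) = 0 := by rw [map_sub, hR', sub_self]
    rw [h2, map_zero, _root_.zero_apply, add_zero] at h1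
    exact h1
  have hτs : ∀ u v, g o (τ u) v + g o u (τ v) = 0 := fun u v => by
    obtain ⟨Y, rfl⟩ := hsub u
    obtain ⟨Z, rfl⟩ := hsub v
    rw [← hτ, ← hτ]
    exact hskew Y Z
  refine ⟨τ, hτ, hτs, fun u => ?_⟩
  rw [← sub_eq_zero]
  refine hgJ.eq_zero (x := o) fun v => ?_
  obtain ⟨Y, rfl⟩ := hsub u
  obtain ⟨Z, rfl⟩ := hsub v
  have h1 := hskewJ Y Z
  have h2 := hτs (J o (fund E G F o Y)) (fund E G F o Z)
  rw [hτ, hτ] at h1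
  rw [map_sub, _root_.sub_apply]
  linarith

end InvariantTensors

/-! ### Homogeneous Vaisman manifolds -/

section Vaisman

variable {F : Type*} [NormedAddCommGroup F] [NormedSpace ℝ F]
  {M : Type*} [TopologicalSpace M] [ChartedSpace F M] [IsManifold 𝓘(ℝ, F) ∞ M]

/-- The metric of a Vaisman structure, in terms of the model space. -/
noncomputable def VaismanStructure.metric (S : VaismanStructure F M) (x : M) : F →L[ℝ] F →L[ℝ] ℝ :=
  S.g.inner x

/-- The complex structure of a Vaisman structure, in terms of the model space. -/
noncomputable def VaismanStructure.endo (S : VaismanStructure F M) (x : M) : F →L[ℝ] F := S.J x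

/-- The Lee form of a Vaisman structure, in terms of the model space. -/
noncomputable def VaismanStructure.leeForm (S : VaismanStructure F M) (x : M) : F →L[ℝ] ℝ := S.θ x

/-- The Lee field of a Vaisman structure, in terms of the model space. -/
noncomputable def VaismanStructure.leeField (S : VaismanStructure F M) (x : M) : F := S.ξ x

variable (S : VaismanStructure F M)

lemma VaismanStructure.isMetricEndo : IsMetricEndo S.metric S.endo where
  symm x u v := S.g.symm x u v
  pos x u hu := S.g.pos x u hu
  smooth_metric hV hW := smooth_rmetric S.g hV hW
  smooth_endo hV := S.smooth_J.isSmoothVF_apply hV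

lemma VaismanStructure.endo_endo (x : M) (u : F) : S.endo x (S.endo x u) = -u := S.J_sq x u

lemma VaismanStructure.metric_endo_endo (x : M) (u v : F) :
    S.metric x (S.endo x u) (S.endo x v) = S.metric x u v := S.hermitian x u v

lemma VaismanStructure.metric_endo_left (x : M) (u v : F) :
    S.metric x (S.endo x u) v = -S.metric x u (S.endo x v) := by
  have h := S.metric_endo_endo x u (S.endo x v)
  rw [S.endo_endo, map_neg] at h
  linarith

lemma VaismanStructure.metric_neg_left (x : M) (u v : F) :
    S.metric x (-u) v = -S.metric x u v := by
  rw [(S.metric x).map_neg, _root_.neg_apply]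

lemma VaismanStructure.metric_neg_right (x : M) (u v : F) :
    S.metric x u (-v) = -S.metric x u v := (S.metric x u).map_neg v

lemma VaismanStructure.metric_leeField (x : M) (u : F) :
    S.metric x (S.leeField x) u = S.leeForm x u := S.lee_dual x u

lemma VaismanStructure.smooth_leeForm {V : M → F} (hV : IsSmoothVF (F := F) V) :
    Smooth F ℝ (fun x => S.leeForm x (V x)) := S.smooth_θ.smooth_apply hV

lemma VaismanStructure.nijenhuis {V W : M → F} (hV : IsSmoothVF (F := F) V)
    (hW : IsSmoothVF (F := F) W) (x : M) :
    mbr (fun y => S.endo y (V y)) (fun y => S.endo y (W y)) x - mbr V W x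
      - S.endo x (mbr (fun y => S.endo y (V y)) W x)
      - S.endo x (mbr V (fun y => S.endo y (W y)) x) = 0 := S.integrable V W hV hW x

lemma VaismanStructure.leeForm_closed {V W : M → F} (hV : IsSmoothVF (F := F) V)
    (hW : IsSmoothVF (F := F) W) (x : M) :
    mder F ℝ (fun y => S.leeForm y (W y)) x (V x) - mder F ℝ (fun y => S.leeForm y (V y)) x (W x)
      - S.leeForm x (mbr V W x) = 0 := S.closed V W hV hW x

lemma VaismanStructure.lck_apply {U V W : M → F} (hU : IsSmoothVF (F := F) U)
    (hV : IsSmoothVF (F := F) V) (hW : IsSmoothVF (F := F) W) (x : M) :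
    mder F ℝ (fun y => S.metric y (V y) (S.endo y (W y))) x (U x)
      + mder F ℝ (fun y => S.metric y (W y) (S.endo y (U y))) x (V x)
      + mder F ℝ (fun y => S.metric y (U y) (S.endo y (V y))) x (W x)
      - S.metric x (mbr U V x) (S.endo x (W x)) - S.metric x (mbr V W x) (S.endo x (U x))
      - S.metric x (mbr W U x) (S.endo x (V x))
      = S.metric x (U x) (S.endo x (V x)) * S.leeForm x (W x)
        + S.metric x (V x) (S.endo x (W x)) * S.leeForm x (U x)
        + S.metric x (W x) (S.endo x (U x)) * S.leeForm x (V x) := S.lck U V W hU hV hW x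

lemma VaismanStructure.killing_apply {V W : M → F} (hV : IsSmoothVF (F := F) V)
    (hW : IsSmoothVF (F := F) W) (x : M) :
    mder F ℝ (fun y => S.metric y (V y) (W y)) x (S.leeField x)
      = S.metric x (mbr S.leeField V x) (W x) + S.metric x (V x) (mbr S.leeField W x) :=
  S.killing V W hV hW x

variable {S}
variable {E : Type*} [NormedAddCommGroup E] [NormedSpace ℝ E]
  {G : Type*} [TopologicalSpace G] [ChartedSpace E G] [Group G] [LieGroup 𝓘(ℝ, E) ∞ G]
  [MulAction G M] [ContMDiffSMul 𝓘(ℝ, E) 𝓘(ℝ, F) ∞ G M]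

lemma VaismanStructure.isInvariantMetricEndo
    (hG : ∀ a : G, S.IsAutomorphism (fun x => a • x)) :
    IsInvariantMetricEndo G S.metric S.endo where
  metric a x u v := (hG a x u).1 v
  endo a x u := (hG a x u).2

lemma mbr_skew (V W : M → F) (x : M) : mbr V W x = -mbr W V x :=
  mlieBracket_swap_apply

lemma adj_lbr (a : G) (Y Z : E) : adj a (lbr G Y Z) = lbr G (adj a Y) (adj a Z) :=
  mder_hom_lbr ((smooth₂_conj E G).right a) (fun b c => by group) Y Z

/-- The structure equation `dΩ = Ω ∧ θ` for three fundamental fields, which preserve `Ω`. -/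
lemma VaismanStructure.lck_fund (hG : ∀ a : G, S.IsAutomorphism (fun x => a • x)) (U V W : E)
    (x : M) :
    -(S.metric x (fund E G F x (lbr G U V)) (S.endo x (fund E G F x W))
      + S.metric x (fund E G F x (lbr G V W)) (S.endo x (fund E G F x U))
      + S.metric x (fund E G F x (lbr G W U)) (S.endo x (fund E G F x V)))
      = S.metric x (fund E G F x U) (S.endo x (fund E G F x V)) * S.leeForm x (fund E G F x W)
        + S.metric x (fund E G F x V) (S.endo x (fund E G F x W)) * S.leeForm x (fund E G F x U)
        + S.metric x (fund E G F x W) (S.endo x (fund E G F x U))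
          * S.leeForm x (fund E G F x V) := by
  have hinv := S.isInvariantMetricEndo hG
  have hs := fun Y : E => isSmoothVF_fund (F := F) (M := M) (G := G) Y
  have hJs := fun Y : E => S.isMetricEndo.smooth_endo (hs Y)
  have hd : ∀ A B C : E, mder F ℝ (fun y => S.metric y (fund E G F y B)
      (S.endo y (fund E G F y C))) x (fund E G F x A)
      = - S.metric x (fund E G F x (lbr G A B)) (S.endo x (fund E G F x C))
        - S.metric x (fund E G F x B) (S.endo x (fund E G F x (lbr G A C))) := fun A B C => by
    rw [mder_bilin_fund (hs B) (hJs C) (S.isMetricEndo.smooth_metric (hs B) (hJs C)) hinv.metric,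
      mbr_fund_endo (hs C) (hJs C) hinv.endo, mbr_fund_fund, mbr_fund_fund, map_neg, map_neg,
      map_neg, _root_.neg_apply]
    ring
  have hsk : ∀ A B C : E, S.metric x (fund E G F x B) (S.endo x (fund E G F x (lbr G A C)))
      = S.metric x (fund E G F x (lbr G C A)) (S.endo x (fund E G F x B)) := fun A B C => by
    rw [lbr_skew A C, (fund E G F x).map_neg, (S.endo x).map_neg, (S.metric x _).map_neg,
      S.isMetricEndo.symm, S.metric_endo_left, neg_neg]
  have hbr : ∀ (A B : E) (v : F),
      S.metric x (mbr (fun x => fund E G F x A) (fun x => fund E G F x B) x) v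
        = -S.metric x (fund E G F x (lbr G A B)) v := fun A B v => by
    rw [mbr_fund_fund, (S.metric x).map_neg, _root_.neg_apply]
  have h := S.lck_apply (hs U) (hs V) (hs W) x
  rw [hd, hd, hd, hsk, hsk, hsk, hbr, hbr, hbr] at h
  rw [← h]
  ring

/-- A covector whose wedge product with the fundamental form of a Hermitian vector space of real
dimension at least four vanishes is zero. -/
lemma VaismanStructure.eq_zero_of_wedge (S : VaismanStructure F M) (x : M) (k : F →L[ℝ] ℝ)
    (hk : ∀ u v w, S.metric x u (S.endo x v) * k w + S.metric x v (S.endo x w) * k u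
      + S.metric x w (S.endo x u) * k v = 0) : k = 0 := by
  have : FiniteDimensional ℝ F := Module.finite_of_finrank_pos (by have := S.four_le_dim; omega)
  ext w
  -- a nonzero vector orthogonal to `w` and `J w`
  let f : F →ₗ[ℝ] ℝ × ℝ :=
    (S.metric x w).toLinearMap.prod (S.metric x (S.endo x w)).toLinearMap
  have hker : LinearMap.ker f ≠ ⊥ := LinearMap.ker_ne_bot_of_finrank_lt (by
    have := S.four_le_dim
    rw [Module.finrank_prod, Module.finrank_self]
    omega)
  obtain ⟨u, hu, hu0⟩ := Submodule.exists_mem_ne_zero_of_ne_bot hker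
  have hu1 : S.metric x w u = 0 := congrArg Prod.fst hu
  have hu2 : S.metric x (S.endo x w) u = 0 := congrArg Prod.snd hu
  have h := hk u (S.endo x u) w
  have h3 : S.metric x w (S.endo x u) = 0 := by
    have := S.metric_endo_left x w u
    linarith
  rw [S.endo_endo, S.metric_endo_endo, h3, S.isMetricEndo.symm x u w, hu1, (S.metric x u).map_neg]
    at h
  have := S.isMetricEndo.pos x u hu0
  have h4 : S.metric x u u * k w = 0 := by linarith
  exact (mul_eq_zero.1 h4).resolve_left this.ne'

variable [MulAction.IsPretransitive G M] {o : M}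

/-- Holomorphic isometries preserve the Lee form, since they preserve the fundamental form, whose
exterior derivative determines the Lee form. -/
lemma VaismanStructure.leeForm_actDeriv (hG : ∀ a : G, S.IsAutomorphism (fun x => a • x))
    (hsub : Function.Surjective (fund E G F o)) (a : G) (x : M) (u : F) :
    S.leeForm (a • x) (actDeriv F a x u) = S.leeForm x u := by
  have hinv := S.isInvariantMetricEndo hG
  have hs := fund_surjective (E := E) (G := G) hsub x
  have h0 := S.eq_zero_of_wedge x ((S.leeForm (a • x)).comp (actDeriv F a x) - S.leeForm x) (by
    intro u v w
    obtain ⟨U, rfl⟩ := hs u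
    obtain ⟨V, rfl⟩ := hs v
    obtain ⟨W, rfl⟩ := hs w
    have h1 := S.lck_fund hG U V W x
    have h2 := S.lck_fund hG (adj a U) (adj a V) (adj a W) (a • x)
    simp only [← adj_lbr, ← actDeriv_fund, ← hinv.endo, hinv.metric] at h2
    rw [h1] at h2
    simp only [_root_.sub_apply, ContinuousLinearMap.comp_apply]
    linarith)
  have h := congrArg (fun L : F →L[ℝ] ℝ => L u) h0
  exact sub_eq_zero.1 h

lemma VaismanStructure.leeField_invariant (hG : ∀ a : G, S.IsAutomorphism (fun x => a • x))
    (hsub : Function.Surjective (fund E G F o)) : IsInvariantVF G S.leeField := by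
  intro a x
  rw [← sub_eq_zero]
  refine S.isMetricEndo.eq_zero (x := a • x) fun v => ?_
  rw [← actDeriv_apply_inv E a x v, map_sub, _root_.sub_apply,
    (S.isInvariantMetricEndo hG).metric, S.metric_leeField, S.metric_leeField,
    S.leeForm_actDeriv hG hsub, sub_self]

/-- The rotated Lee field `J ξ`. -/
noncomputable def VaismanStructure.rotatedLeeField (S : VaismanStructure F M) (x : M) : F :=
  S.endo x (S.leeField x)

lemma VaismanStructure.rotatedLeeField_invariant (hG : ∀ a : G, S.IsAutomorphism (fun x => a • x))
    (hsub : Function.Surjective (fund E G F o)) : IsInvariantVF G S.rotatedLeeField := by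
  intro a x
  rw [rotatedLeeField, (S.isInvariantMetricEndo hG).endo, S.leeField_invariant hG hsub]
  rfl

section Brackets

variable [FiniteDimensional ℝ F]

lemma VaismanStructure.smooth_leeField (hG : ∀ a : G, S.IsAutomorphism (fun x => a • x))
    (hsub : Function.Surjective (fund E G F o)) : IsSmoothVF (F := F) S.leeField :=
  isSmoothVF_of_invariant hsub (S.leeField_invariant hG hsub)

lemma VaismanStructure.smooth_rotatedLeeField (hG : ∀ a : G, S.IsAutomorphism (fun x => a • x))
    (hsub : Function.Surjective (fund E G F o)) : IsSmoothVF (F := F) S.rotatedLeeField :=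
  isSmoothVF_of_invariant hsub (S.rotatedLeeField_invariant hG hsub)

/-- As fundamental fields preserve `J`, the vanishing of the Nijenhuis tensor says that the bracket
changes its sign if two fundamental fields are rotated by `J`. -/
lemma VaismanStructure.mbr_endo_endo (hG : ∀ a : G, S.IsAutomorphism (fun x => a • x))
    (Y Z : E) (x : M) :
    mbr (fun y => S.endo y (fund E G F y Y)) (fun y => S.endo y (fund E G F y Z)) x
      = -mbr (fun y => fund E G F y Y) (fun y => fund E G F y Z) x := by
  have hs := fun Y : E => isSmoothVF_fund (F := F) (M := M) (G := G) Y
  have hJs := fun Y : E => S.isMetricEndo.smooth_endo (hs Y)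
  have hinv := (S.isInvariantMetricEndo hG).endo
  have h := S.nijenhuis (hs Y) (hs Z) x
  rw [mbr_skew (fun y => S.endo y (fund E G F y Y)) (fun y => fund E G F y Z),
    mbr_fund_endo (hs Y) (hJs Y) hinv, mbr_fund_endo (hs Z) (hJs Z) hinv, (S.endo x).map_neg,
    S.endo_endo, S.endo_endo, mbr_skew (fun y => fund E G F y Z)] at h
  have h2 : mbr (fun y => S.endo y (fund E G F y Y)) (fun y => S.endo y (fund E G F y Z)) x
      + mbr (fun y => fund E G F y Y) (fun y => fund E G F y Z) x = 0 := by
    rw [← h]; abel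
  exact eq_neg_of_add_eq_zero_left h2

lemma VaismanStructure.mder_leeForm (hG : ∀ a : G, S.IsAutomorphism (fun x => a • x))
    (hsub : Function.Surjective (fund E G F o)) {W : M → F} (hW : IsSmoothVF (F := F) W)
    (Y : E) (x : M) :
    mder F ℝ (fun y => S.leeForm y (W y)) x (fund E G F x Y)
      = S.leeForm x (mbr (fun y => fund E G F y Y) W x) :=
  mder_oneForm_fund hW (S.smooth_leeForm hW) (fun a x v => S.leeForm_actDeriv hG hsub a x v) x Y

/-- The Lee form kills brackets of fundamental fields, as it is closed and invariant. -/
lemma VaismanStructure.leeForm_mbr (hG : ∀ a : G, S.IsAutomorphism (fun x => a • x))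
    (hsub : Function.Surjective (fund E G F o)) (Y Z : E) (x : M) :
    S.leeForm x (mbr (fun y => fund E G F y Y) (fun y => fund E G F y Z) x) = 0 := by
  have hs := fun Y : E => isSmoothVF_fund (F := F) (M := M) (G := G) Y
  have h := S.leeForm_closed (hs Y) (hs Z) x
  rw [S.mder_leeForm hG hsub (hs Z), S.mder_leeForm hG hsub (hs Y),
    mbr_skew (fun y => fund E G F y Z), (S.leeForm x).map_neg] at h
  linarith

lemma VaismanStructure.mder_leeForm_endo (hG : ∀ a : G, S.IsAutomorphism (fun x => a • x))
    (hsub : Function.Surjective (fund E G F o)) (Y Z : E) (x : M) :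
    mder F ℝ (fun y => S.leeForm y (fund E G F y Z)) x (S.endo x (fund E G F x Y)) = 0 := by
  have hs := fun Y : E => isSmoothVF_fund (F := F) (M := M) (G := G) Y
  have hJs := fun Y : E => S.isMetricEndo.smooth_endo (hs Y)
  have h := S.leeForm_closed (hJs Y) (hs Z) x
  rw [S.mder_leeForm hG hsub (hJs Y), mbr_skew (fun y => S.endo y (fund E G F y Y)),
    (S.leeForm x).map_neg] at h
  linarith

lemma VaismanStructure.mder_metric (hG : ∀ a : G, S.IsAutomorphism (fun x => a • x))
    {V W : M → F} (hV : IsSmoothVF (F := F) V) (hW : IsSmoothVF (F := F) W) (Y : E) (x : M) :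
    mder F ℝ (fun y => S.metric y (V y) (W y)) x (fund E G F x Y)
      = S.metric x (mbr (fun y => fund E G F y Y) V x) (W x)
        + S.metric x (V x) (mbr (fun y => fund E G F y Y) W x) :=
  mder_bilin_fund hV hW (S.isMetricEndo.smooth_metric hV hW) (S.isInvariantMetricEndo hG).metric x Y

/-- The structure equation for the Lee field `ξ` and two fundamental fields. These commute with `ξ`,
so it gives the derivative of the components of the fundamental form along `ξ`. -/
lemma VaismanStructure.lck_leeField (hG : ∀ a : G, S.IsAutomorphism (fun x => a • x))
    (hsub : Function.Surjective (fund E G F o)) (Y Z : E) (x : M) :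
    mder F ℝ (fun y => S.metric y (fund E G F y Y) (S.endo y (fund E G F y Z))) x (S.leeField x)
      + S.metric x (mbr (fun y => fund E G F y Y) (fun y => fund E G F y Z) x)
        (S.rotatedLeeField x)
      = S.leeForm x (S.endo x (fund E G F x Y)) * S.leeForm x (fund E G F x Z)
        + S.metric x (fund E G F x Y) (S.endo x (fund E G F x Z)) * S.leeForm x (S.leeField x)
        - S.leeForm x (S.endo x (fund E G F x Z)) * S.leeForm x (fund E G F x Y) := by
  have hs := fun Y : E => isSmoothVF_fund (F := F) (M := M) (G := G) Y
  have hJs := fun Y : E => S.isMetricEndo.smooth_endo (hs Y)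
  have hinv := (S.isInvariantMetricEndo hG).endo
  have hξ := S.smooth_leeField hG hsub
  have hη := S.smooth_rotatedLeeField hG hsub
  have hξi := S.leeField_invariant hG hsub
  have hηi := S.rotatedLeeField_invariant hG hsub
  have hb0 : ∀ Y : E, mbr S.leeField (fun y => fund E G F y Y) x = 0 := fun Y => by
    rw [mbr_skew, mbr_fund_of_invariant hξ hξi, neg_zero]
  have h := S.lck_apply hξ (hs Y) (hs Z) x
  have h1 : mder F ℝ (fun y => S.metric y (fund E G F y Z) (S.endo y (S.leeField y))) x
      (fund E G F x Y) = S.metric x (mbr (fun y => fund E G F y Y) (fun y => fund E G F y Z) x)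
        (S.rotatedLeeField x) := by
    refine (S.mder_metric hG (hs Z) hη Y x).trans ?_
    rw [mbr_fund_of_invariant hη hηi, map_zero, add_zero]
  have h2 : mder F ℝ (fun y => S.metric y (S.leeField y) (S.endo y (fund E G F y Y))) x
      (fund E G F x Z) = S.metric x (mbr (fun y => fund E G F y Y) (fun y => fund E G F y Z) x)
        (S.rotatedLeeField x) := by
    rw [S.mder_metric hG hξ (hJs Y), mbr_fund_of_invariant hξ hξi,
      mbr_fund_endo (hs Y) (hJs Y) hinv,
      mbr_skew (fun y => fund E G F y Z), map_zero, _root_.zero_apply, zero_add,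
      (S.endo x).map_neg, (S.metric x _).map_neg, ← S.metric_endo_left, S.isMetricEndo.symm]
    rfl
  rw [h1, h2, hb0, mbr_fund_of_invariant hξ hξi, (S.metric x).map_zero, _root_.zero_apply,
    _root_.zero_apply, S.metric_leeField,
    show S.metric x (fund E G F x Z) (S.endo x (S.leeField x))
      = -S.leeForm x (S.endo x (fund E G F x Z)) by
        rw [← S.metric_leeField, S.isMetricEndo.symm, S.metric_endo_left]] at h
  change _ + _ + _ - 0 - S.metric x _ (S.rotatedLeeField x) - 0 = _ at h
  linarith

/-- The bracket of the Lee field with a rotated fundamental field vanishes. This says that the Lee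
field preserves `J`: the Lie derivative of `J` is skew-symmetric because the Lee field is Killing,
and symmetric by the structure equation. -/
lemma VaismanStructure.mbr_leeField_endo (hG : ∀ a : G, S.IsAutomorphism (fun x => a • x))
    (hsub : Function.Surjective (fund E G F o)) (Y : E) (x : M) :
    mbr S.leeField (fun y => S.endo y (fund E G F y Y)) x = 0 := by
  have hs := fun Y : E => isSmoothVF_fund (F := F) (M := M) (G := G) Y
  have hJs := fun Y : E => S.isMetricEndo.smooth_endo (hs Y)
  have hξ := S.smooth_leeField hG hsub
  have hb0 : ∀ Y : E, mbr S.leeField (fun y => fund E G F y Y) x = 0 := fun Y => by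
    rw [mbr_skew, mbr_fund_of_invariant hξ (S.leeField_invariant hG hsub), neg_zero]
  have hkill : ∀ A B : E, mder F ℝ (fun y => S.metric y (S.endo y (fund E G F y A))
      (fund E G F y B)) x (S.leeField x)
      = S.metric x (mbr S.leeField (fun y => S.endo y (fund E G F y A)) x) (fund E G F x B) :=
    fun A B => by
      rw [S.killing_apply (hJs A) (hs B), hb0, map_zero, add_zero]
  -- the structure equation for the Lee field and two rotated fundamental fields
  have hsym : ∀ A B : E,
      S.metric x (mbr S.leeField (fun y => S.endo y (fund E G F y A)) x) (fund E G F x B)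
      = S.metric x (mbr S.leeField (fun y => S.endo y (fund E G F y B)) x) (fund E G F x A) := by
    intro A B
    have h := S.lck_apply hξ (hJs A) (hJs B) x
    have e1 : (fun y => S.metric y (S.endo y (fund E G F y A))
          (S.endo y (S.endo y (fund E G F y B))))
        = fun y => S.metric y (fund E G F y A) (S.endo y (fund E G F y B)) :=
      funext fun y => S.metric_endo_endo y _ _
    have e2 : (fun y => S.metric y (S.endo y (fund E G F y B)) (S.endo y (S.leeField y)))
        = fun y => S.leeForm y (fund E G F y B) :=
      funext fun y => by rw [S.metric_endo_endo, S.isMetricEndo.symm, S.metric_leeField]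
    have e3 : (fun y => S.metric y (S.leeField y) (S.endo y (S.endo y (fund E G F y A))))
        = fun y => -S.leeForm y (fund E G F y A) :=
      funext fun y => by rw [S.endo_endo, (S.metric y _).map_neg, S.metric_leeField]
    rw [e1, e2, e3, mder_neg_apply, S.mder_leeForm_endo hG hsub,
      S.mder_leeForm_endo hG hsub, S.mbr_endo_endo hG,
      mbr_skew (fun y => S.endo y (fund E G F y B)), S.metric_neg_left, S.metric_neg_left,
      S.endo_endo, S.endo_endo, S.metric_neg_right,
      S.metric_neg_right, S.metric_neg_right, S.metric_neg_right, S.metric_leeField,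
      S.metric_endo_endo] at h
    have h2 := S.lck_leeField hG hsub A B x
    have e4 : S.metric x (S.endo x (fund E G F x A)) (fund E G F x B)
        = -S.metric x (fund E G F x A) (S.endo x (fund E G F x B)) := S.metric_endo_left x _ _
    have e5 : S.metric x (fund E G F x B) (S.leeField x) = S.leeForm x (fund E G F x B) := by
      rw [S.isMetricEndo.symm, S.metric_leeField]
    rw [e4, e5] at h
    change _ + _ + _ - _ - -S.metric x _ (S.rotatedLeeField x) - _ = _ at h
    linarith
  refine S.isMetricEndo.eq_zero (x := x) fun v => ?_
  obtain ⟨Z, rfl⟩ := fund_surjective (E := E) (G := G) hsub x v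
  have h1 := hkill Y Z
  have h2 := hkill Z Y
  have e : (fun y => S.metric y (S.endo y (fund E G F y Y)) (fund E G F y Z))
      = fun y => -S.metric y (S.endo y (fund E G F y Z)) (fund E G F y Y) :=
    funext fun y => by rw [S.metric_endo_left, S.isMetricEndo.symm]
  rw [e, mder_neg_apply, h2] at h1
  have := hsym Y Z
  linarith

/-- The Lee field is an infinitesimal automorphism of the Hermitian structure. -/
lemma VaismanStructure.leeField_isInvariantAutField
    (hG : ∀ a : G, S.IsAutomorphism (fun x => a • x))
    (hsub : Function.Surjective (fund E G F o)) :
    IsInvariantAutField E G S.metric S.endo S.leeField where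
  smooth := S.smooth_leeField hG hsub
  invariant := S.leeField_invariant hG hsub
  metric Y Z x := by
    have hξ := S.smooth_leeField hG hsub
    rw [S.killing_apply (isSmoothVF_fund Y) (isSmoothVF_fund Z), mbr_skew,
      mbr_fund_of_invariant hξ (S.leeField_invariant hG hsub), mbr_skew S.leeField,
      mbr_fund_of_invariant hξ (S.leeField_invariant hG hsub), neg_zero, map_zero, map_zero,
      _root_.zero_apply, add_zero]
  endo Y Z x := by
    have hξ := S.smooth_leeField hG hsub
    rw [S.killing_apply (S.isMetricEndo.smooth_endo (isSmoothVF_fund Y)) (isSmoothVF_fund Z),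
      S.mbr_leeField_endo hG hsub, mbr_skew S.leeField,
      mbr_fund_of_invariant hξ (S.leeField_invariant hG hsub), neg_zero, map_zero, map_zero,
      _root_.zero_apply, add_zero]

lemma VaismanStructure.metric_endo_self (S : VaismanStructure F M) (x : M) (u : F) :
    S.metric x u (S.endo x u) = 0 := by
  have h := S.metric_endo_left x u u
  rw [S.isMetricEndo.symm] at h
  linarith

lemma VaismanStructure.leeForm_rotatedLeeField (S : VaismanStructure F M) (x : M) :
    S.leeForm x (S.rotatedLeeField x) = 0 := by
  rw [← S.metric_leeField]
  exact S.metric_endo_self x _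

lemma VaismanStructure.endo_rotatedLeeField (S : VaismanStructure F M) (x : M) :
    S.endo x (S.rotatedLeeField x) = -S.leeField x := S.endo_endo x _

lemma VaismanStructure.metric_rotatedLeeField_endo (S : VaismanStructure F M) (x : M) (u : F) :
    S.metric x (S.rotatedLeeField x) (S.endo x u) = S.leeForm x u :=
  (S.metric_endo_endo x _ _).trans (S.metric_leeField x u)

lemma VaismanStructure.metric_endo_rotatedLeeField (S : VaismanStructure F M) (x : M) (u : F) :
    S.metric x u (S.endo x (S.rotatedLeeField x)) = -S.leeForm x u := by
  rw [S.endo_rotatedLeeField, S.metric_neg_right, S.isMetricEndo.symm, S.metric_leeField]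

/-- The rotated Lee field is an infinitesimal automorphism: it preserves `J` because the Nijenhuis
tensor vanishes and the Lee field preserves `J`, and the derivatives of the components of `g` and
`g J` along it are given by the structure equation. -/
lemma VaismanStructure.rotatedLeeField_isInvariantAutField
    (hG : ∀ a : G, S.IsAutomorphism (fun x => a • x))
    (hsub : Function.Surjective (fund E G F o)) :
    IsInvariantAutField E G S.metric S.endo S.rotatedLeeField := by
  have hs := fun Y : E => isSmoothVF_fund (F := F) (M := M) (G := G) Y
  have hJs := fun Y : E => S.isMetricEndo.smooth_endo (hs Y)
  have hinv := (S.isInvariantMetricEndo hG).endo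
  have hξ := S.smooth_leeField hG hsub
  have hη := S.smooth_rotatedLeeField hG hsub
  have hξi := S.leeField_invariant hG hsub
  have hηi := S.rotatedLeeField_invariant hG hsub
  have hb : ∀ (Y : E) x, mbr S.rotatedLeeField (fun y => fund E G F y Y) x = 0 := fun Y x => by
    rw [mbr_skew, mbr_fund_of_invariant hη hηi, neg_zero]
  have hbξ : ∀ (Y : E) x, mbr S.leeField (fun y => fund E G F y Y) x = 0 := fun Y x => by
    rw [mbr_skew, mbr_fund_of_invariant hξ hξi, neg_zero]
  have hbJ : ∀ (Y : E) x, mbr S.rotatedLeeField (fun y => S.endo y (fund E G F y Y)) x = 0 :=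
    fun Y x => by
      have h := S.nijenhuis hξ (hs Y) x
      rw [hbξ, S.mbr_leeField_endo hG hsub, show mbr (fun y => S.endo y (S.leeField y))
        (fun y => fund E G F y Y) x = 0 from hb Y x] at h
      simp only [map_zero, sub_zero] at h
      exact h
  refine ⟨hη, hηi, fun Y Z x => ?_, fun Y Z x => ?_⟩
  · have h := S.lck_apply hη (hs Y) (hJs Z) x
    have e1 : (fun y => S.metric y (fund E G F y Y) (S.endo y (S.endo y (fund E G F y Z))))
        = fun y => -S.metric y (fund E G F y Y) (fund E G F y Z) :=
      funext fun y => by rw [S.endo_endo, S.metric_neg_right]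
    have e2 : (fun y => S.metric y (S.endo y (fund E G F y Z)) (S.endo y (S.rotatedLeeField y)))
        = fun y => -S.leeForm y (S.endo y (fund E G F y Z)) :=
      funext fun y => S.metric_endo_rotatedLeeField y _
    have e3 : (fun y => S.metric y (S.rotatedLeeField y) (S.endo y (fund E G F y Y)))
        = fun y => S.leeForm y (fund E G F y Y) :=
      funext fun y => S.metric_rotatedLeeField_endo y _
    rw [e1, e2, e3, mder_neg_apply, mder_neg_apply, S.mder_leeForm hG hsub (hJs Z),
      S.mder_leeForm_endo hG hsub, hb, mbr_skew _ S.rotatedLeeField, hbJ, neg_zero,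
      (S.metric x).map_zero, _root_.zero_apply, _root_.zero_apply, S.metric_rotatedLeeField_endo,
      S.leeForm_rotatedLeeField, S.metric_endo_rotatedLeeField,
      S.metric_endo_rotatedLeeField] at h
    linarith
  · have h := S.lck_apply hη (hs Y) (hs Z) x
    have e1 : (fun y => S.metric y (fund E G F y Y) (S.endo y (fund E G F y Z)))
        = fun y => -S.metric y (S.endo y (fund E G F y Y)) (fund E G F y Z) :=
      funext fun y => by rw [S.metric_endo_left, neg_neg]
    have e2 : (fun y => S.metric y (fund E G F y Z) (S.endo y (S.rotatedLeeField y)))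
        = fun y => -S.leeForm y (fund E G F y Z) :=
      funext fun y => S.metric_endo_rotatedLeeField y _
    have e3 : (fun y => S.metric y (S.rotatedLeeField y) (S.endo y (fund E G F y Y)))
        = fun y => S.leeForm y (fund E G F y Y) :=
      funext fun y => S.metric_rotatedLeeField_endo y _
    rw [e1, e2, e3, mder_neg_apply, mder_neg_apply, S.mder_leeForm hG hsub (hs Z),
      S.mder_leeForm hG hsub (hs Y), S.leeForm_mbr hG hsub, S.leeForm_mbr hG hsub, hb,
      mbr_skew _ S.rotatedLeeField, hb, S.metric_neg_left,
      (S.metric x).map_zero, _root_.zero_apply, _root_.zero_apply, S.metric_rotatedLeeField_endo,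
      S.leeForm_rotatedLeeField, S.metric_endo_rotatedLeeField,
      S.metric_endo_rotatedLeeField, S.leeForm_mbr hG hsub] at h
    linarith

/-- The Lee field has no zeros on a homogeneous Vaisman manifold. -/
lemma VaismanStructure.leeForm_leeField_pos (hG : ∀ a : G, S.IsAutomorphism (fun x => a • x))
    (hsub : Function.Surjective (fund E G F o)) (x : M) :
    0 < S.leeForm x (S.leeField x) := by
  rw [← S.metric_leeField]
  refine S.isMetricEndo.pos x _ fun h0 => ?_
  obtain ⟨y, hy⟩ := S.lee_ne_zero
  obtain ⟨a, rfl⟩ := MulAction.exists_smul_eq G x y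
  refine hy ?_
  have h1 : S.leeForm (a • x) = 0 := by
    ext v
    rw [← S.metric_leeField, ← S.leeField_invariant hG hsub, h0, map_zero, map_zero]
  exact h1

/-- The fundamental field of a central element is, at each point, a linear combination of the Lee
field and the rotated Lee field. -/
lemma VaismanStructure.fund_of_central (hG : ∀ a : G, S.IsAutomorphism (fun x => a • x))
    (hsub : Function.Surjective (fund E G F o)) {W : E} (hW : ∀ Z, lbr G W Z = 0) (x : M) :
    S.leeForm x (S.leeField x) • fund E G F x W
      = S.leeForm x (fund E G F x W) • S.leeField x
        - S.leeForm x (S.endo x (fund E G F x W)) • S.rotatedLeeField x := by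
  rw [← sub_eq_zero]
  refine S.isMetricEndo.eq_zero (x := x) fun v => ?_
  obtain ⟨Z, hZ⟩ := fund_surjective (E := E) (G := G) hsub x (S.endo x v)
  have h := S.lck_leeField hG hsub W Z x
  have h0 := (S.leeField_isInvariantAutField hG hsub).endo W Z x
  have e : (fun y => S.metric y (S.endo y (fund E G F y W)) (fund E G F y Z))
      = fun y => -S.metric y (fund E G F y W) (S.endo y (fund E G F y Z)) :=
    funext fun y => S.metric_endo_left y _ _
  rw [e, mder_neg_apply] at h0
  rw [neg_eq_zero.1 h0, mbr_fund_fund, hW, map_zero, neg_zero, (S.metric x).map_zero,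
    _root_.zero_apply, hZ, S.endo_endo, S.metric_neg_right, (S.leeForm x).map_neg] at h
  have h3 : S.metric x (S.rotatedLeeField x) v = -S.leeForm x (S.endo x v) := by
    rw [← S.metric_leeField]
    exact S.metric_endo_left x _ _
  simp only [map_sub, map_smul, _root_.sub_apply, _root_.smul_apply, smul_eq_mul,
    S.metric_leeField, h3]
  linarith

end Brackets

end Vaisman

/-! ### Homogeneous Sasaki manifolds -/

section Sasaki

variable {F : Type*} [NormedAddCommGroup F] [NormedSpace ℝ F]
  {M : Type*} [TopologicalSpace M] [ChartedSpace F M] [IsManifold 𝓘(ℝ, F) ∞ M]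

/-- The metric of a Sasaki structure, in terms of the model space. -/
noncomputable def SasakiStructure.metric (S : SasakiStructure F M) (x : M) : F →L[ℝ] F →L[ℝ] ℝ :=
  S.g.inner x

/-- The `(1,1)`-tensor of a Sasaki structure, in terms of the model space. -/
noncomputable def SasakiStructure.endo (S : SasakiStructure F M) (x : M) : F →L[ℝ] F := S.J x

/-- The contact form of a Sasaki structure, in terms of the model space. -/
noncomputable def SasakiStructure.form (S : SasakiStructure F M) (x : M) : F →L[ℝ] ℝ := S.φ x

/-- The Reeb field of a Sasaki structure, in terms of the model space. -/
noncomputable def SasakiStructure.reeb (S : SasakiStructure F M) (x : M) : F := S.η x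

variable (S : SasakiStructure F M)

lemma SasakiStructure.isMetricEndo : IsMetricEndo S.metric S.endo where
  symm x u v := S.g.symm x u v
  pos x u hu := S.g.pos x u hu
  smooth_metric hV hW := smooth_rmetric S.g hV hW
  smooth_endo hV := S.smooth_J.isSmoothVF_apply hV

lemma SasakiStructure.endo_endo (x : M) (u : F) :
    S.endo x (S.endo x u) = -u + S.form x u • S.reeb x := S.J_sq x u

lemma SasakiStructure.form_reeb (x : M) : S.form x (S.reeb x) = 1 := S.φ_η x

lemma SasakiStructure.isSmoothVF_reeb : IsSmoothVF (F := F) S.reeb := S.smooth_η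

lemma SasakiStructure.smooth_form {V : M → F} (hV : IsSmoothVF (F := F) V) :
    Smooth F ℝ (fun x => S.form x (V x)) := S.smooth_φ.smooth_apply hV

lemma SasakiStructure.metric_eq_apply {V W : M → F} (hV : IsSmoothVF (F := F) V)
    (hW : IsSmoothVF (F := F) W) (x : M) :
    S.metric x (V x) (W x) = S.form x (V x) * S.form x (W x)
      + (mder F ℝ (fun y => S.form y (S.endo y (W y))) x (V x)
        - mder F ℝ (fun y => S.form y (V y)) x (S.endo x (W x))
        - S.form x (mbr V (fun y => S.endo y (W y)) x)) := S.metric_eq V W hV hW x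

lemma SasakiStructure.dform_reeb {V : M → F} (hV : IsSmoothVF (F := F) V) (x : M) :
    mder F ℝ (fun y => S.form y (V y)) x (S.reeb x)
      - mder F ℝ (fun y => S.form y (S.reeb y)) x (V x)
      - S.form x (mbr S.reeb V x) = 0 := S.dφ_η V hV x

lemma SasakiStructure.killing_apply {V W : M → F} (hV : IsSmoothVF (F := F) V)
    (hW : IsSmoothVF (F := F) W) (x : M) :
    mder F ℝ (fun y => S.metric y (V y) (W y)) x (S.reeb x)
      = S.metric x (mbr S.reeb V x) (W x) + S.metric x (V x) (mbr S.reeb W x) :=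
  S.killing V W hV hW x

/-- The equation `J² = -1 + φ ⊗ η` alone implies `J η = 0`. -/
lemma SasakiStructure.endo_reeb (x : M) : S.endo x (S.reeb x) = 0 := by
  have h0 : S.endo x (S.endo x (S.reeb x)) = 0 := by
    rw [S.endo_endo, S.form_reeb, one_smul, neg_add_cancel]
  have h1 := S.endo_endo x (S.endo x (S.reeb x))
  rw [h0, map_zero, eq_comm, neg_add_eq_zero] at h1
  -- `J η = c η` with `c² = 0`
  have h2 : S.form x (S.endo x (S.reeb x)) * S.form x (S.endo x (S.reeb x)) = 0 := by
    have h3 := congrArg (fun u => S.form x (S.endo x u)) h1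
    simp only [h0, map_smul, map_zero, smul_eq_mul] at h3
    exact h3.symm
  rw [h1, mul_self_eq_zero.1 h2, zero_smul]

lemma SasakiStructure.form_endo (x : M) (u : F) : S.form x (S.endo x u) = 0 := by
  have h1 := S.endo_endo x (S.endo x u)
  have h2 := congrArg (S.endo x) (S.endo_endo x u)
  rw [map_add, map_neg, map_smul, S.endo_reeb, smul_zero, add_zero, h1, add_eq_left] at h2
  have h3 := congrArg (S.form x) h2
  simpa [S.form_reeb] using h3

/-- A horizontal vector that is orthogonal to the image of `J` vanishes. -/
lemma SasakiStructure.eq_zero_of_horizontal (x : M) {u : F} (hu : S.form x u = 0)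
    (h : ∀ v, S.metric x u (S.endo x v) = 0) : u = 0 := by
  by_contra hne
  have h1 := h (S.endo x u)
  rw [S.endo_endo, hu, zero_smul, add_zero, (S.metric x u).map_neg, neg_eq_zero] at h1
  exact (S.isMetricEndo.pos x u hne).ne' h1

variable {S}
variable {E : Type*} [NormedAddCommGroup E] [NormedSpace ℝ E]
  {G : Type*} [TopologicalSpace G] [ChartedSpace E G] [Group G] [LieGroup 𝓘(ℝ, E) ∞ G]
  [MulAction G M] [ContMDiffSMul 𝓘(ℝ, E) 𝓘(ℝ, F) ∞ G M]

lemma SasakiStructure.form_actDeriv (hG : ∀ a : G, S.IsAutomorphism (fun x => a • x))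
    (a : G) (x : M) (u : F) : S.form (a • x) (actDeriv F a x u) = S.form x u := (hG a x u).1

lemma SasakiStructure.mder_form (hG : ∀ a : G, S.IsAutomorphism (fun x => a • x))
    {W : M → F} (hW : IsSmoothVF (F := F) W) (Y : E) (x : M) :
    mder F ℝ (fun y => S.form y (W y)) x (fund E G F x Y)
      = S.form x (mbr (fun y => fund E G F y Y) W x) :=
  mder_oneForm_fund hW (S.smooth_form hW) (fun a x v => S.form_actDeriv hG a x v) x Y

lemma SasakiStructure.mder_form_reeb (hG : ∀ a : G, S.IsAutomorphism (fun x => a • x))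
    (Y : E) (x : M) : mder F ℝ (fun y => S.form y (fund E G F y Y)) x (S.reeb x) = 0 := by
  have hs := isSmoothVF_fund (F := F) (M := M) (G := G) Y
  have h := S.dform_reeb hs x
  rw [S.mder_form hG S.isSmoothVF_reeb, mbr_skew S.reeb, (S.form x).map_neg] at h
  linarith

/-- The value of the metric on a fundamental vector: the exterior derivative of the contact form
is easily computed on fundamental fields, as these preserve the contact form. -/
lemma SasakiStructure.metric_fund (hG : ∀ a : G, S.IsAutomorphism (fun x => a • x))
    {W : M → F} (hW : IsSmoothVF (F := F) W) (Y : E) (x : M) :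
    S.metric x (fund E G F x Y) (W x) = S.form x (fund E G F x Y) * S.form x (W x)
      - mder F ℝ (fun y => S.form y (fund E G F y Y)) x (S.endo x (W x)) := by
  have h := S.metric_eq_apply (isSmoothVF_fund (G := G) Y) hW x
  rw [S.mder_form hG (S.isMetricEndo.smooth_endo hW)] at h
  rw [h]
  ring

lemma SasakiStructure.metric_fund_endo (hG : ∀ a : G, S.IsAutomorphism (fun x => a • x))
    (Y Z : E) (x : M) :
    S.metric x (fund E G F x Y) (S.endo x (fund E G F x Z))
      = S.form x (fund E G F x (lbr G Y Z)) := by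
  have hs := fun Y : E => isSmoothVF_fund (F := F) (M := M) (G := G) Y
  rw [S.metric_fund hG (S.isMetricEndo.smooth_endo (hs Z)), S.form_endo, S.endo_endo, map_add,
    map_neg, map_smul, S.mder_form_reeb hG, S.mder_form hG (hs Y), mbr_fund_fund, lbr_skew,
    (fund E G F x).map_neg, neg_neg]
  simp

variable [MulAction.IsPretransitive G M] {o : M}

lemma SasakiStructure.metric_reeb (hG : ∀ a : G, S.IsAutomorphism (fun x => a • x))
    (hsub : Function.Surjective (fund E G F o)) (x : M) (u : F) :
    S.metric x u (S.reeb x) = S.form x u := by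
  obtain ⟨Y, rfl⟩ := fund_surjective (E := E) (G := G) hsub x u
  rw [S.metric_fund hG S.isSmoothVF_reeb, S.form_reeb, S.endo_reeb, map_zero]
  simp

/-- Automorphisms preserve the bilinear form `g(u, J v)`, which on fundamental fields is the value
of the contact form on their bracket. -/
lemma SasakiStructure.metric_endo_actDeriv (hG : ∀ a : G, S.IsAutomorphism (fun x => a • x))
    (hsub : Function.Surjective (fund E G F o)) (a : G) (x : M) (u v : F) :
    S.metric (a • x) (actDeriv F a x u) (S.endo (a • x) (actDeriv F a x v))
      = S.metric x u (S.endo x v) := by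
  obtain ⟨Y, rfl⟩ := fund_surjective (E := E) (G := G) hsub x u
  obtain ⟨Z, rfl⟩ := fund_surjective (E := E) (G := G) hsub x v
  rw [actDeriv_fund, actDeriv_fund, S.metric_fund_endo hG, S.metric_fund_endo hG, ← adj_lbr,
    ← actDeriv_fund, S.form_actDeriv hG]

lemma SasakiStructure.reeb_invariant (hG : ∀ a : G, S.IsAutomorphism (fun x => a • x))
    (hsub : Function.Surjective (fund E G F o)) : IsInvariantVF G S.reeb := by
  intro a x
  rw [← sub_eq_zero]
  refine S.eq_zero_of_horizontal (a • x) ?_ fun v => ?_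
  · rw [map_sub, S.form_actDeriv hG, S.form_reeb, S.form_reeb, sub_self]
  · rw [← actDeriv_apply_inv E a x v, map_sub, _root_.sub_apply, S.metric_endo_actDeriv hG hsub,
      S.isMetricEndo.symm, S.metric_reeb hG hsub, S.form_endo, S.isMetricEndo.symm,
      S.metric_reeb hG hsub, S.form_endo, sub_self]

/-- Automorphisms are only assumed to commute with `J` on the kernel of the contact form, but they
also preserve the Reeb field, which spans a complement. -/
lemma SasakiStructure.isInvariantMetricEndo (hG : ∀ a : G, S.IsAutomorphism (fun x => a • x))
    (hsub : Function.Surjective (fund E G F o)) :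
    IsInvariantMetricEndo G S.metric S.endo := by
  have hJ : ∀ (a : G) x u, actDeriv F a x (S.endo x u) = S.endo (a • x) (actDeriv F a x u) := by
    intro a x u
    have h : actDeriv F a x (S.endo x (u - S.form x u • S.reeb x))
        = S.endo (a • x) (actDeriv F a x (u - S.form x u • S.reeb x)) :=
      (hG a x (u - S.form x u • S.reeb x : F)).2 (by
        change S.form x (u - S.form x u • S.reeb x) = 0
        rw [map_sub, map_smul, S.form_reeb, smul_eq_mul, mul_one, sub_self])
    simpa only [map_sub, map_smul, S.endo_reeb, map_zero, smul_zero, sub_zero,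
      S.reeb_invariant hG hsub a x] using h
  refine ⟨fun a x u v => ?_, hJ⟩
  have key : ∀ x u v, S.metric x u v
      = S.form x v * S.form x u - S.metric x u (S.endo x (S.endo x v)) := fun x u v => by
    rw [S.endo_endo, map_add, map_neg, map_smul, S.metric_reeb hG hsub, smul_eq_mul]
    ring
  rw [key, ← hJ, S.metric_endo_actDeriv hG hsub, S.form_actDeriv hG, S.form_actDeriv hG, ← key]

/-- The Reeb field is an infinitesimal automorphism. -/
lemma SasakiStructure.reeb_isInvariantAutField
    (hG : ∀ a : G, S.IsAutomorphism (fun x => a • x))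
    (hsub : Function.Surjective (fund E G F o)) :
    IsInvariantAutField E G S.metric S.endo S.reeb where
  smooth := S.isSmoothVF_reeb
  invariant := S.reeb_invariant hG hsub
  metric Y Z x := by
    have hη := S.isSmoothVF_reeb
    rw [S.killing_apply (isSmoothVF_fund Y) (isSmoothVF_fund Z), mbr_skew,
      mbr_fund_of_invariant hη (S.reeb_invariant hG hsub), mbr_skew S.reeb,
      mbr_fund_of_invariant hη (S.reeb_invariant hG hsub), neg_zero, map_zero, map_zero,
      _root_.zero_apply, add_zero]
  endo Y Z x := by
    have e : (fun y => S.metric y (S.endo y (fund E G F y Y)) (fund E G F y Z))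
        = fun y => S.form y (fund E G F y (lbr G Z Y)) :=
      funext fun y => by rw [S.isMetricEndo.symm, S.metric_fund_endo hG]
    rw [e, S.mder_form_reeb hG]

/-- The fundamental field of a central element is proportional to the Reeb field. -/
lemma SasakiStructure.fund_of_central (hG : ∀ a : G, S.IsAutomorphism (fun x => a • x))
    (hsub : Function.Surjective (fund E G F o)) {W : E} (hW : ∀ Z, lbr G W Z = 0) (x : M) :
    fund E G F x W = S.form x (fund E G F x W) • S.reeb x := by
  rw [← sub_eq_zero]
  refine S.eq_zero_of_horizontal x ?_ fun v => ?_
  · rw [map_sub, map_smul, S.form_reeb, smul_eq_mul, mul_one, sub_self]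
  · obtain ⟨Z, rfl⟩ := fund_surjective (E := E) (G := G) hsub x v
    rw [map_sub, _root_.sub_apply, S.metric_fund_endo hG, hW, map_smul, _root_.smul_apply,
      S.isMetricEndo.symm x (S.reeb x), S.metric_reeb hG hsub, S.form_endo]
    simp

end Sasaki

/-! ### The product of a Lie group with a line -/

section ProductWithLine

/-- The Lie group `G × ℝ`, with the additive structure on `ℝ`. -/
def ProdReal (G : Type*) : Type _ := G × ℝ

variable {E : Type*} [NormedAddCommGroup E] [NormedSpace ℝ E]
  {G : Type*}

instance [TopologicalSpace G] : TopologicalSpace (ProdReal G) :=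
  inferInstanceAs (TopologicalSpace (G × ℝ))

instance [TopologicalSpace G] [ChartedSpace E G] : ChartedSpace (E × ℝ) (ProdReal G) :=
  prodChartedSpace E G ℝ ℝ

instance [Group G] : Group (ProdReal G) where
  mul p q := (p.1 * q.1, p.2 + q.2)
  one := (1, 0)
  inv p := (p.1⁻¹, -p.2)
  mul_assoc p q r := Prod.ext (mul_assoc _ _ _) (add_assoc _ _ _)
  one_mul p := Prod.ext (one_mul _) (zero_add _)
  mul_one p := Prod.ext (mul_one _) (add_zero _)
  inv_mul_cancel p := Prod.ext (inv_mul_cancel _) (neg_add_cancel _)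

/-- The element of the product with the given components. -/
def ProdReal.mk (a : G) (s : ℝ) : ProdReal G := (a, s)

/-- The first component, an element of the group. -/
def ProdReal.fst (p : ProdReal G) : G := p.1

/-- The second component, a real number. -/
def ProdReal.snd (p : ProdReal G) : ℝ := p.2

namespace ProdReal

section Group
variable [Group G]

lemma fst_mul (p q : ProdReal G) : (p * q).fst = p.fst * q.fst := rfl
lemma snd_mul (p q : ProdReal G) : (p * q).snd = p.snd + q.snd := rfl
lemma fst_one : (1 : ProdReal G).fst = 1 := rfl
lemma snd_one : (1 : ProdReal G).snd = 0 := rfl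

end Group

variable [TopologicalSpace G] [ChartedSpace E G]

/-- The models of `G × ℝ` as a manifold modelled on a normed space and as a product agree. -/
lemma model_eq : 𝓘(ℝ, E × ℝ) = (𝓘(ℝ, E).prod 𝓘(ℝ, ℝ) : ModelWithCorners ℝ (E × ℝ) (E × ℝ)) :=
  modelWithCornersSelf_prod

lemma smooth_fst : Smooth (E × ℝ) E (ProdReal.fst (G := G)) := by
  unfold Smooth
  rw [model_eq]
  exact contMDiff_fst (I := 𝓘(ℝ, E)) (J := 𝓘(ℝ, ℝ)) (M := G) (N := ℝ)

lemma smooth_snd : Smooth (E × ℝ) ℝ (ProdReal.snd (G := G)) := by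
  unfold Smooth
  rw [model_eq]
  exact contMDiff_snd (I := 𝓘(ℝ, E)) (J := 𝓘(ℝ, ℝ)) (M := G) (N := ℝ)

lemma contMDiff_mk {K H P : Type*} [NormedAddCommGroup K] [NormedSpace ℝ K] [TopologicalSpace H]
    {I : ModelWithCorners ℝ K H} [TopologicalSpace P] [ChartedSpace H P] {f : P → G} {s : P → ℝ}
    (hf : ContMDiff I 𝓘(ℝ, E) ∞ f) (hs : ContMDiff I 𝓘(ℝ, ℝ) ∞ s) :
    ContMDiff I 𝓘(ℝ, E × ℝ) ∞ (fun p => ProdReal.mk (f p) (s p)) := by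
  rw [model_eq]
  exact ContMDiff.prodMk hf hs

lemma mder_fst (p : ProdReal G) (v : E × ℝ) : mder (E × ℝ) E (ProdReal.fst (G := G)) p v = v.1 := by
  unfold mder
  rw [model_eq]
  exact congrArg (fun L : E × ℝ →L[ℝ] E => L v)
    (mfderiv_fst (I := 𝓘(ℝ, E)) (I' := 𝓘(ℝ, ℝ)) (M := G) (M' := ℝ) (x := p))

lemma mder_snd (p : ProdReal G) (v : E × ℝ) : mder (E × ℝ) ℝ (ProdReal.snd (G := G)) p v = v.2 := by
  unfold mder
  rw [model_eq]
  exact congrArg (fun L : E × ℝ →L[ℝ] ℝ => L v)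
    (mfderiv_snd (I := 𝓘(ℝ, E)) (I' := 𝓘(ℝ, ℝ)) (M := G) (M' := ℝ) (x := p))

instance [IsManifold 𝓘(ℝ, E) ∞ G] : IsManifold 𝓘(ℝ, E × ℝ) ∞ (ProdReal G) := by
  rw [model_eq]
  exact IsManifold.prod (I := 𝓘(ℝ, E)) (I' := 𝓘(ℝ, ℝ)) G ℝ

instance [Group G] [LieGroup 𝓘(ℝ, E) ∞ G] : LieGroup 𝓘(ℝ, E × ℝ) ∞ (ProdReal G) where
  contMDiff_mul := contMDiff_mk
    ((smooth_fst.comp contMDiff_fst).mul (smooth_fst.comp contMDiff_snd))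
    ((smooth_snd (E := E) (G := G).comp contMDiff_fst).add (smooth_snd.comp contMDiff_snd))
  contMDiff_inv := contMDiff_mk smooth_fst.inv smooth_snd.neg

instance [SimplyConnectedSpace G] : SimplyConnectedSpace (ProdReal G) :=
  ((ContinuousMap.HomotopyEquiv.refl G).prodCongr
    (ContractibleSpace.hequiv ℝ Unit).some |>.trans
      (Homeomorph.prodPUnit G).toHomotopyEquiv).simplyConnectedSpace

variable [Group G] [LieGroup 𝓘(ℝ, E) ∞ G]

/-- The projections to the factors are homomorphisms, and so determine the bracket. -/
lemma lbr_eq (v w : E × ℝ) : lbr (ProdReal G) v w = (lbr G v.1 w.1, 0) := by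
  have h1 := mder_hom_lbr (smooth_fst (E := E) (G := G)) fst_mul v w
  have h2 := mder_char_lbr (smooth_snd (E := E) (G := G)) snd_mul v w
  rw [mder_fst, mder_fst, mder_fst] at h1
  rw [mder_snd] at h2
  exact Prod.ext h1 h2

variable {F : Type*} [NormedAddCommGroup F] [NormedSpace ℝ F]
  {M : Type*} [TopologicalSpace M] [ChartedSpace F M] [IsManifold 𝓘(ℝ, F) ∞ M]
  [MulAction G M] [ContMDiffSMul 𝓘(ℝ, E) 𝓘(ℝ, F) ∞ G M] {ζ : M → F} {ψ : ℝ → M → M}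

/-- The action of `G × ℝ` that is given by an action of `G` and a commuting flow. -/
@[reducible] def flowAction (h : IsEquivariantFlow G ζ ψ) : MulAction (ProdReal G) M where
  smul p x := p.fst • ψ p.snd x
  one_smul x := by
    change (1 : G) • ψ 0 x = x
    rw [h.zero, one_smul]
  mul_smul p q x := by
    change (p.fst * q.fst) • ψ (p.snd + q.snd) x = p.fst • ψ p.snd (q.fst • ψ q.snd x)
    rw [h.add, h.smul, mul_smul]

lemma smooth_flowAction (h : IsEquivariantFlow G ζ ψ) :
    letI := flowAction h
    ContMDiffSMul 𝓘(ℝ, E × ℝ) 𝓘(ℝ, F) ∞ (ProdReal G) M :=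
  letI := flowAction h
  ⟨ContMDiff.comp (smooth₂_smul E G F M) ((smooth_fst.comp contMDiff_fst).prodMk
    (ContMDiff.comp h.smooth
      ((smooth_snd (E := E) (G := G).comp contMDiff_fst).prodMk contMDiff_snd)))⟩

lemma fund_flowAction (h : IsEquivariantFlow G ζ ψ) (x : M) (v : E × ℝ) :
    letI := flowAction h
    fund (E × ℝ) (ProdReal G) F x v = fund E G F x v.1 + v.2 • ζ x := by
  let _ := flowAction h
  have hs : Smooth (E × ℝ) F (fun p : ProdReal G => ψ p.snd x) :=
    (h.smooth_left x).comp smooth_snd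
  have h1 := mder_comp₂ (smooth₂_smul E G F M) (f := ProdReal.fst (G := G))
    (k := fun p => ψ p.snd x) (p := (1 : ProdReal G)) (smooth_fst.mdAt 1) (hs.mdAt 1) v
  have h2 := mder_comp' (E := E × ℝ) (F := ℝ) (F' := F) (g := fun t => ψ t x)
    (f := ProdReal.snd (G := G)) 1 ((h.smooth_left x).mdAt _) (smooth_snd.mdAt 1) v
  rw [mder_snd, snd_one] at h2
  have h3 : mder ℝ F (fun t => ψ t x) 0 v.2 = v.2 • ζ x := by
    rw [← h.deriv, ← map_smul, smul_eq_mul, mul_one]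
  rw [h2, h3, mder_fst, fst_one, snd_one, h.zero] at h1
  simp only [one_smul, mder_id] at h1
  exact h1

end ProdReal

end ProductWithLine

/-! ### One-dimensional modifications -/

section Modification

/-- The Lie subalgebra spanned by one element. -/
def lineSubalgebra {L : Type*} [LieRing L] [LieAlgebra ℝ L] (D : L) : LieSubalgebra ℝ L where
  toSubmodule := Submodule.span ℝ {D}
  lie_mem' := by
    intro x y hx hy
    obtain ⟨a, rfl⟩ := Submodule.mem_span_singleton.1 hx
    obtain ⟨b, rfl⟩ := Submodule.mem_span_singleton.1 hy
    simp

lemma mem_lineSubalgebra {L : Type*} [LieRing L] [LieAlgebra ℝ L] {D x : L} :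
    x ∈ lineSubalgebra D ↔ ∃ a : ℝ, a • D = x := Submodule.mem_span_singleton

instance {L : Type*} [LieRing L] [LieAlgebra ℝ L] (D : L) : IsLieAbelian (lineSubalgebra D) where
  trivial := by
    rintro ⟨x, hx⟩ ⟨y, hy⟩
    obtain ⟨a, rfl⟩ := mem_lineSubalgebra.1 hx
    obtain ⟨b, rfl⟩ := mem_lineSubalgebra.1 hy
    ext1
    simp

variable {V : Type w} [AddCommGroup V] [Module ℝ V] {g : V → V → ℝ} {J : V → V}

/-- A modification with a one-dimensional algebra of derivations, spanned by `D`, in terms of the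
components `A` and `c D` of the map to the semidirect sum. -/
lemma LiePair.isModificationStep_of_derivation
    {P P' : LiePair.{v} V} (D : LieDerivation ℝ P.𝔤 P.𝔤) (τ : V →ₗ[ℝ] V)
    (hg0 : ∀ (t : ℝ) x y, g (t • x) y = t * g x y) (hg1 : ∀ (t : ℝ) x y, g x (t • y) = t * g x y)
    (hJ : ∀ (t : ℝ) x, J (t • x) = t • J x)
    (hτ : ∀ X, P.proj (D X) = τ (P.proj X)) (hskew : ∀ x y, g (τ x) y + g x (τ y) = 0)
    (hτJ : ∀ x, J (τ x) = τ (J x)) (A : P'.𝔤 →ₗ[ℝ] P.𝔤) (c : P'.𝔤 →ₗ[ℝ] ℝ)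
    (hA : ∀ v w : P'.𝔤, A ⁅v, w⁆ = ⁅A v, A w⁆ + c v • D (A w) - c w • D (A v))
    (hc : ∀ v w : P'.𝔤, c ⁅v, w⁆ = 0) (hproj : ∀ v, P'.proj v = P.proj (A v))
    (hbij : (D ≠ 0 ∧ Function.Bijective fun v => (A v, c v)) ∨ Function.Bijective A) :
    LiePair.IsModificationStep g J P P' := by
  let f : P'.𝔤 →ₗ⁅ℝ⁆ LieAlgebra.SemiDirectSum P.𝔤 (lineSubalgebra D) (lineSubalgebra D).incl :=
    { toFun := fun v => ⟨A v, ⟨c v • D, mem_lineSubalgebra.2 ⟨c v, rfl⟩⟩⟩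
      map_add' := fun v w => by
        simp only [map_add, LieAlgebra.SemiDirectSum.add_eq_mk, add_smul]
        rfl
      map_smul' := fun t v => by
        simp only [map_smul, LieAlgebra.SemiDirectSum.smul_eq_mk, smul_eq_mul, mul_smul]
        rfl
      map_lie' := fun {v w} => by
        rw [LieAlgebra.SemiDirectSum.lie_eq_mk]
        congr 1
        · exact hA v w
        · refine Subtype.ext ?_
          change c ⁅v, w⁆ • D = ⁅c v • D, c w • D⁆
          rw [hc, zero_smul, smul_lie, lie_smul, lie_self, smul_zero, smul_zero] }
  refine ⟨lineSubalgebra D, fun σ hσ => ?_, f, hproj, hbij.imp (fun h => ?_)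
    fun h => ⟨inferInstance, h⟩⟩
  · obtain ⟨t, rfl⟩ := mem_lineSubalgebra.1 hσ
    refine ⟨t • τ, fun X => ?_, fun x y => ?_, fun x => ?_⟩
    · rw [LieDerivation.smul_apply, map_smul, hτ, LinearMap.smul_apply]
    · rw [LinearMap.smul_apply, LinearMap.smul_apply, hg0, hg1, ← mul_add, hskew, mul_zero]
    · rw [LinearMap.smul_apply, LinearMap.smul_apply, hJ, hτJ]
  · obtain ⟨hD, hb⟩ := h
    constructor
    · intro v w hvw
      have h1 : A v = A w := congrArg LieAlgebra.SemiDirectSum.left hvw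
      have h2 : c v • D = c w • D :=
        congrArg (fun x => (LieAlgebra.SemiDirectSum.right x).1) hvw
      exact hb.1 (Prod.ext h1 (smul_left_injective ℝ hD h2))
    · rintro ⟨x, ⟨σ, hσ⟩⟩
      obtain ⟨t, rfl⟩ := mem_lineSubalgebra.1 hσ
      obtain ⟨v, hv⟩ := hb.2 (x, t)
      have h1 : A v = x := congrArg Prod.fst hv
      have h2 : c v = t := congrArg Prod.snd hv
      exact ⟨v, LieAlgebra.SemiDirectSum.ext h1 (Subtype.ext (congrArg (fun s => s • D) h2))⟩

end Modification

section Presentation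

variable {F : Type w} [NormedAddCommGroup F] [NormedSpace ℝ F]
  {M : Type z} [TopologicalSpace M] [ChartedSpace F M] [IsManifold 𝓘(ℝ, F) ∞ M] {o : M}

namespace HomogeneousPresentation

lemma surjective_fund (P : HomogeneousPresentation.{u, v} F o) :
    Function.Surjective (fund P.E P.G F o) := P.submersion

/-- The element `W` of the Lie algebra, as an element of the model space, is central. -/
def IsCentral (P : HomogeneousPresentation.{u, v} F o) (W : P.E) : Prop := ∀ Z, lbr P.G W Z = 0

/-- The isotropy algebra contains no nonzero ideal, in terms of the model space. -/
lemma eq_zero_of_mem_ideal (P : HomogeneousPresentation.{u, v} F o) (I : Submodule ℝ P.E)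
    (hI : ∀ Z, ∀ Y ∈ I, lbr P.G Z Y ∈ I) (h0 : ∀ Y ∈ I, fund P.E P.G F o Y = 0) {Y : P.E}
    (hY : Y ∈ I) : Y = 0 := by
  let I' : LieIdeal ℝ P.lieAlg :=
    { carrier := {Y : P.lieAlg | (show P.E from Y) ∈ I}
      add_mem' := fun ha hb => I.add_mem ha hb
      zero_mem' := I.zero_mem
      smul_mem' := fun t _ hY => I.smul_mem t hY
      lie_mem := fun {Z Y} hY => hI Z Y hY }
  have h1 : I' = ⊥ := P.almost_effective I' h0
  have h2 : (show P.lieAlg from Y) ∈ I' := hY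
  rw [h1] at h2
  exact (LieSubmodule.mem_bot (show P.lieAlg from Y)).1 h2

lemma eq_zero_of_isCentral (P : HomogeneousPresentation.{u, v} F o) {W : P.E} (hW : P.IsCentral W)
    (h0 : fund P.E P.G F o W = 0) : W = 0 := by
  refine P.eq_zero_of_mem_ideal (Submodule.span ℝ {W}) (fun Z Y hY => ?_) (fun Y hY => ?_)
    (Submodule.mem_span_singleton_self W)
  · obtain ⟨t, rfl⟩ := Submodule.mem_span_singleton.1 hY
    rw [lbr_smul_right, lbr_skew, hW, neg_zero, smul_zero]
    exact Submodule.zero_mem _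
  · obtain ⟨t, rfl⟩ := Submodule.mem_span_singleton.1 hY
    rw [map_smul, h0, smul_zero]

end HomogeneousPresentation

end Presentation

/-! ### Presentations with an additional line -/

section ProductPresentation

variable {F : Type w} [NormedAddCommGroup F] [NormedSpace ℝ F]
  {M : Type z} [TopologicalSpace M] [ChartedSpace F M] [IsManifold 𝓘(ℝ, F) ∞ M] {o : M}
  {g : M → F →L[ℝ] F →L[ℝ] ℝ} {J : M → F →L[ℝ] F} {ζ : M → F} {ψ : ℝ → M → M}

namespace HomogeneousPresentation

lemma isotropyDim_add_finrank (P : HomogeneousPresentation.{u, v} F o) :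
    P.isotropyDim + finrank ℝ F = finrank ℝ P.E := by
  have : FiniteDimensional ℝ P.lieAlg := P.finiteDimensional
  have h1 := LinearMap.finrank_range_add_finrank_ker (orbitDeriv P.E P.G F o)
  have h2 := congrArg (fun N : Submodule ℝ (TangentSpace 𝓘(ℝ, F) o) => finrank ℝ N)
    (LinearMap.range_eq_top.2 P.submersion)
  have h3 : finrank ℝ (LinearMap.range (orbitDeriv P.E P.G F o)) = finrank ℝ F :=
    h2.trans (finrank_top _ _)
  rw [h3, add_comm] at h1
  exact h1

/-- A modification step with the derivation `ad X`, where `X` represents an invariant infinitesimal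
automorphism at `o`. -/
lemma isModificationStep_of_autField (P P' : HomogeneousPresentation.{u, v} F o)
    (hgJ : IsMetricEndo g J) (hG : IsInvariantMetricEndo P.G g J)
    (hζ : IsInvariantAutField P.E P.G g J ζ) {X : P.E} (hX : fund P.E P.G F o X = ζ o)
    (A : P'.E →ₗ[ℝ] P.E) (c : P'.E →ₗ[ℝ] ℝ)
    (hA : ∀ v w, A (lbr P'.G v w)
      = lbr P.G (A v) (A w) + c v • lbr P.G X (A w) - c w • lbr P.G X (A v))
    (hc : ∀ v w, c (lbr P'.G v w) = 0)
    (hproj : ∀ v, fund P'.E P'.G F o v = fund P.E P.G F o (A v))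
    (hbij : (¬ P.IsCentral X ∧ Function.Bijective fun v => (A v, c v)) ∨ Function.Bijective A) :
    LiePair.IsModificationStep (V := TangentSpace 𝓘(ℝ, F) o) (fun u v => g o u v) (J o)
      P.pair P'.pair := by
  obtain ⟨τ, hτ, hskew, hτJ⟩ := hζ.exists_induced P.surjective_fund hgJ hG hX
  let D : LieDerivation ℝ P.lieAlg P.lieAlg := LieDerivation.ad ℝ P.lieAlg X
  have hD : ∀ Y : P.E, D Y = lbr P.G X Y := fun Y => LieDerivation.ad_apply_apply ..
  refine LiePair.isModificationStep_of_derivation (P := P.pair) (P' := P'.pair)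
    D τ (fun t x y => ?_) (fun t x y => ?_)
    (fun t x => (J o).map_smul t x)
    (fun Y => (congrArg (fund P.E P.G F o) (hD Y)).trans (hτ Y)) hskew hτJ A c
    (fun v w => (hA v w).trans (congrArg₂ (fun y z : P.E =>
      lbr P.G (A v) (A w) + c v • y - c w • z) (hD _).symm (hD _).symm)) hc hproj
    (hbij.imp_left fun h => ⟨fun h0 => h.1 fun Z => ?_, h.2⟩)
  · exact congrArg (fun L : F →L[ℝ] ℝ => L y) ((g o).map_smul t x)
  · exact (g o x).map_smul t y
  · exact (hD Z).symm.trans (congrArg (fun D : LieDerivation ℝ P.lieAlg P.lieAlg => D Z) h0)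

/-- The stabilizer of `o` in `G × ℝ` consists of the pairs `(a exp(-t X), t)` with `a` in the
stabilizer in `G`, so it is connected. -/
lemma isConnected_stabilizer_prodReal (P : HomogeneousPresentation.{u, v} F o)
    (h : IsEquivariantFlow P.G ζ ψ) {e : ℝ → P.G} (he : Smooth ℝ P.E e)
    (hadd : ∀ s t, e (s + t) = e s * e t) (hψ : ∀ t, ψ t o = e t • o) :
    letI := ProdReal.flowAction h
    IsConnected (MulAction.stabilizer (ProdReal P.G) o : Set (ProdReal P.G)) := by
  let _ := ProdReal.flowAction h
  have hmem : ∀ p : ProdReal P.G, p ∈ MulAction.stabilizer (ProdReal P.G) o ↔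
      p.fst * e p.snd ∈ MulAction.stabilizer P.G o := fun p => by
    rw [MulAction.mem_stabilizer_iff, MulAction.mem_stabilizer_iff, mul_smul, ← hψ]
    rfl
  have he0 : ∀ t, e (-t) * e t = 1 := fun t => by
    rw [← hadd, neg_add_cancel]
    simpa using hadd 0 0
  have hcont : Continuous fun q : P.G × ℝ => ProdReal.mk (q.1 * e (-q.2)) q.2 :=
    Continuous.prodMk
      ((smooth₂_mul P.E P.G).continuous.comp
        (continuous_fst.prodMk (he.continuous.comp continuous_snd.neg))) continuous_snd
  have himg : (MulAction.stabilizer (ProdReal P.G) o : Set (ProdReal P.G))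
      = (fun q : P.G × ℝ => ProdReal.mk (q.1 * e (-q.2)) q.2) ''
        ((MulAction.stabilizer P.G o : Set P.G) ×ˢ univ) := by
    ext p
    rw [SetLike.mem_coe, hmem]
    constructor
    · intro hp
      refine ⟨(p.fst * e p.snd, p.snd), ⟨hp, mem_univ _⟩, Prod.ext ?_ rfl⟩
      change p.fst * e p.snd * e (-p.snd) = p.fst
      have := he0 (-p.snd)
      rw [neg_neg] at this
      rw [mul_assoc, this, mul_one]
    · rintro ⟨⟨a, t⟩, ⟨ha, -⟩, rfl⟩
      change a * e (-t) * e t ∈ _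
      rw [mul_assoc, he0, mul_one]
      exact ha
  rw [himg]
  exact (P.isotropy_connected.prod isConnected_univ).image _ hcont.continuousOn

/-- The presentation with the group `G × ℝ`, where `ℝ` acts by the flow of a field `ζ` that no
central element of the Lie algebra represents at `o`. The latter condition makes the action almost
effective: if `(Y, t)` lies in an ideal contained in the isotropy algebra, then `Y` is central, and
`Y + t X` lies in the isotropy algebra of `G`, where `X` represents `ζ`. -/
noncomputable def prodReal (P : HomogeneousPresentation.{u, v} F o)
    (h : IsEquivariantFlow P.G ζ ψ) {e : ℝ → P.G} (he : Smooth ℝ P.E e)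
    (hadd : ∀ s t, e (s + t) = e s * e t) (hψ : ∀ t, ψ t o = e t • o)
    (hne : ∀ Z, P.IsCentral Z → fund P.E P.G F o Z ≠ ζ o) :
    HomogeneousPresentation.{u, v} F o :=
  letI := ProdReal.flowAction h
  haveI := ProdReal.smooth_flowAction (E := P.E) h
  { E := P.E × ℝ
    G := ProdReal P.G
    transitive := ⟨fun x y => by
      obtain ⟨a, ha⟩ := MulAction.exists_smul_eq P.G x y
      refine ⟨ProdReal.mk a 0, ?_⟩
      change a • ψ 0 x = y
      rw [h.zero, ha]⟩
    isotropy_connected := P.isConnected_stabilizer_prodReal h he hadd hψ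
    submersion := fun u => by
      obtain ⟨Y, hY⟩ := P.surjective_fund u
      refine ⟨(Y, (0 : ℝ)), (ProdReal.fund_flowAction h o (Y, 0)).trans ?_⟩
      rw [zero_smul, add_zero]
      exact hY
    almost_effective := fun I hI => by
      have hI' : ∀ p : P.E × ℝ, p ∈ I → fund P.E P.G F o p.1 + p.2 • ζ o = 0 := fun p hp =>
        (ProdReal.fund_flowAction h o p).symm.trans (hI p hp)
      have hbr : ∀ (p : P.E × ℝ) (Z : P.E), p ∈ I → ((lbr P.G Z p.1, 0) : P.E × ℝ) ∈ I :=
        fun p Z hp => by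
          have h1 := I.lie_mem (x := ((Z, 0) : P.E × ℝ)) hp
          have h2 : lbr (ProdReal P.G) ((Z, 0) : P.E × ℝ) p = (lbr P.G Z p.1, 0) :=
            ProdReal.lbr_eq _ _
          exact h2 ▸ h1
      let I₀ : Submodule ℝ P.E :=
        { carrier := {Y | ((Y, 0) : P.E × ℝ) ∈ I}
          add_mem' := fun {Y Z} hY hZ => by
            have h1 : ((Y, 0) + (Z, 0) : P.E × ℝ) ∈ I := I.add_mem hY hZ
            rwa [Prod.mk_add_mk, add_zero] at h1
          zero_mem' := I.zero_mem
          smul_mem' := fun t Y hY => by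
            have h1 : (t • (Y, 0) : P.E × ℝ) ∈ I := I.smul_mem t hY
            rwa [Prod.smul_mk, smul_zero] at h1 }
      have h0 : ∀ Y ∈ I₀, Y = 0 := fun Y hY => by
        refine P.eq_zero_of_mem_ideal I₀ (fun Z Y hY => hbr (Y, 0) Z hY) (fun Y hY => ?_) hY
        have h1 := hI' (Y, 0) hY
        rwa [zero_smul, add_zero] at h1
      refine (LieSubmodule.eq_bot_iff _).2 ?_
      rintro ⟨Y, t⟩ hp
      have hc : P.IsCentral Y := fun Z => by
        rw [lbr_skew, h0 _ (hbr (Y, t) Z hp), neg_zero]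
      have h1 : fund P.E P.G F o Y + t • ζ o = 0 := hI' (Y, t) hp
      have ht : t = 0 := by
        by_contra ht
        refine hne (-t⁻¹ • Y) (fun Z => ?_) ?_
        · rw [lbr_smul_left, hc, smul_zero]
        · rw [map_smul, eq_neg_of_add_eq_zero_left h1, smul_neg, neg_smul, neg_neg, smul_smul,
            inv_mul_cancel₀ ht, one_smul]
      have hY : Y = 0 := h0 Y (by rw [ht] at hp; exact hp)
      rw [hY, ht]
      rfl }

section
variable (P : HomogeneousPresentation.{u, v} F o)
    (h : IsEquivariantFlow P.G ζ ψ) {e : ℝ → P.G} (he : Smooth ℝ P.E e)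
    (hadd : ∀ s t, e (s + t) = e s * e t) (hψ : ∀ t, ψ t o = e t • o)
    (hne : ∀ Z, P.IsCentral Z → fund P.E P.G F o Z ≠ ζ o)

lemma prodReal_smul (a : (P.prodReal h he hadd hψ hne).G) :
    ∃ (b : P.G) (t : ℝ), ∀ x : M, a • x = b • ψ t x :=
  ⟨ProdReal.fst (G := P.G) a, ProdReal.snd (G := P.G) a, fun _ => rfl⟩

lemma prodReal_fund (v : P.E × ℝ) :
    fund (P.prodReal h he hadd hψ hne).E (P.prodReal h he hadd hψ hne).G F o v
      = fund P.E P.G F o v.1 + v.2 • ζ o := ProdReal.fund_flowAction h o v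

lemma prodReal_lbr (v w : P.E × ℝ) :
    lbr (E := (P.prodReal h he hadd hψ hne).E) (P.prodReal h he hadd hψ hne).G v w
      = (lbr P.G v.1 w.1, 0) := ProdReal.lbr_eq v w

lemma prodReal_isCentral {W : P.E} (hW : P.IsCentral W) (t : ℝ) :
    (P.prodReal h he hadd hψ hne).IsCentral (W, t) := fun v => by
  refine (P.prodReal_lbr h he hadd hψ hne (W, t) v).trans ?_
  rw [hW]
  rfl

lemma prodReal_isotropyDim :
    (P.prodReal h he hadd hψ hne).isotropyDim = P.isotropyDim + 1 := by
  have h1 := (P.prodReal h he hadd hψ hne).isotropyDim_add_finrank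
  have h2 := P.isotropyDim_add_finrank
  have h3 : finrank ℝ (P.prodReal h he hadd hψ hne).E = finrank ℝ P.E + 1 :=
    (finrank_prod (R := ℝ) (M := P.E) (M' := ℝ)).trans (by rw [finrank_self])
  omega

/-- The Lie algebra of `G × ℝ` is `𝔤 ⋊ ℝ ad X`, by `(Y, t) ↦ (Y + t X, -t ad X)`. -/
lemma prodReal_isModificationStep
    (hgJ : IsMetricEndo g J) (hG : IsInvariantMetricEndo P.G g J)
    (hζ : IsInvariantAutField P.E P.G g J ζ) {X : P.E} (hX : fund P.E P.G F o X = ζ o) :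
    LiePair.IsModificationStep (V := TangentSpace 𝓘(ℝ, F) o) (fun u v => g o u v) (J o) P.pair
      (P.prodReal h he hadd hψ hne).pair := by
  let A : P.E × ℝ →ₗ[ℝ] P.E :=
    LinearMap.fst ℝ P.E ℝ + (LinearMap.snd ℝ P.E ℝ).smulRight X
  have hA : ∀ v, A v = v.1 + v.2 • X := fun v => rfl
  refine P.isModificationStep_of_autField (P.prodReal h he hadd hψ hne) hgJ hG hζ hX
    A (-LinearMap.snd ℝ P.E ℝ) (fun v w => ?_) (fun v w => ?_) (fun v => ?_)
    (Or.inl ⟨fun hc => hne X hc hX, fun v w hvw => ?_, fun q => ⟨(q.1 + q.2 • X, -q.2), ?_⟩⟩)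
  · refine (congrArg A (P.prodReal_lbr h he hadd hψ hne v w)).trans ?_
    change A (_, 0) = lbr P.G (v.1 + v.2 • X) (w.1 + w.2 • X)
      + (-v.2) • lbr P.G X (w.1 + w.2 • X) - (-w.2) • lbr P.G X (v.1 + v.2 • X)
    simp only [hA, lbr_add_left, lbr_add_right, lbr_smul_left, lbr_smul_right, lbr_self]
    rw [lbr_skew v.1 X]
    module
  · refine (congrArg (-LinearMap.snd ℝ P.E ℝ) (P.prodReal_lbr h he hadd hψ hne v w)).trans ?_
    exact neg_zero
  · refine (P.prodReal_fund h he hadd hψ hne v).trans ?_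
    change _ = fund P.E P.G F o (v.1 + v.2 • X)
    rw [map_add, map_smul, hX]
  · have h1 : v.1 + v.2 • X = w.1 + w.2 • X := congrArg Prod.fst hvw
    have h2 : -v.2 = -w.2 := congrArg Prod.snd hvw
    have h3 : v.2 = w.2 := neg_injective h2
    rw [h3, add_left_inj] at h1
    exact Prod.ext h1 h3
  · refine Prod.ext ?_ (neg_neg _)
    change q.1 + q.2 • X + (-q.2) • X = q.1
    module

end

end HomogeneousPresentation

end ProductPresentation

/-! ### The twisted group -/

section TwistedGroup

variable {E : Type*} [NormedAddCommGroup E] [NormedSpace ℝ E]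
  {G : Type*} [TopologicalSpace G] [ChartedSpace E G] [Group G]

/-- A smooth one-parameter subgroup of `G`, and a smooth character of `G`. -/
structure TwistData (E : Type*) [NormedAddCommGroup E] [NormedSpace ℝ E]
    (G : Type*) [TopologicalSpace G] [ChartedSpace E G] [Group G] where
  /-- the one-parameter subgroup -/
  exp : ℝ → G
  /-- the character -/
  char : G → ℝ
  smooth_exp : Smooth ℝ E exp
  exp_add : ∀ s t, exp (s + t) = exp s * exp t
  smooth_char : Smooth E ℝ char
  char_mul : ∀ a b, char (a * b) = char a + char b

namespace TwistData

variable (T : TwistData E G)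

lemma exp_zero : T.exp 0 = 1 := by simpa using T.exp_add 0 0

lemma char_one : T.char 1 = 0 := by simpa using T.char_mul 1 1

lemma exp_mul_exp_neg (t : ℝ) : T.exp t * T.exp (-t) = 1 := by
  rw [← T.exp_add, add_neg_cancel, T.exp_zero]

lemma exp_neg_mul_exp (t : ℝ) : T.exp (-t) * T.exp t = 1 := by
  rw [← T.exp_add, neg_add_cancel, T.exp_zero]

lemma char_exp_neg (t : ℝ) : T.char (T.exp (-t)) = -T.char (T.exp t) := by
  rw [← add_eq_zero_iff_eq_neg, ← T.char_mul, T.exp_neg_mul_exp, T.char_one]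

lemma char_inv (a : G) : T.char a⁻¹ = -T.char a := by
  rw [← add_eq_zero_iff_eq_neg, ← T.char_mul, inv_mul_cancel, T.char_one]

/-- The manifold `G`, with the multiplication for which `a ↦ (a · exp(-χ(a)), χ(a))` is a
homomorphism to `G × ℝ`. It is a type synonym, so that the manifold structure is that of `G`. -/
def Twisted (_ : TwistData E G) : Type _ := G

instance : TopologicalSpace T.Twisted := inferInstanceAs (TopologicalSpace G)
instance : ChartedSpace E T.Twisted := inferInstanceAs (ChartedSpace E G)
instance [IsManifold 𝓘(ℝ, E) ∞ G] : IsManifold 𝓘(ℝ, E) ∞ T.Twisted :=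
  inferInstanceAs (IsManifold 𝓘(ℝ, E) ∞ G)
instance [SimplyConnectedSpace G] : SimplyConnectedSpace T.Twisted :=
  inferInstanceAs (SimplyConnectedSpace G)

/-- The multiplication of the twisted group. -/
def mulTw (a b : G) : G := a * T.exp (-T.char a) * (b * T.exp (T.char a))

/-- The inverse in the twisted group. -/
def invTw (a : G) : G := T.exp (T.char a) * (a⁻¹ * T.exp (-T.char a))

lemma char_mulTw (a b : G) : T.char (T.mulTw a b) = T.char a + T.char b := by
  simp only [mulTw, T.char_mul, T.char_exp_neg]
  ring

lemma char_invTw (a : G) : T.char (T.invTw a) = -T.char a := by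
  simp only [invTw, T.char_mul, T.char_exp_neg, T.char_inv]
  ring

lemma mulTw_assoc (a b c : G) : T.mulTw (T.mulTw a b) c = T.mulTw a (T.mulTw b c) := by
  have h := fun t (x : G) => (mul_assoc _ _ x).symm.trans
    ((congrArg (· * x) (T.exp_mul_exp_neg t)).trans (one_mul x))
  have h1 : T.exp (-(T.char a + T.char b)) = T.exp (-T.char a) * T.exp (-T.char b) := by
    rw [← T.exp_add, neg_add]
  have h2 : T.exp (T.char a + T.char b) = T.exp (T.char b) * T.exp (T.char a) := by
    rw [← T.exp_add, add_comm]
  have h3 : ∀ x : G, T.mulTw x c = x * T.exp (-T.char x) * (c * T.exp (T.char x)) := fun x => rfl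
  rw [h3, T.char_mulTw, h1, h2]
  simp only [mulTw, mul_assoc, h]

lemma one_mulTw (a : G) : T.mulTw 1 a = a := by
  simp [mulTw, T.char_one, T.exp_zero]

lemma mulTw_one (a : G) : T.mulTw a 1 = a := by
  unfold mulTw
  rw [one_mul, mul_assoc, T.exp_neg_mul_exp, mul_one]

lemma invTw_mulTw (a : G) : T.mulTw (T.invTw a) a = 1 := by
  have h := fun t (x : G) => (mul_assoc _ _ x).symm.trans
    ((congrArg (· * x) (T.exp_neg_mul_exp t)).trans (one_mul x))
  unfold mulTw
  rw [T.char_invTw, neg_neg]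
  simp only [invTw, mul_assoc, h, inv_mul_cancel_left, T.exp_mul_exp_neg]

instance : Group T.Twisted where
  mul := T.mulTw
  one := (1 : G)
  inv := T.invTw
  mul_assoc := T.mulTw_assoc
  one_mul := T.one_mulTw
  mul_one := T.mulTw_one
  inv_mul_cancel := T.invTw_mulTw

/-- The component in `G` of the homomorphism from the twisted group to `G × ℝ`. -/
def fst (a : T.Twisted) : G := (show G from a) * T.exp (-T.char a)

/-- The component in `ℝ` of the homomorphism from the twisted group to `G × ℝ`. -/
def snd (a : T.Twisted) : ℝ := T.char a

lemma snd_mul (a b : T.Twisted) : T.snd (a * b) = T.snd a + T.snd b := T.char_mulTw a b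

lemma mulTw_mul_exp (a b : G) : T.mulTw a b * T.exp (-T.char (T.mulTw a b))
    = a * T.exp (-T.char a) * (b * T.exp (-T.char b)) := by
  rw [T.char_mulTw, neg_add, T.exp_add]
  simp only [mulTw, mul_assoc]
  rw [← mul_assoc (T.exp (T.char a)), T.exp_mul_exp_neg, one_mul]

lemma fst_mul (a b : T.Twisted) : T.fst (a * b) = T.fst a * T.fst b := T.mulTw_mul_exp a b

lemma fst_one : T.fst 1 = 1 := by
  change (1 : G) * T.exp (-T.char 1) = 1
  rw [T.char_one, neg_zero, T.exp_zero, one_mul]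

lemma snd_one : T.snd 1 = 0 := T.char_one

variable [LieGroup 𝓘(ℝ, E) ∞ G]

lemma contMDiff_mulTw : Smooth₂ E E E (fun p : G × G => T.mulTw p.1 p.2) := by
  have h1 : ContMDiff (𝓘(ℝ, E).prod 𝓘(ℝ, E)) 𝓘(ℝ, ℝ) ∞ fun p : G × G => T.char p.1 :=
    ContMDiff.comp T.smooth_char contMDiff_fst
  exact (contMDiff_fst.mul (ContMDiff.comp T.smooth_exp h1.neg)).mul
    (contMDiff_snd.mul (ContMDiff.comp T.smooth_exp h1))

lemma contMDiff_invTw : Smooth E E T.invTw :=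
  (ContMDiff.comp T.smooth_exp T.smooth_char).mul
    ((smooth_inv E G).mul (ContMDiff.comp T.smooth_exp T.smooth_char.neg))

instance : LieGroup 𝓘(ℝ, E) ∞ T.Twisted where
  contMDiff_mul := T.contMDiff_mulTw
  contMDiff_inv := T.contMDiff_invTw

lemma smooth_fst : Smooth E E T.fst :=
  ContMDiff.mul (I := 𝓘(ℝ, E)) (G := G) contMDiff_id
    (ContMDiff.comp T.smooth_exp T.smooth_char.neg)

lemma smooth_snd : Smooth E ℝ T.snd := T.smooth_char

/-- The generator of the one-parameter subgroup. -/
noncomputable def gen : E := mder ℝ E T.exp 0 1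

/-- The differential of the character. -/
noncomputable def dchar : E →L[ℝ] ℝ := mder E ℝ T.char 1

lemma mder_fst (v : E) : mder E E T.fst 1 v = v - T.dchar v • T.gen := by
  have h1 : Smooth E ℝ (fun a : G => -T.char a) := T.smooth_char.neg
  have h2 := mder_comp₂ (smooth₂_mul E G) (f := fun a : G => a)
    (k := fun a => T.exp (-T.char a)) (p := (1 : G)) (Smooth.mdAt contMDiff_id 1)
    (Smooth.mdAt (ContMDiff.comp T.smooth_exp h1) 1) v
  have h3 := mder_comp' (E := E) (F := ℝ) (F' := E) (g := T.exp)
    (f := fun a : G => -T.char a) 1 (T.smooth_exp.mdAt _) (h1.mdAt 1) v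
  have h4 : ∀ t : ℝ, mder ℝ E T.exp 0 t = t • T.gen := fun t => by
    rw [gen, ← map_smul, smul_eq_mul, mul_one]
  rw [mder_neg_apply, T.char_one, neg_zero, h4] at h3
  rw [h3] at h2
  simp only [T.char_one, neg_zero, T.exp_zero, mul_one, one_mul, mder_id] at h2
  refine h2.trans ?_
  rw [neg_smul, sub_eq_add_neg]
  rfl

lemma dchar_lbr (v w : E) : T.dchar (lbr T.Twisted v w) = 0 :=
  mder_char_lbr T.smooth_snd T.snd_mul v w

/-- The homomorphism to `G` has the differential `Y ↦ Y - χ'(Y) X`. -/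
lemma lbr_twisted (v w : E) :
    lbr T.Twisted v w = lbr G (v - T.dchar v • T.gen) (w - T.dchar w • T.gen) := by
  have h1 := mder_hom_lbr T.smooth_fst T.fst_mul v w
  rw [T.mder_fst, T.mder_fst, T.mder_fst, T.dchar_lbr, zero_smul, sub_zero] at h1
  exact h1

variable {F : Type*} [NormedAddCommGroup F] [NormedSpace ℝ F]
  {M : Type*} [TopologicalSpace M] [ChartedSpace F M] [IsManifold 𝓘(ℝ, F) ∞ M]
  [MulAction G M] [ContMDiffSMul 𝓘(ℝ, E) 𝓘(ℝ, F) ∞ G M] {ζ : M → F} {ψ : ℝ → M → M}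

/-- The action of the twisted group that is given by an action of `G` and a commuting flow. -/
@[reducible] def flowAction (h : IsEquivariantFlow G ζ ψ) : MulAction T.Twisted M where
  smul a x := T.fst a • ψ (T.snd a) x
  one_smul x := by
    change T.fst 1 • ψ (T.snd 1) x = x
    rw [T.fst_one, T.snd_one, h.zero, one_smul]
  mul_smul a b x := by
    change T.fst (a * b) • ψ (T.snd (a * b)) x = T.fst a • ψ (T.snd a) (T.fst b • ψ (T.snd b) x)
    rw [h.smul, ← h.add, T.snd_mul, T.fst_mul, mul_smul]

lemma smooth_flowAction (h : IsEquivariantFlow G ζ ψ) :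
    letI := T.flowAction h
    ContMDiffSMul 𝓘(ℝ, E) 𝓘(ℝ, F) ∞ T.Twisted M :=
  letI := T.flowAction h
  ⟨ContMDiff.comp (smooth₂_smul E G F M) ((T.smooth_fst.comp contMDiff_fst).prodMk
    (ContMDiff.comp h.smooth ((T.smooth_snd.comp contMDiff_fst).prodMk contMDiff_snd)))⟩

/-- The orbit map of a point `o` is that of `G` if the flow moves `o` by the one-parameter
subgroup. -/
lemma twisted_smul (h : IsEquivariantFlow G ζ ψ) {o : M} (ho : ∀ t, ψ t o = T.exp t • o)
    (a : T.Twisted) :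
    letI := T.flowAction h
    a • o = (show G from a) • o := by
  change T.fst a • ψ (T.snd a) o = _
  rw [ho, ← mul_smul]
  change ((show G from a) * T.exp (-T.char a) * T.exp (T.char a)) • o = _
  rw [mul_assoc, T.exp_neg_mul_exp, mul_one]

lemma fund_twisted (h : IsEquivariantFlow G ζ ψ) {o : M} (ho : ∀ t, ψ t o = T.exp t • o) :
    letI := T.flowAction h
    fund E T.Twisted F o = fund E G F o :=
  congrArg (fun f : G → M => mder E F f 1) (funext (T.twisted_smul h ho))

end TwistData

end TwistedGroup

/-! ### Presentations with the twisted group -/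

section TwistedPresentation

/-- The Jacobi identity. -/
lemma lbr_lbr {E : Type*} [NormedAddCommGroup E] [NormedSpace ℝ E] [CompleteSpace E]
    {G : Type*} [TopologicalSpace G] [ChartedSpace E G] [Group G] [LieGroup 𝓘(ℝ, E) ∞ G]
    (X Y Z : E) : lbr G X (lbr G Y Z) = lbr G (lbr G X Y) Z + lbr G Y (lbr G X Z) :=
  leibniz_lie (show GroupLieAlgebra 𝓘(ℝ, E) G from X) (show GroupLieAlgebra 𝓘(ℝ, E) G from Y)
    (show GroupLieAlgebra 𝓘(ℝ, E) G from Z)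

variable {F : Type w} [NormedAddCommGroup F] [NormedSpace ℝ F]
  {M : Type z} [TopologicalSpace M] [ChartedSpace F M] [IsManifold 𝓘(ℝ, F) ∞ M] {o : M}
  {g : M → F →L[ℝ] F →L[ℝ] ℝ} {J : M → F →L[ℝ] F} {ζ : M → F} {ψ : ℝ → M → M}

namespace HomogeneousPresentation

/-- The isotropy algebra of the twisted group contains no nonzero ideal: the images of an ideal of
the twisted group under the powers of `ad X` span an ideal of the original group. -/
lemma eq_zero_of_mem_ideal_twisted (P : HomogeneousPresentation.{u, v} F o)
    (T : TwistData P.E P.G)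
    (hchar : ∀ Y, fund P.E P.G F o Y = 0 → T.dchar Y = 0)
    (hgen : ∀ Y, fund P.E P.G F o Y = 0 → fund P.E P.G F o (lbr P.G T.gen Y) = 0)
    (I : Submodule ℝ P.E) (hI : ∀ Z, ∀ Y ∈ I, lbr T.Twisted Z Y ∈ I)
    (h0 : ∀ Y ∈ I, fund P.E P.G F o Y = 0) {Y : P.E} (hY : Y ∈ I) : Y = 0 := by
  let D : P.E → P.E := fun Y => lbr P.G T.gen Y
  let s : Set P.E := {W | ∃ n : ℕ, ∃ Y ∈ I, D^[n] Y = W}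
  have hs : ∀ W ∈ s, D W ∈ s := by
    rintro _ ⟨n, Y, hY, rfl⟩
    exact ⟨n + 1, Y, hY, Function.iterate_succ_apply' D n Y⟩
  have hK : ∀ W ∈ Submodule.span ℝ s, D W ∈ Submodule.span ℝ s := fun W hW => by
    induction hW using Submodule.span_induction with
    | mem W hW => exact Submodule.subset_span (hs W hW)
    | zero =>
      have h : D 0 = 0 := by simpa using lbr_smul_right (G := P.G) 0 T.gen 0
      rw [h]
      exact Submodule.zero_mem _
    | add V W _ _ hV hW =>
      have h : D (V + W) = D V + D W := lbr_add_right _ _ _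
      rw [h]
      exact Submodule.add_mem _ hV hW
    | smul t W _ hW =>
      have h : D (t • W) = t • D W := lbr_smul_right _ _ _
      rw [h]
      exact Submodule.smul_mem _ t hW
  have hs0 : ∀ n : ℕ, ∀ Y ∈ I, fund P.E P.G F o (D^[n] Y) = 0 := fun n Y hY => by
    induction n with
    | zero => exact h0 Y hY
    | succ n ih =>
      rw [Function.iterate_succ_apply']
      exact hgen _ ih
  have hid : ∀ n : ℕ, ∀ Y ∈ I, ∀ Z, lbr P.G Z (D^[n] Y) ∈ Submodule.span ℝ s := by
    intro n Y hY
    induction n with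
    | zero =>
      intro Z
      have h1 : lbr P.G Z Y = lbr T.Twisted Z Y + T.dchar Z • D Y := by
        rw [T.lbr_twisted, hchar Y (h0 Y hY), zero_smul, sub_zero, lbr_sub_left, lbr_smul_left]
        exact (sub_add_cancel _ _).symm
      rw [Function.iterate_zero_apply, h1]
      exact Submodule.add_mem _ (Submodule.subset_span ⟨0, _, hI Z Y hY, rfl⟩)
        (Submodule.smul_mem _ _ (Submodule.subset_span ⟨1, Y, hY, rfl⟩))
    | succ n ih =>
      intro Z
      rw [Function.iterate_succ_apply']
      change lbr P.G Z (lbr P.G T.gen _) ∈ _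
      rw [lbr_lbr]
      exact Submodule.add_mem _ (ih _) (hK _ (ih Z))
  refine P.eq_zero_of_mem_ideal (Submodule.span ℝ s) (fun Z W hW => ?_) (fun W hW => ?_)
    (Submodule.subset_span ⟨0, Y, hY, rfl⟩)
  · induction hW using Submodule.span_induction with
    | mem W hW =>
      obtain ⟨n, Y, hY, rfl⟩ := hW
      exact hid n Y hY Z
    | zero =>
      have h : lbr P.G Z 0 = 0 := by simpa using lbr_smul_right (G := P.G) 0 Z 0
      rw [h]
      exact Submodule.zero_mem _
    | add V W _ _ hV hW =>
      rw [lbr_add_right]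
      exact Submodule.add_mem _ hV hW
    | smul t W _ hW =>
      rw [lbr_smul_right]
      exact Submodule.smul_mem _ t hW
  · induction hW using Submodule.span_induction with
    | mem W hW =>
      obtain ⟨n, Y, hY, rfl⟩ := hW
      exact hs0 n Y hY
    | zero => exact map_zero _
    | add V W _ _ hV hW => rw [map_add, hV, hW, add_zero]
    | smul t W _ hW => rw [map_smul, hW, smul_zero]

/-- The presentation with the twisted group, which acts through its homomorphism to `G × ℝ`. The
orbit map of `o`, and with it the isotropy group and the isotropy algebra, does not change. -/
noncomputable def twist (P : HomogeneousPresentation.{u, v} F o) (T : TwistData P.E P.G)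
    (h : IsEquivariantFlow P.G ζ ψ) (hψ : ∀ t, ψ t o = T.exp t • o)
    (hchar : ∀ Y, fund P.E P.G F o Y = 0 → T.dchar Y = 0)
    (hgen : ∀ Y, fund P.E P.G F o Y = 0 → fund P.E P.G F o (lbr P.G T.gen Y) = 0) :
    HomogeneousPresentation.{u, v} F o :=
  letI := T.flowAction h
  haveI := T.smooth_flowAction h
  { E := P.E
    G := T.Twisted
    transitive := (MulAction.isPretransitive_iff_base o).2 fun x => by
      obtain ⟨a, ha⟩ := MulAction.exists_smul_eq P.G o x
      exact ⟨a, (T.twisted_smul h hψ a).trans ha⟩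
    isotropy_connected := by
      have h1 : (MulAction.stabilizer T.Twisted o : Set T.Twisted)
          = (MulAction.stabilizer P.G o : Set P.G) := by
        ext a
        exact (Eq.congr_left (T.twisted_smul h hψ a) : a • o = o ↔ _)
      rw [h1]
      exact P.isotropy_connected
    submersion := fun u => by
      obtain ⟨Y, hY⟩ := P.surjective_fund u
      exact ⟨Y, (congrArg (fun L : P.E →L[ℝ] F => L Y) (T.fund_twisted h hψ)).trans hY⟩
    almost_effective := fun I hI => by
      let I₀ : Submodule ℝ P.E :=
        { carrier := {Y : P.E | Y ∈ I}
          add_mem' := fun hY hZ => I.add_mem hY hZ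
          zero_mem' := I.zero_mem
          smul_mem' := fun t Y hY => I.smul_mem t hY }
      refine (LieSubmodule.eq_bot_iff _).2 fun Y hY => ?_
      exact P.eq_zero_of_mem_ideal_twisted T hchar hgen I₀ (fun Z Y hY => I.lie_mem hY)
        (fun Y hY => (congrArg (fun L : P.E →L[ℝ] F => L Y) (T.fund_twisted h hψ)).symm.trans
          (hI Y hY)) hY }

section

variable (P : HomogeneousPresentation.{u, v} F o) (T : TwistData P.E P.G)
    (h : IsEquivariantFlow P.G ζ ψ) (hψ : ∀ t, ψ t o = T.exp t • o)
    (hchar : ∀ Y, fund P.E P.G F o Y = 0 → T.dchar Y = 0)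
    (hgen : ∀ Y, fund P.E P.G F o Y = 0 → fund P.E P.G F o (lbr P.G T.gen Y) = 0)

lemma twist_smul (a : (P.twist T h hψ hchar hgen).G) :
    ∃ (b : P.G) (t : ℝ), ∀ x : M, a • x = b • ψ t x :=
  ⟨T.fst a, T.snd a, fun _ => rfl⟩

lemma twist_fund (v : P.E) :
    fund (P.twist T h hψ hchar hgen).E (P.twist T h hψ hchar hgen).G F o v = fund P.E P.G F o v :=
  congrArg (fun L : P.E →L[ℝ] F => L v) (T.fund_twisted h hψ)

lemma twist_lbr (v w : P.E) :
    lbr (E := (P.twist T h hψ hchar hgen).E) (P.twist T h hψ hchar hgen).G v w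
      = lbr P.G (v - T.dchar v • T.gen) (w - T.dchar w • T.gen) := T.lbr_twisted v w

/-- The homomorphism of the twisted Lie algebra to `𝔤` kills the generator `X`, if `χ'(X) = 1`. -/
lemma twist_isCentral_gen (h1 : T.dchar T.gen = 1) :
    (P.twist T h hψ hchar hgen).IsCentral T.gen := fun v => by
  refine (P.twist_lbr T h hψ hchar hgen T.gen v).trans ?_
  have h2 : T.gen - T.dchar T.gen • T.gen = 0 := by rw [h1, one_smul, sub_self]
  have h3 : ∀ Z : P.E, lbr P.G (0 : P.E) Z = 0 := fun Z => by
    simpa using lbr_smul_left (G := P.G) 0 (0 : P.E) Z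
  rw [h2]
  exact h3 _

lemma twist_isotropyDim : (P.twist T h hψ hchar hgen).isotropyDim = P.isotropyDim := by
  have h1 := (P.twist T h hψ hchar hgen).isotropyDim_add_finrank
  have h2 := P.isotropyDim_add_finrank
  exact Nat.add_right_cancel (h1.trans h2.symm)

/-- The Lie algebra of the twisted group is `{(Y, -χ'(Y) ad X)}` in `𝔤 ⋊ ℝ ad X`. -/
lemma twist_isModificationStep
    (hgJ : IsMetricEndo g J) (hG : IsInvariantMetricEndo P.G g J)
    (hζ : IsInvariantAutField P.E P.G g J ζ) (hX : fund P.E P.G F o T.gen = ζ o) :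
    LiePair.IsModificationStep (V := TangentSpace 𝓘(ℝ, F) o) (fun u v => g o u v) (J o) P.pair
      (P.twist T h hψ hchar hgen).pair := by
  refine P.isModificationStep_of_autField (P.twist T h hψ hchar hgen) hgJ hG hζ hX
    (LinearMap.id : P.E →ₗ[ℝ] P.E) (-T.dchar.toLinearMap) (fun v w => ?_) (fun v w => ?_)
    (fun v => P.twist_fund T h hψ hchar hgen v) (Or.inr Function.bijective_id)
  · let v' : P.E := v
    let w' : P.E := w
    refine (P.twist_lbr T h hψ hchar hgen v' w').trans ?_
    change _ = lbr P.G v' w' + (-T.dchar v') • lbr P.G T.gen w' - (-T.dchar w') • lbr P.G T.gen v'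
    simp only [lbr_sub_left, lbr_sub_right, lbr_smul_left, lbr_smul_right, lbr_self]
    rw [lbr_skew v' T.gen]
    module
  · exact (congrArg Neg.neg (T.dchar_lbr v w)).trans neg_zero

end

end HomogeneousPresentation

end TwistedPresentation

/-! ### The center of the modified Lie algebra -/

section Center

variable {F : Type w} [NormedAddCommGroup F] [NormedSpace ℝ F] [FiniteDimensional ℝ F]
  {M : Type z} [TopologicalSpace M] [ChartedSpace F M] [IsManifold 𝓘(ℝ, F) ∞ M] {o : M}
  {g : M → F →L[ℝ] F →L[ℝ] ℝ} {J : M → F →L[ℝ] F} {ζ : M → F} {ψ : ℝ → M → M}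

namespace HomogeneousPresentation

/-- By almost effectiveness, the center embeds into the tangent space at the base point. -/
lemma centerDim_eq (P : HomogeneousPresentation.{u, v} F o) (N : Submodule ℝ F)
    (h1 : ∀ W, P.IsCentral W → fund P.E P.G F o W ∈ N)
    (h2 : ∀ u ∈ N, ∃ W, P.IsCentral W ∧ fund P.E P.G F o W = u) : P.centerDim = finrank ℝ N := by
  have hmem : ∀ W : P.lieAlg, W ∈ LieAlgebra.center ℝ P.lieAlg ↔ P.IsCentral W := fun W => by
    rw [LieModule.mem_maxTrivSubmodule]
    refine forall_congr' fun Z => ?_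
    rw [← lie_skew, neg_eq_zero]
    rfl
  let f : LieAlgebra.center ℝ P.lieAlg →ₗ[ℝ] TangentSpace 𝓘(ℝ, F) o :=
    (orbitDeriv P.E P.G F o).domRestrict (LieAlgebra.center ℝ P.lieAlg).toSubmodule
  have hf : Function.Injective f := by
    rw [← LinearMap.ker_eq_bot, LinearMap.ker_eq_bot']
    exact fun W hW => Subtype.ext (P.eq_zero_of_isCentral ((hmem W.1).1 W.2) hW)
  have hr : LinearMap.range f = N := by
    ext x
    constructor
    · rintro ⟨W, rfl⟩
      exact h1 _ ((hmem W.1).1 W.2)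
    · intro hx
      obtain ⟨W, hW, rfl⟩ := h2 x hx
      exact ⟨⟨W, (hmem W).2 hW⟩, rfl⟩
  have h := LinearMap.finrank_range_of_inj hf
  rw [hr] at h
  exact h.symm

variable [T2Space M]

/-- An invariant vector field has a flow that moves `o` by a one-parameter subgroup. -/
lemma exists_exp_flow (P : HomogeneousPresentation.{u, v} F o) (hζ : IsSmoothVF (F := F) ζ)
    (hinv : IsInvariantVF P.G ζ) :
    ∃ (e : ℝ → P.G) (ψ : ℝ → M → M), Smooth ℝ P.E e ∧ (∀ s t, e (s + t) = e s * e t) ∧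
      fund P.E P.G F o (mder ℝ P.E e 0 1) = ζ o ∧ IsEquivariantFlow P.G ζ ψ ∧
      ∀ t, ψ t o = e t • o := by
  obtain ⟨X, hX⟩ := P.surjective_fund (ζ o)
  obtain ⟨e, he, hadd, hder⟩ := exists_oneParameterSubgroup (G := P.G) X
  obtain ⟨ψ, hψ, ho⟩ := exists_isEquivariantFlow hζ hinv P.surjective_fund hX he hadd hder
  exact ⟨e, ψ, he, hadd, hder.symm ▸ hX, hψ, ho⟩

/-- After a modification that raises the dimension of the isotropy group by at most one, an
invariant infinitesimal automorphism is represented by a central element of the Lie algebra, and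
central elements of the old Lie algebra remain. -/
lemma exists_central_of_autField (P : HomogeneousPresentation.{u, v} F o)
    (hgJ : IsMetricEndo g J) (hG : IsInvariantMetricEndo P.G g J)
    (hζ : IsInvariantAutField P.E P.G g J ζ) (C : (M → M) → Prop) (hP : ∀ a : P.G, C fun x => a • x)
    (hC : ∀ ψ, IsEquivariantFlow P.G ζ ψ → ∀ (a : P.G) (t : ℝ), C fun x => a • ψ t x) :
    ∃ P' : HomogeneousPresentation.{u, v} F o, (∀ a : P'.G, C fun x => a • x) ∧
      LiePair.IsModification (V := TangentSpace 𝓘(ℝ, F) o) (fun u v => g o u v) (J o) P.pair P'.pair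
      ∧ P'.isotropyDim ≤ P.isotropyDim + 1
      ∧ (∃ W, P'.IsCentral W ∧ fund P'.E P'.G F o W = ζ o)
      ∧ ∀ W, P.IsCentral W → ∃ W', P'.IsCentral W' ∧
        fund P'.E P'.G F o W' = fund P.E P.G F o W := by
  by_cases hne : ∃ W, P.IsCentral W ∧ fund P.E P.G F o W = ζ o
  · exact ⟨P, hP, Relation.ReflTransGen.refl, Nat.le_succ _, hne, fun W hW => ⟨W, hW, rfl⟩⟩
  push Not at hne
  obtain ⟨e, ψ, he, hadd, hX, hψ, ho⟩ := P.exists_exp_flow hζ.smooth hζ.invariant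
  refine ⟨P.prodReal hψ he hadd ho hne, fun a => ?_,
    Relation.ReflTransGen.single (P.prodReal_isModificationStep hψ he hadd ho hne hgJ hG hζ hX),
    (P.prodReal_isotropyDim hψ he hadd ho hne).le,
    ⟨((0 : P.E), (1 : ℝ)), P.prodReal_isCentral hψ he hadd ho hne (W := 0) (fun Z => ?_) 1, ?_⟩,
    fun W hW => ⟨(W, (0 : ℝ)), P.prodReal_isCentral hψ he hadd ho hne hW 0, ?_⟩⟩
  · obtain ⟨b, t, h⟩ := P.prodReal_smul hψ he hadd ho hne a
    rw [funext h]
    exact hC ψ hψ b t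
  · simpa using lbr_smul_left (G := P.G) 0 (0 : P.E) Z
  · refine (P.prodReal_fund hψ he hadd ho hne (0, 1)).trans ?_
    rw [map_zero, one_smul, zero_add]
  · refine (P.prodReal_fund hψ he hadd ho hne (W, 0)).trans ?_
    rw [zero_smul, add_zero]

end HomogeneousPresentation

end Center

section Automorphisms

variable {F : Type w} [NormedAddCommGroup F] [NormedSpace ℝ F]
  {M : Type z} [TopologicalSpace M] [ChartedSpace F M] [IsManifold 𝓘(ℝ, F) ∞ M] {o : M}
  {E : Type*} [NormedAddCommGroup E] [NormedSpace ℝ E]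
  {G : Type*} [TopologicalSpace G] [ChartedSpace E G] [Group G] [LieGroup 𝓘(ℝ, E) ∞ G]
  [MulAction G M] [ContMDiffSMul 𝓘(ℝ, E) 𝓘(ℝ, F) ∞ G M] {ζ : M → F} {ψ : ℝ → M → M}

lemma IsEquivariantFlow.mder_smul (E : Type*) [NormedAddCommGroup E] [NormedSpace ℝ E]
    {G : Type*} [TopologicalSpace G] [ChartedSpace E G] [Group G] [LieGroup 𝓘(ℝ, E) ∞ G]
    [MulAction G M] [ContMDiffSMul 𝓘(ℝ, E) 𝓘(ℝ, F) ∞ G M] (h : IsEquivariantFlow G ζ ψ)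
    (a : G) (t : ℝ) (x : M) (u : F) :
    mder F F (fun x => a • ψ t x) x u = actDeriv F a (ψ t x) (mder F F (ψ t) x u) :=
  mder_comp' (E := F) (F := F) (F' := F) (g := fun x => a • x) (f := ψ t) x
    ((smooth_smul_left E F M a).mdAt _) ((h.smooth_right t).mdAt _) u

lemma VaismanStructure.isAutomorphism_iff (S : VaismanStructure F M) (Ψ : M → M) :
    S.IsAutomorphism Ψ ↔ ∀ x u,
      (∀ v, S.metric (Ψ x) (mder F F Ψ x u) (mder F F Ψ x v) = S.metric x u v) ∧
      mder F F Ψ x (S.endo x u) = S.endo (Ψ x) (mder F F Ψ x u) := Iff.rfl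

lemma SasakiStructure.isAutomorphism_iff (S : SasakiStructure F M) (Ψ : M → M) :
    S.IsAutomorphism Ψ ↔ ∀ x u, S.form (Ψ x) (mder F F Ψ x u) = S.form x u ∧
      (S.form x u = 0 → mder F F Ψ x (S.endo x u) = S.endo (Ψ x) (mder F F Ψ x u)) := Iff.rfl

variable [MulAction.IsPretransitive G M]

lemma VaismanStructure.isAutomorphism_smul_flow {S : VaismanStructure F M}
    (hG : ∀ a : G, S.IsAutomorphism (fun x => a • x)) (hsub : Function.Surjective (fund E G F o))
    (hζ : IsInvariantAutField E G S.metric S.endo ζ) (h : IsEquivariantFlow G ζ ψ) (a : G) (t : ℝ) :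
    S.IsAutomorphism (fun x => a • ψ t x) := by
  rw [isAutomorphism_iff]
  intro x u
  obtain ⟨h1, h2⟩ := h.metric_endo hsub S.isMetricEndo hζ t x
  have h3 := S.isInvariantMetricEndo hG
  refine ⟨fun v => ?_, ?_⟩
  · rw [h.mder_smul E, h.mder_smul E, h3.metric, h1]
  · rw [h.mder_smul E, h.mder_smul E, h2, h3.endo]

lemma SasakiStructure.isAutomorphism_smul_flow [FiniteDimensional ℝ F] {S : SasakiStructure F M}
    (hG : ∀ a : G, S.IsAutomorphism (fun x => a • x)) (hsub : Function.Surjective (fund E G F o))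
    (h : IsEquivariantFlow G S.reeb ψ) (a : G) (t : ℝ) :
    S.IsAutomorphism (fun x => a • ψ t x) := by
  rw [isAutomorphism_iff]
  intro x u
  have h2 := (h.metric_endo hsub S.isMetricEndo (S.reeb_isInvariantAutField hG hsub) t x).2
  have h3 := S.isInvariantMetricEndo hG hsub
  have h4 := h.oneForm hsub (fun Y => S.smooth_form (isSmoothVF_fund Y)) (S.mder_form_reeb hG) t x
  refine ⟨?_, fun _ => ?_⟩
  · rw [h.mder_smul E, S.form_actDeriv hG, h4]
  · rw [h.mder_smul E, h.mder_smul E, h2, h3.endo]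

end Automorphisms

section Main

variable {F : Type w} [NormedAddCommGroup F] [NormedSpace ℝ F] [FiniteDimensional ℝ F]
  {M : Type z} [TopologicalSpace M] [ChartedSpace F M] [IsManifold 𝓘(ℝ, F) ∞ M] {o : M}

namespace HomogeneousPresentation

lemma IsCentral.smul_add_smul {P : HomogeneousPresentation.{u, v} F o} {W W' : P.E}
    (hW : P.IsCentral W) (hW' : P.IsCentral W') (s t : ℝ) : P.IsCentral (s • W + t • W') :=
  fun Z => by rw [lbr_add_left, lbr_smul_left, lbr_smul_left, hW, hW', smul_zero, smul_zero,
    add_zero]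

end HomogeneousPresentation

lemma VaismanStructure.linearIndependent_lee {S : VaismanStructure F M} {x : M}
    (hpos : 0 < S.leeForm x (S.leeField x)) :
    LinearIndependent ℝ ![S.leeField x, S.rotatedLeeField x] := by
  rw [LinearIndependent.pair_iff]
  intro s t h
  have h1 := congrArg (S.leeForm x) h
  have h2 := congrArg (fun u => S.leeForm x (S.endo x u)) h
  simp only [map_add, map_smul, map_zero, map_neg, S.endo_rotatedLeeField] at h1 h2
  have h3 : S.leeForm x (S.endo x (S.leeField x)) = 0 := S.leeForm_rotatedLeeField x
  rw [S.leeForm_rotatedLeeField, smul_zero, add_zero, smul_eq_mul] at h1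
  rw [h3, smul_zero, zero_add, smul_eq_mul] at h2
  exact ⟨(mul_eq_zero.1 h1).resolve_right hpos.ne',
    (mul_eq_zero.1 h2).resolve_right (neg_ne_zero.2 hpos.ne')⟩

/-- The center is identified with the span of the Lee field and the rotated Lee field at `o`, which
are linearly independent. -/
lemma VaismanStructure.centerDim_eq_two {S : VaismanStructure F M}
    {P : HomogeneousPresentation.{u, v} F o} (hG : ∀ a : P.G, S.IsAutomorphism (fun x => a • x))
    (h1 : ∃ W, P.IsCentral W ∧ fund P.E P.G F o W = S.leeField o)
    (h2 : ∃ W, P.IsCentral W ∧ fund P.E P.G F o W = S.rotatedLeeField o) : P.centerDim = 2 := by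
  have hpos := S.leeForm_leeField_pos hG P.surjective_fund o
  have hr : Set.range ![S.leeField o, S.rotatedLeeField o]
      = {S.leeField o, S.rotatedLeeField o} := Matrix.range_cons_cons_empty _ _ _
  rw [P.centerDim_eq (Submodule.span ℝ (Set.range ![S.leeField o, S.rotatedLeeField o])),
    finrank_span_eq_card (S.linearIndependent_lee hpos), Fintype.card_fin]
  · intro W hW
    rw [hr]
    have h := S.fund_of_central hG P.surjective_fund hW o
    rw [← Submodule.smul_mem_iff _ hpos.ne', h]
    exact Submodule.sub_mem _ (Submodule.smul_mem _ _ (Submodule.subset_span (by simp)))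
      (Submodule.smul_mem _ _ (Submodule.subset_span (by simp)))
  · intro u hu
    rw [hr, Submodule.mem_span_pair] at hu
    obtain ⟨s, t, rfl⟩ := hu
    obtain ⟨W, hW, hW1⟩ := h1
    obtain ⟨W', hW', hW1'⟩ := h2
    exact ⟨s • W + t • W', hW.smul_add_smul hW' s t, by rw [map_add, map_smul, map_smul, hW1, hW1']⟩

lemma SasakiStructure.centerDim_eq_one {S : SasakiStructure F M}
    {P : HomogeneousPresentation.{u, v} F o} (hG : ∀ a : P.G, S.IsAutomorphism (fun x => a • x))
    (h1 : ∃ W, P.IsCentral W ∧ fund P.E P.G F o W = S.reeb o) : P.centerDim = 1 := by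
  have hne : S.reeb o ≠ 0 := fun h => by
    have := S.form_reeb o
    rw [h, map_zero] at this
    exact zero_ne_one this
  rw [P.centerDim_eq (Submodule.span ℝ {S.reeb o}), finrank_span_singleton hne]
  · intro W hW
    rw [S.fund_of_central hG P.surjective_fund hW o]
    exact Submodule.smul_mem _ _ (Submodule.mem_span_singleton_self _)
  · intro u hu
    obtain ⟨t, rfl⟩ := Submodule.mem_span_singleton.1 hu
    obtain ⟨W, hW, hW1⟩ := h1
    exact ⟨t • W, fun Z => by rw [lbr_smul_left, hW, smul_zero], by rw [map_smul, hW1]⟩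

variable [T2Space M]

/-- After twisting the group by the character that is given by the Lee form, the Lee field comes
from a central element of the Lie algebra. -/
lemma VaismanStructure.exists_central_leeField {S : VaismanStructure F M}
    (P : HomogeneousPresentation.{u, v} F o) (hG : ∀ a : P.G, S.IsAutomorphism (fun x => a • x)) :
    ∃ P' : HomogeneousPresentation.{u, v} F o, (∀ a : P'.G, S.IsAutomorphism fun x => a • x) ∧
      LiePair.IsModificationStep (V := TangentSpace 𝓘(ℝ, F) o) (fun u v => S.metric o u v)
        (S.endo o) P.pair P'.pair
      ∧ P'.isotropyDim = P.isotropyDim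
      ∧ ∃ W, P'.IsCentral W ∧ fund P'.E P'.G F o W = S.leeField o := by
  have hs := P.surjective_fund
  have hpos := S.leeForm_leeField_pos hG hs o
  have hζ := S.leeField_isInvariantAutField hG hs
  obtain ⟨e, ψ, he, hadd, hX, hψ, ho⟩ := P.exists_exp_flow hζ.smooth hζ.invariant
  let l : P.E →L[ℝ] ℝ :=
    (S.leeForm o (S.leeField o))⁻¹ • (S.leeForm o).comp (fund P.E P.G F o)
  have hl : ∀ Y, l Y = (S.leeForm o (S.leeField o))⁻¹ * S.leeForm o (fund P.E P.G F o Y) :=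
    fun Y => rfl
  obtain ⟨χ, hχ, hχmul, hχl⟩ := exists_character (G := P.G) (l := l) fun Y Z => by
    have h := S.leeForm_mbr hG hs Y Z o
    rw [mbr_fund_fund, map_neg, neg_eq_zero] at h
    rw [hl, h, mul_zero]
  let T : TwistData P.E P.G := ⟨e, χ, he, hadd, hχ, hχmul⟩
  have hT : ∀ Y, T.dchar Y
      = (S.leeForm o (S.leeField o))⁻¹ * S.leeForm o (fund P.E P.G F o Y) := fun Y =>
    (congrArg (fun L : P.E →L[ℝ] ℝ => L Y) hχl).trans (hl Y)
  have hXT : fund P.E P.G F o T.gen = S.leeField o := hX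
  obtain ⟨τ, hτ, -, -⟩ := hζ.exists_induced hs S.isMetricEndo (S.isInvariantMetricEndo hG) hXT
  have hchar : ∀ Y, fund P.E P.G F o Y = 0 → T.dchar Y = 0 := fun Y hY => by
    rw [hT, hY, map_zero, mul_zero]
  have hgen : ∀ Y, fund P.E P.G F o Y = 0 → fund P.E P.G F o (lbr P.G T.gen Y) = 0 :=
    fun Y hY => by rw [hτ, hY, map_zero]
  refine ⟨P.twist T hψ ho hchar hgen, fun a => ?_,
    P.twist_isModificationStep T hψ ho hchar hgen S.isMetricEndo (S.isInvariantMetricEndo hG) hζ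
      hXT,
    P.twist_isotropyDim T hψ ho hchar hgen, T.gen,
    P.twist_isCentral_gen T hψ ho hchar hgen ?_,
    (P.twist_fund T hψ ho hchar hgen T.gen).trans hXT⟩
  · obtain ⟨b, t, h⟩ := P.twist_smul T hψ ho hchar hgen a
    rw [funext h]
    exact S.isAutomorphism_smul_flow hG hs hζ hψ b t
  · rw [hT, hXT, inv_mul_cancel₀ hpos.ne']

end Main

theorem lemma1p1
    {F : Type w} [NormedAddCommGroup F] [NormedSpace ℝ F] [FiniteDimensional ℝ F]
    {M : Type z} [TopologicalSpace M] [T2Space M] [ChartedSpace F M] [IsManifold 𝓘(ℝ, F) ∞ M]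
    (o : M) :
    (∀ (S : VaismanStructure F M) (P : HomogeneousPresentation.{u, v} F o),
      (∀ a : P.G, S.IsAutomorphism (fun x => a • x)) →
      ∃ P' : HomogeneousPresentation.{u, v} F o,
        (∀ a : P'.G, S.IsAutomorphism (fun x => a • x)) ∧
        LiePair.IsModification (fun X Y => S.g.inner o X Y) (S.J o) P.pair P'.pair ∧
        P'.centerDim = 2 ∧
        P'.isotropyDim ≤ P.isotropyDim + 1) ∧
    (∀ (S : SasakiStructure F M) (P : HomogeneousPresentation.{u, v} F o),
      (∀ a : P.G, S.IsAutomorphism (fun x => a • x)) →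
      ∃ P' : HomogeneousPresentation.{u, v} F o,
        (∀ a : P'.G, S.IsAutomorphism (fun x => a • x)) ∧
        LiePair.IsModification (fun X Y => S.g.inner o X Y) (S.J o) P.pair P'.pair ∧
        P'.centerDim = 1) := by
  refine ⟨fun S P hG => ?_, fun S P hG => ?_⟩
  · obtain ⟨P₁, hG₁, hstep, hdim, W, hW, hW1⟩ := S.exists_central_leeField P hG
    have hs := P₁.surjective_fund
    have hζ := S.rotatedLeeField_isInvariantAutField hG₁ hs
    obtain ⟨P₂, hG₂, hmod, hdim₂, hJ, hcen⟩ := P₁.exists_central_of_autField S.isMetricEndo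
      (S.isInvariantMetricEndo hG₁) hζ S.IsAutomorphism hG₁
      fun ψ hψ a t => S.isAutomorphism_smul_flow hG₁ hs hζ hψ a t
    obtain ⟨W', hW', hW1'⟩ := hcen W hW
    exact ⟨P₂, hG₂, (Relation.ReflTransGen.single hstep).trans hmod,
      S.centerDim_eq_two hG₂ ⟨W', hW', hW1'.trans hW1⟩ hJ, hdim ▸ hdim₂⟩
  · have hs := P.surjective_fund
    obtain ⟨P', hG', hmod, -, hη, -⟩ := P.exists_central_of_autField S.isMetricEndo
      (S.isInvariantMetricEndo hG hs) (S.reeb_isInvariantAutField hG hs) S.IsAutomorphism hG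
      fun ψ hψ a t => S.isAutomorphism_smul_flow hG hs hψ a t
    exact ⟨P', hG', hmod, S.centerDim_eq_one hG' hη⟩
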